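/- Let $d\ge 3$, $\lambda>0$, and let $h:(0,\infty)\to[0,\infty)$ be of class $C^3$ with $h''>0$, $h'''<0$ and $\lim_{v\to0}h(v)=\lim_{v\to\infty}h(v)=\infty$. For $F\in\mathbb R^{d\times d}$ with $\det F>0$ let $W(F)=\Phi(\lambda_1,\dots,\lambda_d)=\frac12\sum_i\lambda_i^2+h\big(\prod_i\lambda_i\big)$, where $\lambda_1,\dots,\lambda_d$ are the eigenvalues of $\sqrt{FF^T}$, and let $S=\partial W/\partial F$. For $w=w(R,t)$ the radial motion with amplitude $w$ is $\mathbf y(\mathbf x,t)=w(|\mathbf x|,t)\,\mathbf x/|\mathbf x|$. Write $\Phi_1(a,b)=a+b^{d-1}h'(ab^{d-1})$ and $\Phi_2(a,b)=b+ab^{d-2}h'(ab^{d-1})$ for $\partial\Phi/\partial\lambda_1$, $\partial\Phi/\partial\lambda_2$ at $(a,b,\dots,b)$, and $c^2(a,b)=1+b^{2(d-1)}h''(ab^{d-1})$. *Cavitating solution (of Pericak-Spector and Spector).* Let $\sigma>0$ and let $r:[0,\infty)\to\mathbb R$ be continuous with $r(0)>0$, of class $C^2$ with $r'>0$ on $(0,\sigma)$,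 and $r(s)=\lambda s$ for $s\ge\sigma$, such that * $s^2r''=s^{1-d}\frac{d}{ds}\big(s^{d-1}\Phi_1(r',r/s)\big)-\frac{d-1}{s}\Phi_2(r',r/s)$ on $(0,\sigma)$, i.e. $w=t\,r(R/t)$ solves $w_{tt}=R^{1-d}\partial_R\big(R^{d-1}\Phi_1(w_R,w/R)\big)-\frac{d-1}{R}\Phi_2(w_R,w/R)$ for $0<R<\sigma t$; * the surface of the cavity is free of Cauchy stress: $(r/s)^{1-d}\,\Phi_1(r',r/s)\to0$ as $s\to0^+$; * the limit $a=r'(\sigma-)>0$ exists, and the Rankine–Hugoniot condition $\sigma^2(\lambda-a)=\Phi_1(\lambda,\lambda)-\Phi_1(a,\lambda)$ and the Lax condition $c^2(\lambda,\lambda)<\sigma^2<c^2(a,\lambda)$ hold. Let $\mathbf y$ be the radial motion with amplitude $w(R,t)=t\,r(R/t)$ for $t>0$ and $w(R,t)=\lambda R$ for $t\le0$, so that $\mathbf y=\lambda\mathbf x$ for $t\le 0$. *Slic-solutions.* Let $\mathbf y\in L^\infty_{loc}(\mathbb R;L^1_{loc}(\mathbb R^d;\mathbb R^d))$ be the radial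 motion with an amplitude $w\ge0$ that is monotone increasing in $R$, and let $\mathbf y=\lambda\mathbf x$ for $t\le0$ and, for some $\bar r>0$, for $t>0$, $|\mathbf x|>\bar r t$. For $\phi\in C_c^\infty(\mathbb R)$ with $\phi\ge0$, $\phi(-x)=\phi(x)$, $\int\phi=1$, $\operatorname{supp}\phi\subset[-1,1]$, $\phi(0)>0$, and $n\ge1$, put $\phi_n(R)=n\phi(nR)$ and let $\mathbf y^n$ be the radial motion with amplitude $$w^n(R,t)=\int_0^\infty\phi_n(R-\rho)\,w(\rho,t)\,d\rho-\int_0^\infty\phi_n(R+\rho)\,w(\rho,t)\,d\rho .$$ Then $\mathbf y$ is a slic-solution of $\mathbf y_{tt}=\operatorname{div}S(\nabla\mathbf y)$ if for all such $\phi$: for every $n\ge1$ there is $\varepsilon_n>0$ with $\det\nabla\mathbf y^n\ge\varepsilon_n$ on $\mathbb R^d\times\mathbb R$, and for every $\psi\in C_c^2(\mathbb R^d\times\mathbb R;\mathbb R^d)$ the integrand below is integrable for every $n\ge 1$ and $$\int_{\mathbb R}\int_{\mathbb R^d}\mathbf y^n\cdot\partial_{tt}\psi+S(\nabla\mathbf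 y^n):\nabla\psi\,d\mathbf x\,dt\to0\qquad(n\to\infty).$$ **Theorem.** The cavitating solution $\mathbf y$ is a weak solution on $\mathbb R^d\times\mathbb R$, i.e. for all $\psi\in C_c^\infty(\mathbb R^d\times\mathbb R;\mathbb R^d)$ the function $\mathbf y\cdot\partial_{tt}\psi+S(\nabla\mathbf y):\nabla\psi$ is integrable with integral $0$. It is a slic-solution if $$\lim_{v\to\infty}\frac{h'(v^d)}{v}=0,$$ and it is not a slic-solution if $$\liminf_{v\to\infty}\frac{h'(v^d)}{v}>0 .$$ -/

import Mathlib

open Filter Topology MeasureTheory Set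

/-- The hypotheses on the volumetric part `h : (0,∞) → [0,∞)` of the stored energy: three times
continuously differentiable, with positive second and negative third derivative, blowing up at
`0` and at `∞`. Values of `h` outside `(0,∞)` play no role. -/
structure IsVolumetricEnergy (h : ℝ → ℝ) : Prop where
  contDiffOn : ContDiffOn ℝ 3 h (Ioi 0)
  nonneg : ∀ v, 0 < v → 0 ≤ h v
  second_pos : ∀ v, 0 < v → 0 < iteratedDeriv 2 h v
  third_neg : ∀ v, 0 < v → iteratedDeriv 3 h v < 0
  tendsto_zero : Tendsto h (𝓝[>] 0) atTop
  tendsto_top : Tendsto h atTop atTop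

/-- The principal stretches of a deformation gradient `F`: the eigenvalues of `√(F Fᵀ)`. -/
noncomputable def principalStretch {d : ℕ} (F : Matrix (Fin d) (Fin d) ℝ) (i : Fin d) : ℝ :=
  Real.sqrt ((Matrix.isHermitian_mul_conjTranspose_self F).eigenvalues i)

/-- The stored energy `W(F) = ½ ∑ λᵢ² + h (∏ λᵢ)`, with `λᵢ` the principal stretches of `F`. -/
noncomputable def storedEnergy {d : ℕ} (h : ℝ → ℝ) (F : Matrix (Fin d) (Fin d) ℝ) : ℝ :=
  (1 / 2) * ∑ i, principalStretch F i ^ 2 + h (∏ i, principalStretch F i)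

/-- The Piola-Kirchhoff stress `S(F) = ∂W/∂F`, entry by entry. -/
noncomputable def piolaStress {d : ℕ} (h : ℝ → ℝ) (F : Matrix (Fin d) (Fin d) ℝ) :
    Matrix (Fin d) (Fin d) ℝ :=
  Matrix.of fun i j => lineDeriv ℝ (storedEnergy h) F (Matrix.single i j 1)

/-- The spatial gradient `(∇f)ᵢⱼ = ∂ⱼ fᵢ` of a vector field. -/
noncomputable def gradMatrix {d : ℕ} (f : EuclideanSpace ℝ (Fin d) → EuclideanSpace ℝ (Fin d))
    (x : EuclideanSpace ℝ (Fin d)) : Matrix (Fin d) (Fin d) ℝ :=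
  Matrix.of fun i j => (fderiv ℝ f x (EuclideanSpace.single j 1)) i

/-- The integrand `y · ∂ₜₜψ + S(∇y) : ∇ψ` of the weak form of `yₜₜ = div S(∇y)`, at `(x, t)`. -/
noncomputable def momentumIntegrand {d : ℕ} (h : ℝ → ℝ)
    (y : EuclideanSpace ℝ (Fin d) → ℝ → EuclideanSpace ℝ (Fin d))
    (ψ : EuclideanSpace ℝ (Fin d) × ℝ → EuclideanSpace ℝ (Fin d))
    (x : EuclideanSpace ℝ (Fin d)) (t : ℝ) : ℝ :=
  inner ℝ (y x t) (iteratedDeriv 2 (fun τ => ψ (x, τ)) t) +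
    ∑ i, ∑ j, piolaStress h (gradMatrix (fun z => y z t) x) i j *
      gradMatrix (fun z => ψ (z, t)) x i j

/-- Weak solutions of `yₜₜ = div S(∇y)` on all of `ℝᵈ × ℝ`. The gradient is the pointwise one, so
this is meant for motions that are locally of class `W^{1,1}` and differentiable almost
everywhere. -/
def IsWeakSolution {d : ℕ} (h : ℝ → ℝ)
    (y : EuclideanSpace ℝ (Fin d) → ℝ → EuclideanSpace ℝ (Fin d)) : Prop :=
  ∀ ψ : EuclideanSpace ℝ (Fin d) × ℝ → EuclideanSpace ℝ (Fin d),
    ContDiff ℝ (⊤ : ℕ∞) ψ → HasCompactSupport ψ →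
      Integrable (fun p : EuclideanSpace ℝ (Fin d) × ℝ => momentumIntegrand h y ψ p.1 p.2) ∧
      ∫ t, ∫ x, momentumIntegrand h y ψ x t = 0

/-- The radial motion `y(x,t) = w(|x|,t) x/|x|` with amplitude `w` (`w` takes first the radius,
then the time; the value at `x = 0` is `0`). -/
noncomputable def radialMotion (d : ℕ) (w : ℝ → ℝ → ℝ)
    (x : EuclideanSpace ℝ (Fin d)) (t : ℝ) : EuclideanSpace ℝ (Fin d) :=
  (w ‖x‖ t / ‖x‖) • x

/-- Admissible mollifiers on the line: smooth, nonnegative, even, of integral one, supported in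
`[-1,1]`, and positive at the origin. -/
structure IsRadialMollifier (φ : ℝ → ℝ) : Prop where
  smooth : ContDiff ℝ (⊤ : ℕ∞) φ
  nonneg : ∀ x, 0 ≤ φ x
  even : ∀ x, φ (-x) = φ x
  integral_one : ∫ x, φ x = 1
  support_subset : tsupport φ ⊆ Icc (-1) 1
  pos_zero : 0 < φ 0

/-- `wⁿ(R,t) = ∫₀^∞ φₙ(R - ρ) w(ρ,t) dρ - ∫₀^∞ φₙ(R + ρ) w(ρ,t) dρ` with `φₙ(R) = n φ(nR)`: the
mollification in `R` of the odd extension of `w`. -/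
noncomputable def mollifiedAmplitude (φ : ℝ → ℝ) (n : ℕ) (w : ℝ → ℝ → ℝ) (R t : ℝ) : ℝ :=
  (∫ ρ in Ioi (0 : ℝ), n * φ (n * (R - ρ)) * w ρ t) -
    ∫ ρ in Ioi (0 : ℝ), n * φ (n * (R + ρ)) * w ρ t

/-- `y ∈ L^∞_loc(ℝ; L¹_loc(ℝᵈ; ℝᵈ))`. -/
def IsLocBoundedL1 {d : ℕ} (y : EuclideanSpace ℝ (Fin d) → ℝ → EuclideanSpace ℝ (Fin d)) :
    Prop :=
  AEStronglyMeasurable (fun p : EuclideanSpace ℝ (Fin d) × ℝ => y p.1 p.2) volume ∧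
  ∀ T M : ℝ, ∃ C : NNReal, ∀ᵐ t : ℝ, |t| ≤ T →
    ∫⁻ x in Metric.closedBall (0 : EuclideanSpace ℝ (Fin d)) M, ‖y x t‖ₑ ≤ C

/-- The radial motion `y` with amplitude `w` is a singular limiting induced from continuum (slic)
solution of `yₜₜ = div S(∇y)`, with the homogeneous deformation `lam • x` for `t ≤ 0` and for
`|x| > rbar t`. Here `yⁿ` is the radial motion whose amplitude is the mollified one. -/
structure IsSlicSolution (d : ℕ) (h : ℝ → ℝ) (lam : ℝ) (w : ℝ → ℝ → ℝ) : Prop where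
  amplitude_nonneg : ∀ R t, 0 ≤ R → 0 ≤ w R t
  locBounded : IsLocBoundedL1 (radialMotion d w)
  monotone : ∀ t, MonotoneOn (fun R => w R t) (Ici 0)
  eq_of_nonpos : ∀ x t, t ≤ 0 → radialMotion d w x t = lam • x
  eq_of_far : ∃ rbar : ℝ, 0 < rbar ∧
    ∀ x t, 0 < t → rbar * t < ‖x‖ → radialMotion d w x t = lam • x
  det_bound : ∀ φ, IsRadialMollifier φ → ∀ n : ℕ, 1 ≤ n → ∃ ε : ℝ, 0 < ε ∧ ∀ x t,
    ε ≤ (gradMatrix (fun z => radialMotion d (mollifiedAmplitude φ n w) z t) x).det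
  momentum_limit : ∀ φ, IsRadialMollifier φ →
    ∀ ψ : EuclideanSpace ℝ (Fin d) × ℝ → EuclideanSpace ℝ (Fin d),
      ContDiff ℝ 2 ψ → HasCompactSupport ψ →
        (∀ n : ℕ, 1 ≤ n → Integrable (fun p : EuclideanSpace ℝ (Fin d) × ℝ =>
          momentumIntegrand h (radialMotion d (mollifiedAmplitude φ n w)) ψ p.1 p.2)) ∧
        Tendsto (fun n : ℕ => ∫ t, ∫ x,
          momentumIntegrand h (radialMotion d (mollifiedAmplitude φ n w)) ψ x t) atTop (𝓝 0)

/-- `∂Φ/∂λ₁` at `(a, b, …, b)` for `Φ = ½ ∑ λᵢ² + h (∏ λᵢ)`: the radial principal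
Piola-Kirchhoff stress. -/
noncomputable def radialStress (d : ℕ) (h : ℝ → ℝ) (a b : ℝ) : ℝ :=
  a + b ^ (d - 1) * deriv h (a * b ^ (d - 1))

/-- `∂Φ/∂λ₂` at `(a, b, …, b)`: the tangential principal Piola-Kirchhoff stress. -/
noncomputable def hoopStress (d : ℕ) (h : ℝ → ℝ) (a b : ℝ) : ℝ :=
  b + a * b ^ (d - 2) * deriv h (a * b ^ (d - 1))

/-- The square `∂²Φ/∂λ₁²` of the radial wave speed at `(a, b, …, b)`. -/
noncomputable def radialSpeedSq (d : ℕ) (h : ℝ → ℝ) (a b : ℝ) : ℝ :=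
  1 + b ^ (2 * (d - 1)) * iteratedDeriv 2 h (a * b ^ (d - 1))

/-- The self-similar cavitating profiles: `r` on `[0,∞)` with an open cavity `r 0 > 0` whose surface
is free of Cauchy stress, a smooth solution with positive Jacobian of the radial equation behind
one outgoing shock of speed `σ`, and the homogeneous deformation `lam * s` ahead of it; at the
shock the Rankine-Hugoniot condition and the Lax condition hold. -/
structure IsCavitatingProfile (d : ℕ) (h : ℝ → ℝ) (lam σ : ℝ) (r : ℝ → ℝ) : Prop where
  speed_pos : 0 < σ
  continuousOn : ContinuousOn r (Ici 0)
  cavity : 0 < r 0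
  smooth : ContDiffOn ℝ 2 r (Ioo 0 σ)
  deriv_pos : ∀ s ∈ Ioo 0 σ, 0 < deriv r s
  /-- The equation `w_tt = R^{1-d} ∂_R (R^{d-1} Φ₁) - (d-1) Φ₂ / R` for `w = t r(R/t)`. -/
  equation : ∀ s ∈ Ioo 0 σ,
    s ^ 2 * iteratedDeriv 2 r s =
      deriv (fun ξ => ξ ^ (d - 1) * radialStress d h (deriv r ξ) (r ξ / ξ)) s / s ^ (d - 1) -
        ((d : ℝ) - 1) / s * hoopStress d h (deriv r s) (r s / s)
  /-- The radial Cauchy stress `λ₂^{1-d} Φ₁` vanishes at the surface of the cavity. -/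
  stress_free : Tendsto
    (fun s => radialStress d h (deriv r s) (r s / s) / (r s / s) ^ (d - 1)) (𝓝[>] 0) (𝓝 0)
  eq_ahead : ∀ s, σ ≤ s → r s = lam * s
  /-- `a` is the radial strain just behind the shock. -/
  shock : ∃ a : ℝ, 0 < a ∧ Tendsto (deriv r) (𝓝[<] σ) (𝓝 a) ∧
    σ ^ 2 * (lam - a) = radialStress d h lam lam - radialStress d h a lam ∧
    radialSpeedSq d h lam lam < σ ^ 2 ∧ σ ^ 2 < radialSpeedSq d h a lam

/-- The amplitude `w(R,t) = t r(R/t)` for `t > 0`, extended by `lam * R` for `t ≤ 0`. -/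
noncomputable def selfSimilarAmplitude (lam : ℝ) (r : ℝ → ℝ) (R t : ℝ) : ℝ :=
  if t ≤ 0 then lam * R else t * r (R / t)

/-! ### Stresses and gradients of radial deformations -/

section LinearAlgebra

variable {d : ℕ}

/-! Traces and determinants of `F Fᵀ` turn the spectral energy into ½|F|² + h(|det F|), so S(F) = F
+ h'(det F) cof F wherever det F > 0 (`piolaStress_apply`). For a radial motion of amplitude w, both
∇y and S(∇y) are diagonal in the splitting into the direction of x and its complement, with strains
w_R, w/R and stresses Φ₁, Φ₂.

Weak solution. The divergence of the tangential part of a test field has mean zero on spheres, hence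
is orthogonal to every radial function, in particular to Φ₂
(`integral_radial_mul_tangentialDivergence`). Subtracting Φ₂ times it from the integrand leaves an
expression in the radial component of ψ alone, one for each ray, so the weak form reduces to an
identity in (R,t) (`integral_radialIntegrand_eq_zero`). There the inertia is integrated by parts in
t and the stress in R (`integral_time`, `integral_radius`). The smooth parts cancel by the
differential equation, the boundary term at the cavity vanishes because its surface is stress-free,
and the two jump terms on the shock cancel by the Rankine–Hugoniot condition
(`integral_ray_eq_zero`). Integrability rests on the stress-free condition too: it confines the
Jacobian near the cavity to a compact part of (0,∞), so that w/R grows like 1/R, w_R decays like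
R^{d-1}, and R^{d-1}Φ₁ and RΦ₂ stay bounded.

Slic dichotomy. Since w is homogeneous of degree one in (R,t), wⁿ(R,t) = w¹(nR,nt)/n, and estimates
at unit scale suffice. The odd extension of w jumps by 2w(0,t) across the axis, so wⁿ_R contains the
smeared delta 2φₙ(R)w(0,t). This is absent for |x| > 1/n, where the mollified strains obey the same
bounds as the original ones and dominated convergence gives the limit 0 (`tendsto_integral_outer`).
In the core |x| ≤ 1/n, of volume of order n^{-d}, both strains are at most of order n for bounded
times, and at least of order n on a smaller ball for times of order one because φ(0) > 0. The
Jacobian is then of order n^d, the stresses of order n + n^{d-1}(1 + |h'(n^d)|), and the core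
contributes O(n^{1-d} + 1/n + |h'(n^d)|/n): the price of opening the hole. If h'(v^d)/v → 0 this
disappears (`tendsto_integral_inner`). If its lower limit is positive, the test field ψ = η(t)x near
the axis detects the core: S : ∇ψ = η(Φ₁ + (d-1)Φ₂) is at least of order n^d on the smaller ball,
and its negative part is only O(n^{d-1}) (`exists_inner_lower_bound`). -/

lemma principalStretch_sq (F : Matrix (Fin d) (Fin d) ℝ) (i : Fin d) :
    principalStretch F i ^ 2 = (Matrix.isHermitian_mul_conjTranspose_self F).eigenvalues i :=
  Real.sq_sqrt ((Matrix.posSemidef_self_mul_conjTranspose F).eigenvalues_nonneg i)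

lemma sum_principalStretch_sq (F : Matrix (Fin d) (Fin d) ℝ) :
    ∑ i, principalStretch F i ^ 2 = ∑ i, ∑ j, F i j ^ 2 := by
  have h := (Matrix.isHermitian_mul_conjTranspose_self F).trace_eq_sum_eigenvalues
  simp only [principalStretch_sq]
  simp only [RCLike.ofReal_real_eq_id, id_eq] at h
  rw [← h]
  simp [Matrix.trace, Matrix.mul_apply, sq]

lemma prod_principalStretch (F : Matrix (Fin d) (Fin d) ℝ) :
    ∏ i, principalStretch F i = |F.det| := by
  have h := (Matrix.isHermitian_mul_conjTranspose_self F).det_eq_prod_eigenvalues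
  simp only [RCLike.ofReal_real_eq_id, id_eq] at h
  have h2 : (∏ i, principalStretch F i) ^ 2 = |F.det| ^ 2 := by
    rw [← Finset.prod_pow]
    simp only [principalStretch_sq]
    rw [← h, sq_abs]
    simp [sq]
  exact (pow_left_inj₀ (Finset.prod_nonneg fun i _ => Real.sqrt_nonneg _) (abs_nonneg _)
    two_ne_zero).1 h2

/-- Removes the eigenvalues, so that differentiating the energy needs no smoothness of the principal
stretches. -/
lemma storedEnergy_eq (h : ℝ → ℝ) (F : Matrix (Fin d) (Fin d) ℝ) :
    storedEnergy h F = (1 / 2) * ∑ i, ∑ j, F i j ^ 2 + h |F.det| := by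
  rw [storedEnergy, sum_principalStretch_sq, prod_principalStretch]

/-- The perturbation changes row i only, and the determinant is affine in that row with a cofactor
as slope. -/
lemma det_add_smul_single (F : Matrix (Fin d) (Fin d) ℝ) (i j : Fin d) (t : ℝ) :
    (F + t • Matrix.single i j (1 : ℝ)).det = F.det + t * F.adjugate j i := by
  have : F + t • Matrix.single i j (1 : ℝ) = F.updateRow i (F i + t • Pi.single j 1) := by
    ext a b
    by_cases ha : a = i
    · subst ha
      by_cases hb : b = j
      · subst hb; simp
      · simp [hb, Ne.symm hb]
    · simp [ha, Ne.symm ha]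
  rw [this, Matrix.det_updateRow_add, Matrix.det_updateRow_smul, Matrix.updateRow_eq_self,
    Matrix.adjugate_apply]

lemma piolaStress_apply {h : ℝ → ℝ} {F : Matrix (Fin d) (Fin d) ℝ} (hF : 0 < F.det)
    (hd : DifferentiableAt ℝ h F.det) (i j : Fin d) :
    piolaStress h F i j = F i j + deriv h F.det * F.adjugate j i := by
  have h1 : HasDerivAt (fun t : ℝ => F.det + t * F.adjugate j i) (F.adjugate j i) 0 := by
    simpa using ((hasDerivAt_id (0 : ℝ)).mul_const (F.adjugate j i)).const_add F.det
  have h2 : HasDerivAt (fun t : ℝ => h |F.det + t * F.adjugate j i|)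
      (deriv h F.det * F.adjugate j i) 0 := by
    have h3 : HasDerivAt (fun t : ℝ => h (F.det + t * F.adjugate j i))
        (deriv h F.det * F.adjugate j i) 0 := by
      have h4 : HasDerivAt h (deriv h F.det) (F.det + 0 * F.adjugate j i) := by
        simpa using hd.hasDerivAt
      exact h4.comp (0 : ℝ) h1
    refine h3.congr_of_eventuallyEq ?_
    -- The determinant stays positive for small t, so the absolute value in the energy can be
    -- dropped.
    have : ∀ᶠ t in 𝓝 (0 : ℝ), 0 < F.det + t * F.adjugate j i :=
      h1.continuousAt.eventually_const_lt (by simpa using hF)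
    filter_upwards [this] with t ht
    rw [abs_of_pos ht]
  have h5 : HasDerivAt (fun t : ℝ =>
      (1 / 2 : ℝ) * ∑ a, ∑ b, (F a b + t * Matrix.single i j (1 : ℝ) a b) ^ 2) (F i j) 0 := by
    have : HasDerivAt (fun t : ℝ =>
        (1 / 2 : ℝ) * ∑ a, ∑ b, (F a b + t * Matrix.single i j (1 : ℝ) a b) ^ 2)
        ((1 / 2 : ℝ) * ∑ a, ∑ b, 2 * F a b * Matrix.single i j (1 : ℝ) a b) 0 := by
      refine HasDerivAt.const_mul _ (HasDerivAt.fun_sum fun a _ => HasDerivAt.fun_sum fun b _ => ?_)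
      have := (((hasDerivAt_id (0 : ℝ)).mul_const
        (Matrix.single i j (1 : ℝ) a b)).const_add (F a b)).fun_pow 2
      simpa using this
    convert this using 1
    rw [Finset.sum_eq_single i, Finset.sum_eq_single j]
    · simp
    · intro b _ hb; simp [Ne.symm hb]
    · simp
    · intro a _ ha
      exact Finset.sum_eq_zero fun b _ => by simp [Ne.symm ha]
    · simp
  have h6 := h5.add h2
  rw [piolaStress, Matrix.of_apply, lineDeriv]
  refine HasDerivAt.deriv ?_
  convert h6 using 1
  ext t
  rw [storedEnergy_eq, det_add_smul_single]
  simp only [Matrix.add_apply, Matrix.smul_apply, smul_eq_mul, Pi.add_apply]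

/-- The symmetric tensor with eigenvalue `P` in the direction of `x` and `Q` orthogonally to it. -/
noncomputable def radialTensor (P Q : ℝ) (x : EuclideanSpace ℝ (Fin d)) :
    Matrix (Fin d) (Fin d) ℝ :=
  Q • (1 : Matrix (Fin d) (Fin d) ℝ) + ((P - Q) / ‖x‖ ^ 2) • Matrix.vecMulVec x x

lemma radialTensor_apply (P Q : ℝ) (x : EuclideanSpace ℝ (Fin d)) (i j : Fin d) :
    radialTensor P Q x i j = Q * (if i = j then 1 else 0) + (P - Q) / ‖x‖ ^ 2 * (x i * x j) := by
  simp [radialTensor, Matrix.one_apply, Matrix.vecMulVec_apply]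

lemma dotProduct_self_eq_norm_sq (x : EuclideanSpace ℝ (Fin d)) :
    dotProduct (x : Fin d → ℝ) x = ‖x‖ ^ 2 := by
  rw [EuclideanSpace.norm_sq_eq]
  simp [dotProduct, sq]

/-- For fixed x these tensors are simultaneously diagonal, so they multiply eigenvalue by
eigenvalue. -/
lemma radialTensor_mul {P Q P' Q' : ℝ} {x : EuclideanSpace ℝ (Fin d)} (hx : x ≠ 0) :
    radialTensor P Q x * radialTensor P' Q' x = radialTensor (P * P') (Q * Q') x := by
  have hn : ‖x‖ ^ 2 ≠ 0 := by positivity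
  have h1 : Matrix.vecMulVec (x : Fin d → ℝ) x * Matrix.vecMulVec (x : Fin d → ℝ) x
      = ‖x‖ ^ 2 • Matrix.vecMulVec (x : Fin d → ℝ) x := by
    rw [Matrix.vecMulVec_mul_vecMulVec, dotProduct_self_eq_norm_sq]
    ext i j
    simp [Matrix.vecMulVec_apply]
    ring
  simp only [radialTensor, add_mul, mul_add, Matrix.smul_mul, Matrix.mul_smul, h1, one_mul,
    mul_one, smul_smul]
  ext i j
  simp only [Matrix.add_apply, Matrix.smul_apply, smul_eq_mul]
  field_simp
  ring

lemma radialTensor_self (Q : ℝ) (x : EuclideanSpace ℝ (Fin d)) :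
    radialTensor Q Q x = Q • (1 : Matrix (Fin d) (Fin d) ℝ) := by
  simp [radialTensor]

/-- A rank-one perturbation of Q times the identity, handled by the matrix determinant lemma;
factoring out Q is why Q ≠ 0 is assumed. -/
lemma det_radialTensor (hd : 1 ≤ d) {P Q : ℝ} (hQ : Q ≠ 0) {x : EuclideanSpace ℝ (Fin d)}
    (hx : x ≠ 0) : (radialTensor P Q x).det = P * Q ^ (d - 1) := by
  have hn : ‖x‖ ^ 2 ≠ 0 := by positivity
  have : radialTensor P Q x = Q • (1 + Matrix.replicateCol Unit (fun i => (P - Q) / Q / ‖x‖ ^ 2 * x i) *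
      Matrix.replicateRow Unit (x : Fin d → ℝ)) := by
    ext i j
    simp [radialTensor_apply, Matrix.one_apply, Matrix.mul_apply]
    field_simp
    split_ifs <;> ring
  rw [this, Matrix.det_smul, Matrix.det_one_add_replicateCol_mul_replicateRow]
  have h2 : dotProduct (x : Fin d → ℝ) (fun i => (P - Q) / Q / ‖x‖ ^ 2 * x i) = (P - Q) / Q := by
    have : (fun i => (P - Q) / Q / ‖x‖ ^ 2 * x i) = ((P - Q) / Q / ‖x‖ ^ 2) • (x : Fin d → ℝ) := by
      ext; simp
    rw [this, dotProduct_smul, dotProduct_self_eq_norm_sq, smul_eq_mul]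
    field_simp
  rw [h2]
  obtain ⟨k, rfl⟩ : ∃ k, d = k + 1 := ⟨d - 1, by omega⟩
  simp only [Fintype.card_fin, Nat.add_sub_cancel]
  field_simp
  ring

/-- The candidate has the right product with the tensor, and the nonzero determinant makes it
unique. -/
lemma adjugate_radialTensor (hd : 2 ≤ d) {P Q : ℝ} (hP : P ≠ 0) (hQ : Q ≠ 0)
    {x : EuclideanSpace ℝ (Fin d)} (hx : x ≠ 0) :
    (radialTensor P Q x).adjugate = radialTensor (Q ^ (d - 1)) (P * Q ^ (d - 2)) x := by
  have h1 : radialTensor P Q x * radialTensor (Q ^ (d - 1)) (P * Q ^ (d - 2)) x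
      = (radialTensor P Q x).det • (1 : Matrix (Fin d) (Fin d) ℝ) := by
    rw [radialTensor_mul hx, det_radialTensor (by omega) hQ hx, ← radialTensor_self _ x]
    congr 1
    obtain ⟨k, rfl⟩ : ∃ k, d = k + 2 := ⟨d - 2, by omega⟩
    simp only [Nat.add_sub_cancel, show k + 2 - 1 = k + 1 by omega]
    ring
  have hdet : (radialTensor P Q x).det ≠ 0 := by
    rw [det_radialTensor (by omega) hQ hx]; positivity
  have h2 := congrArg (fun M => (radialTensor P Q x).adjugate * M) h1
  simp only [← mul_assoc, Matrix.adjugate_mul, Matrix.smul_mul, one_mul, Matrix.mul_smul,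
    mul_one] at h2
  exact (smul_right_injective _ hdet h2).symm

lemma piolaStress_radialTensor (hd : 2 ≤ d) {h : ℝ → ℝ} {A B : ℝ} (hA : 0 < A) (hB : 0 < B)
    (hh : DifferentiableAt ℝ h (A * B ^ (d - 1))) {x : EuclideanSpace ℝ (Fin d)} (hx : x ≠ 0) :
    piolaStress h (radialTensor A B x)
      = radialTensor (radialStress d h A B) (hoopStress d h A B) x := by
  have hdet := det_radialTensor (d := d) (by omega) (P := A) hB.ne' hx
  ext i j
  rw [piolaStress_apply (by rw [hdet]; positivity) (by rwa [hdet]), hdet,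
    adjugate_radialTensor hd hA.ne' hB.ne' hx]
  simp only [radialTensor_apply, radialStress, hoopStress]
  by_cases hij : i = j
  · subst hij; simp; ring
  · simp [hij, Ne.symm hij]; ring

/-- In the product (w/R) x the factor x contributes w/R times the identity, and the derivative of
w/R corrects the radial eigenvalue to w_R. -/
lemma gradMatrix_radialMotion {w : ℝ → ℝ → ℝ} {x : EuclideanSpace ℝ (Fin d)} (hx : x ≠ 0)
    {t A : ℝ} (hw : HasDerivAt (fun R => w R t) A ‖x‖) :
    gradMatrix (fun z => radialMotion d w z t) x = radialTensor A (w ‖x‖ t / ‖x‖) x := by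
  have hn : ‖x‖ ≠ 0 := by positivity
  have h1 : HasFDerivAt (fun z : EuclideanSpace ℝ (Fin d) => ‖z‖) (‖x‖⁻¹ • innerSL ℝ x) x := by
    have h2 := (hasStrictFDerivAt_norm_sq x).hasFDerivAt
    have h3 := h2.sqrt (by positivity)
    simp only [Real.sqrt_sq (norm_nonneg _)] at h3
    have h4 : (1 / (2 * ‖x‖)) • 2 • (innerSL ℝ) x = ‖x‖⁻¹ • innerSL ℝ x := by
      ext v
      simp
      field_simp
    rwa [h4] at h3
  have h4 : HasDerivAt (fun R => w R t / R) ((A * ‖x‖ - w ‖x‖ t) / ‖x‖ ^ 2) ‖x‖ := by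
    simpa using hw.fun_div (hasDerivAt_id _) hn
  have h5 := (h4.comp_hasFDerivAt x h1).smul (hasFDerivAt_id x)
  ext i j
  have h6 : fderiv ℝ (fun z => radialMotion d w z t) x = _ := h5.fderiv
  rw [gradMatrix, Matrix.of_apply, h6, radialTensor_apply]
  have h7 : inner ℝ x (EuclideanSpace.single j (1 : ℝ)) = x j := by
    simp [EuclideanSpace.inner_single_right]
  simp only [Function.comp_apply, _root_.add_apply, _root_.smul_apply,
    ContinuousLinearMap.smulRight_apply, ContinuousLinearMap.id_apply, innerSL_apply_apply, h7,
    PiLp.add_apply, PiLp.smul_apply, smul_eq_mul, id_eq]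
  by_cases hij : i = j
  · subst hij; simp; field_simp
  · simp [hij]; field_simp

/-- The norm is not differentiable at the origin, so the derivative is read off directly from w(R) -
AR = o(R). The determinant bound for slic-solutions is demanded at x = 0 as well. -/
lemma gradMatrix_radialMotion_zero {w : ℝ → ℝ → ℝ} {t A : ℝ}
    (hw : HasDerivAt (fun R => w R t) A 0) (h0 : w 0 t = 0) :
    gradMatrix (fun z => radialMotion d w z t) 0 = A • (1 : Matrix (Fin d) (Fin d) ℝ) := by
  have h1 : HasFDerivAt (fun z => radialMotion d w z t)
      (A • ContinuousLinearMap.id ℝ (EuclideanSpace ℝ (Fin d))) 0 := by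
    rw [hasFDerivAt_iff_isLittleO_nhds_zero]
    have h2 := (hasDerivAt_iff_isLittleO_nhds_zero.1 hw).comp_tendsto
      (tendsto_norm_zero (E := EuclideanSpace ℝ (Fin d)))
    rw [← Asymptotics.isLittleO_norm_left, ← Asymptotics.isLittleO_norm_right] at h2 ⊢
    refine h2.congr (fun x => ?_) (fun x => by simp)
    by_cases hx : x = 0
    · simp [hx, radialMotion]
    · have hn : ‖x‖ ≠ 0 := by positivity
      have : radialMotion d w (0 + x) t - radialMotion d w 0 t -
          (A • ContinuousLinearMap.id ℝ (EuclideanSpace ℝ (Fin d))) x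
          = ((w ‖x‖ t - ‖x‖ * A) / ‖x‖) • x := by
        simp [radialMotion, ← sub_smul]
        congr 1; field_simp
      rw [this, norm_smul, norm_div, norm_norm]
      simp only [Function.comp_apply, zero_add, h0, sub_zero, smul_eq_mul]
      field_simp
  ext i j
  rw [gradMatrix, Matrix.of_apply, h1.fderiv]
  simp [Matrix.one_apply]

end LinearAlgebra

lemma iteratedDeriv_two_eq (f : ℝ → ℝ) : iteratedDeriv 2 f = deriv (deriv f) := by
  rw [iteratedDeriv_succ, iteratedDeriv_one]

/-! ### Monotonicity of h' and stress bounds -/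

section Energy

variable {h : ℝ → ℝ}

namespace IsVolumetricEnergy

lemma contDiffOn_deriv (hh : IsVolumetricEnergy h) : ContDiffOn ℝ 2 (deriv h) (Ioi 0) :=
  hh.contDiffOn.deriv_of_isOpen isOpen_Ioi (by norm_num)

lemma contDiffOn_second (hh : IsVolumetricEnergy h) : ContDiffOn ℝ 1 (iteratedDeriv 2 h) (Ioi 0) := by
  rw [iteratedDeriv_two_eq]
  exact hh.contDiffOn_deriv.deriv_of_isOpen isOpen_Ioi (by norm_num)

lemma differentiableAt (hh : IsVolumetricEnergy h) {v : ℝ} (hv : 0 < v) :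
    DifferentiableAt ℝ h v :=
  (hh.contDiffOn.contDiffAt (Ioi_mem_nhds hv)).differentiableAt (by norm_num)

lemma hasDerivAt_deriv (hh : IsVolumetricEnergy h) {v : ℝ} (hv : 0 < v) :
    HasDerivAt (deriv h) (iteratedDeriv 2 h v) v := by
  rw [iteratedDeriv_two_eq]
  exact ((hh.contDiffOn_deriv.contDiffAt (Ioi_mem_nhds hv)).differentiableAt
    (by norm_num)).hasDerivAt

lemma continuousAt_second (hh : IsVolumetricEnergy h) {v : ℝ} (hv : 0 < v) :
    ContinuousAt (iteratedDeriv 2 h) v :=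
  (hh.contDiffOn_second.contDiffAt (Ioi_mem_nhds hv)).continuousAt

lemma strictMonoOn_deriv (hh : IsVolumetricEnergy h) : StrictMonoOn (deriv h) (Ioi 0) := by
  refine strictMonoOn_of_deriv_pos (convex_Ioi 0) hh.contDiffOn_deriv.continuousOn fun v hv => ?_
  rw [interior_Ioi] at hv
  rw [(hh.hasDerivAt_deriv hv).deriv]
  exact hh.second_pos v hv

/-- By the mean value theorem, since h blows up at 0. With `exists_deriv_pos`, this sign change of
h' is what confines the Jacobian at a stress-free surface. -/
lemma exists_deriv_neg (hh : IsVolumetricEnergy h) : ∃ v, 0 < v ∧ deriv h v < 0 := by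
  have h1 : ∀ᶠ v in 𝓝[>] (0 : ℝ), h 1 < h v := hh.tendsto_zero.eventually_gt_atTop _
  have h2 : ∀ᶠ v in 𝓝[>] (0 : ℝ), v ∈ Ioo (0 : ℝ) 1 := Ioo_mem_nhdsGT one_pos
  obtain ⟨v, hv, hv2⟩ := (h1.and h2).exists
  obtain ⟨c, hc, hc2⟩ := exists_deriv_eq_slope h hv2.2
    (hh.contDiffOn.continuousOn.mono fun x hx => hv2.1.trans_le hx.1)
    (fun x hx => (hh.differentiableAt (hv2.1.trans hx.1)).differentiableWithinAt)
  refine ⟨c, hv2.1.trans hc.1, ?_⟩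
  rw [hc2]
  exact div_neg_of_neg_of_pos (by linarith) (by linarith [hv2.2])

lemma exists_deriv_pos (hh : IsVolumetricEnergy h) : ∃ v, 0 < v ∧ 0 < deriv h v := by
  have h1 : ∀ᶠ v in atTop, h 1 < h v := hh.tendsto_top.eventually_gt_atTop _
  obtain ⟨v, hv, hv2⟩ := (h1.and (eventually_gt_atTop 1)).exists
  obtain ⟨c, hc, hc2⟩ := exists_deriv_eq_slope h hv2
    (hh.contDiffOn.continuousOn.mono fun x hx => one_pos.trans_le hx.1)
    (fun x hx => (hh.differentiableAt (one_pos.trans hx.1)).differentiableWithinAt)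
  refine ⟨c, one_pos.trans hc.1, ?_⟩
  rw [hc2]
  exact div_pos (by linarith) (by linarith)

lemma abs_deriv_le (hh : IsVolumetricEnergy h) {c v V : ℝ} (hc : 0 < c) (h1 : c ≤ v) (h2 : v ≤ V) :
    |deriv h v| ≤ |deriv h c| + |deriv h V| := by
  have h3 := hh.strictMonoOn_deriv.monotoneOn hc (hc.trans_le h1) h1
  have h4 := hh.strictMonoOn_deriv.monotoneOn (hc.trans_le h1) (hc.trans_le (h1.trans h2)) h2
  rw [abs_le]
  constructor
  · linarith [neg_abs_le (deriv h c), abs_nonneg (deriv h V)]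
  · linarith [le_abs_self (deriv h V), abs_nonneg (deriv h c)]

lemma exists_second_bounds (hh : IsVolumetricEnergy h) {c C : ℝ} (hc : 0 < c) :
    ∃ m M, 0 < m ∧ 0 < M ∧ ∀ v, c ≤ v → v ≤ C → m ≤ iteratedDeriv 2 h v ∧ iteratedDeriv 2 h v ≤ M := by
  by_cases hcC : c ≤ C
  · have hcont : ContinuousOn (iteratedDeriv 2 h) (Icc c C) :=
      hh.contDiffOn_second.continuousOn.mono fun x hx => hc.trans_le hx.1
    obtain ⟨x, hx, hx2⟩ := isCompact_Icc.exists_isMinOn (nonempty_Icc.2 hcC) hcont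
    obtain ⟨y, hy, hy2⟩ := isCompact_Icc.exists_isMaxOn (nonempty_Icc.2 hcC) hcont
    exact ⟨_, _, hh.second_pos x (hc.trans_le hx.1), hh.second_pos y (hc.trans_le hy.1),
      fun v h1 h2 => ⟨hx2 ⟨h1, h2⟩, hy2 ⟨h1, h2⟩⟩⟩
  · exact ⟨1, 1, one_pos, one_pos, fun v h1 h2 => absurd (h1.trans h2) hcC⟩

end IsVolumetricEnergy

/-- Bounds for both principal stresses in terms of a single parameter `k`. -/
lemma exists_stress_bound (hh : IsVolumetricEnergy h) {d : ℕ} (hd : 2 ≤ d) {c C : ℝ} (hc : 0 < c) :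
    ∃ K, 0 ≤ K ∧ ∀ k A B : ℝ, 0 < k → k ≤ 1 → 0 ≤ A → A ≤ C * k ^ (d - 1) → 0 ≤ B → B * k ≤ C →
      c ≤ A * B ^ (d - 1) → |radialStress d h A B| * k ^ (d - 1) ≤ K ∧
        |hoopStress d h A B| * k ^ (d - 1) ≤ K := by
  -- Since A ≤ Ck^{d-1} and Bk ≤ C, the powers of k cancel in the Jacobian: AB^{d-1} ≤ C(Bk)^{d-1} ≤
  -- C·C^{d-1}. Monotonicity of h' then bounds it by D.
  set D := |deriv h c| + |deriv h (C * C ^ (d - 1))| with hD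
  have hD0 : 0 ≤ D := by positivity
  refine ⟨|C| + |C| ^ (d - 1) * D + |C| * |C| ^ (d - 2) * D, by positivity,
    fun k A B hk hk1 hA hA2 hB hB2 hdet => ?_⟩
  obtain ⟨n, rfl⟩ : ∃ n, d = n + 2 := ⟨d - 2, by omega⟩
  simp only [Nat.add_sub_cancel, show n + 2 - 1 = n + 1 by omega] at *
  have hC : 0 ≤ C := le_trans (by positivity) hB2
  rw [abs_of_nonneg hC]
  have hdet2 : A * B ^ (n + 1) ≤ C * C ^ (n + 1) := by
    calc A * B ^ (n + 1) ≤ C * k ^ (n + 1) * B ^ (n + 1) := by gcongr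
      _ = C * (B * k) ^ (n + 1) := by ring
      _ ≤ _ := by gcongr
  have hder : |deriv h (A * B ^ (n + 1))| ≤ D := hh.abs_deriv_le hc hdet hdet2
  have hkn : k ^ (n + 1) ≤ 1 := pow_le_one₀ hk.le hk1
  have hBk : B ^ n * k ^ n ≤ C ^ n := by rw [← mul_pow]; gcongr
  have hBk1 : B ^ (n + 1) * k ^ (n + 1) ≤ C ^ (n + 1) := by rw [← mul_pow]; gcongr
  have hA3 : A ≤ C := hA2.trans (by nlinarith)
  constructor
  · simp only [radialStress, show n + 2 - 1 = n + 1 by omega]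
    calc _ ≤ (|A| + |B ^ (n + 1) * deriv h (A * B ^ (n + 1))|) * k ^ (n + 1) := by
          gcongr; exact abs_add_le _ _
      _ = A * k ^ (n + 1) + B ^ (n + 1) * k ^ (n + 1) * |deriv h (A * B ^ (n + 1))| := by
          rw [abs_mul, abs_of_nonneg hA, abs_of_nonneg (by positivity : 0 ≤ B ^ (n + 1))]; ring
      _ ≤ C * 1 + C ^ (n + 1) * D := by gcongr
      _ ≤ _ := by
          have : 0 ≤ C * C ^ n * D := by positivity
          linarith
  · simp only [hoopStress, show n + 2 - 1 = n + 1 by omega, Nat.add_sub_cancel]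
    calc _ ≤ (|B| + |A * B ^ n * deriv h (A * B ^ (n + 1))|) * k ^ (n + 1) := by
          gcongr; exact abs_add_le _ _
      _ = (B * k) * k ^ n + A * (B ^ n * k ^ n) * k * |deriv h (A * B ^ (n + 1))| := by
          rw [abs_mul, abs_of_nonneg hB, abs_of_nonneg (by positivity : 0 ≤ A * B ^ n)]; ring
      _ ≤ C * 1 + C * C ^ n * 1 * D := by
          have : k ^ n ≤ 1 := pow_le_one₀ hk.le hk1
          gcongr
      _ ≤ _ := by
          have : 0 ≤ C ^ (n + 1) * D := by positivity
          linarith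

end Energy

/-- The two ends are controlled by hypothesis and the remaining compact piece by continuity. Capping
its ends at σ/2 keeps that piece inside (0, σ). -/
lemma exists_bound_of_eventually {f : ℝ → ℝ} {σ C₀ C₁ : ℝ} (hf : ContinuousOn f (Ioo 0 σ))
    (h0 : ∀ᶠ s in 𝓝[>] (0 : ℝ), f s ≤ C₀) (h1 : ∀ᶠ s in 𝓝[<] σ, f s ≤ C₁) :
    ∃ C, 0 < C ∧ ∀ s ∈ Ioo 0 σ, f s ≤ C := by
  rw [eventually_nhdsWithin_iff, Metric.eventually_nhds_iff] at h0 h1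
  obtain ⟨e0, he0, h0⟩ := h0
  obtain ⟨e1, he1, h1⟩ := h1
  have hcont : ContinuousOn f (Icc (min e0 (σ / 2)) (max (σ - e1) (σ / 2)) ∩ Ioo 0 σ) :=
    hf.mono inter_subset_right
  rcases lt_or_ge 0 σ with hσ | hσ
  · have hsub : Icc (min e0 (σ / 2)) (max (σ - e1) (σ / 2)) ⊆ Ioo 0 σ := fun x hx =>
      ⟨(lt_min he0 (by linarith)).trans_le hx.1,
        hx.2.trans_lt (max_lt (by linarith) (by linarith))⟩
    rw [inter_eq_left.2 hsub] at hcont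
    obtain ⟨C, hC⟩ := isCompact_Icc.bddAbove_image hcont
    refine ⟨max 1 (max C (max C₀ C₁)), by positivity, fun s hs => ?_⟩
    by_cases hs0 : s < min e0 (σ / 2)
    · refine (h0 ?_ hs.1).trans (by simp)
      rw [Real.dist_eq, sub_zero, abs_of_pos hs.1]
      exact hs0.trans_le (min_le_left _ _)
    · by_cases hs1 : s ≤ max (σ - e1) (σ / 2)
      · exact (hC ⟨s, ⟨not_lt.1 hs0, hs1⟩, rfl⟩).trans (by simp)
      · refine (h1 ?_ hs.2).trans (by simp)
        rw [Real.dist_eq, abs_sub_comm, abs_of_pos (by linarith [hs.2])]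
        linarith [le_max_left (σ - e1) (σ / 2)]
  · exact ⟨1, one_pos, fun s hs => absurd (hs.1.trans hs.2) (not_lt.2 hσ)⟩

/-! ### A priori estimates for the cavitating profile -/

section Profile

variable {d : ℕ} {h : ℝ → ℝ} {lam σ : ℝ} {r : ℝ → ℝ}

namespace IsCavitatingProfile

lemma hasDerivAt_ahead (hr : IsCavitatingProfile d h lam σ r) {s : ℝ} (hs : σ < s) :
    HasDerivAt r lam s := by
  have : HasDerivAt (fun s => lam * s) lam s := by simpa using (hasDerivAt_id s).const_mul lam
  refine this.congr_of_eventuallyEq ?_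
  filter_upwards [Ioi_mem_nhds hs] with x hx using hr.eq_ahead x (le_of_lt hx)

lemma contDiffAt (hr : IsCavitatingProfile d h lam σ r) {s : ℝ} (hs : s ∈ Ioo 0 σ) :
    ContDiffAt ℝ 2 r s := hr.smooth.contDiffAt (isOpen_Ioo.mem_nhds hs)

lemma hasDerivAt (hr : IsCavitatingProfile d h lam σ r) {s : ℝ} (hs : 0 < s) (hsσ : s ≠ σ) :
    HasDerivAt r (deriv r s) s := by
  rcases lt_or_gt_of_ne hsσ with h1 | h1
  · exact ((hr.contDiffAt ⟨hs, h1⟩).differentiableAt (by norm_num)).hasDerivAt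
  · exact (hr.hasDerivAt_ahead h1).differentiableAt.hasDerivAt

lemma contDiffOn_deriv (hr : IsCavitatingProfile d h lam σ r) :
    ContDiffOn ℝ 1 (deriv r) (Ioo 0 σ) :=
  hr.smooth.deriv_of_isOpen isOpen_Ioo (by norm_num)

lemma hasDerivAt_deriv (hr : IsCavitatingProfile d h lam σ r) {s : ℝ} (hs : s ∈ Ioo 0 σ) :
    HasDerivAt (deriv r) (iteratedDeriv 2 r s) s := by
  rw [iteratedDeriv_two_eq]
  exact ((hr.contDiffOn_deriv.contDiffAt (isOpen_Ioo.mem_nhds hs)).differentiableAt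
    (by norm_num)).hasDerivAt

lemma continuousOn_second (hr : IsCavitatingProfile d h lam σ r) :
    ContinuousOn (iteratedDeriv 2 r) (Ioo 0 σ) := by
  rw [iteratedDeriv_two_eq]
  exact hr.contDiffOn_deriv.continuousOn_deriv_of_isOpen isOpen_Ioo (by norm_num)

lemma continuousAt_deriv (hr : IsCavitatingProfile d h lam σ r) {s : ℝ} (hs : 0 < s)
    (hsσ : s ≠ σ) : ContinuousAt (deriv r) s := by
  rcases lt_or_gt_of_ne hsσ with h1 | h1
  · exact (hr.hasDerivAt_deriv ⟨hs, h1⟩).continuousAt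
  · refine (continuousAt_const (y := lam)).congr ?_
    filter_upwards [Ioi_mem_nhds h1] with x hx using (hr.hasDerivAt_ahead hx).deriv.symm

lemma deriv_pos' (hr : IsCavitatingProfile d h lam σ r) (hlam : 0 < lam) {s : ℝ} (hs : 0 < s)
    (hsσ : s ≠ σ) : 0 < deriv r s := by
  rcases lt_or_gt_of_ne hsσ with h1 | h1
  · exact hr.deriv_pos s ⟨hs, h1⟩
  · rwa [(hr.hasDerivAt_ahead h1).deriv]

lemma monotoneOn (hr : IsCavitatingProfile d h lam σ r) (hlam : 0 < lam) :
    MonotoneOn r (Ici 0) := by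
  have h1 : MonotoneOn r (Icc 0 σ) := by
    refine monotoneOn_of_deriv_nonneg (convex_Icc 0 σ) (hr.continuousOn.mono Icc_subset_Ici_self)
      ?_ ?_
    · rw [interior_Icc]
      exact hr.smooth.differentiableOn (by norm_num)
    · rw [interior_Icc]
      exact fun s hs => (hr.deriv_pos s hs).le
  intro x hx y hy hxy
  rcases le_total y σ with hyσ | hyσ
  · exact h1 ⟨hx, hxy.trans hyσ⟩ ⟨hy, hyσ⟩ hxy
  · rcases le_total x σ with hxσ | hxσ
    · refine (h1 ⟨hx, hxσ⟩ ⟨hr.speed_pos.le, le_rfl⟩ hxσ).trans ?_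
      rw [hr.eq_ahead _ le_rfl, hr.eq_ahead _ hyσ]
      gcongr
    · rw [hr.eq_ahead _ hxσ, hr.eq_ahead _ hyσ]
      gcongr

lemma cavity_le (hr : IsCavitatingProfile d h lam σ r) (hlam : 0 < lam) {s : ℝ} (hs : 0 ≤ s) :
    r 0 ≤ r s := hr.monotoneOn hlam self_mem_Ici hs hs

lemma pos (hr : IsCavitatingProfile d h lam σ r) (hlam : 0 < lam) {s : ℝ} (hs : 0 ≤ s) :
    0 < r s := hr.cavity.trans_le (hr.cavity_le hlam hs)

/-- By monotonicity r lies between r(0) and lam σ on [0, σ], and beyond σ it is linear. -/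
lemma exists_linear_bounds (hr : IsCavitatingProfile d h lam σ r) (hlam : 0 < lam) :
    ∃ c C, 0 < c ∧ 0 < C ∧ ∀ s, 0 ≤ s → c * (1 + s) ≤ r s ∧ r s ≤ C * (1 + s) := by
  have hσ := hr.speed_pos
  have h0 := hr.cavity
  refine ⟨min (r 0 / (1 + σ)) (lam * σ / (1 + σ)), lam * (1 + σ), by positivity, by positivity,
    fun s hs => ?_⟩
  rcases le_total s σ with h1 | h1
  · constructor
    · calc _ ≤ r 0 / (1 + σ) * (1 + σ) := by gcongr; exact min_le_left _ _
        _ = r 0 := by field_simp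
        _ ≤ r s := hr.cavity_le hlam hs
    · calc r s ≤ r σ := hr.monotoneOn hlam hs hσ.le h1
        _ = lam * σ := hr.eq_ahead _ le_rfl
        _ ≤ lam * (1 + σ) * (1 + 0) := by nlinarith
        _ ≤ _ := by gcongr
  · rw [hr.eq_ahead s h1]
    constructor
    · calc _ ≤ lam * σ / (1 + σ) * (1 + s) := by gcongr; exact min_le_right _ _
        _ = lam * (σ * (1 + s) / (1 + σ)) := by ring
        _ ≤ lam * s := by
            gcongr
            rw [div_le_iff₀ (by positivity)]
            nlinarith
    · have : s ≤ (1 + σ) * (1 + s) := by nlinarith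
      nlinarith

lemma tendsto_left_shock (hr : IsCavitatingProfile d h lam σ r) :
    Tendsto r (𝓝[<] σ) (𝓝 (lam * σ)) := by
  have h1 : Tendsto r (𝓝[Ici 0] σ) (𝓝 (r σ)) := hr.continuousOn σ hr.speed_pos.le
  rw [hr.eq_ahead σ le_rfl] at h1
  refine h1.mono_left ?_
  rw [← nhdsWithin_Ioo_eq_nhdsLT hr.speed_pos]
  exact nhdsWithin_mono _ fun x hx => hx.1.le

lemma tendsto_hoop_left_shock (hr : IsCavitatingProfile d h lam σ r) :
    Tendsto (fun s => r s / s) (𝓝[<] σ) (𝓝 lam) := by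
  have h1 := hr.tendsto_left_shock.div (tendsto_nhdsWithin_of_tendsto_nhds tendsto_id)
    hr.speed_pos.ne'
  have h2 : lam * σ / σ = lam := mul_div_cancel_right₀ _ hr.speed_pos.ne'
  rw [h2] at h1
  exact h1

lemma tendsto_right_zero (hr : IsCavitatingProfile d h lam σ r) :
    Tendsto r (𝓝[>] 0) (𝓝 (r 0)) :=
  (hr.continuousOn 0 self_mem_Ici).mono_left (nhdsWithin_mono _ Ioi_subset_Ici_self)

lemma tendsto_hoop_zero (hr : IsCavitatingProfile d h lam σ r) :
    Tendsto (fun s => r s / s) (𝓝[>] 0) atTop := by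
  simp only [div_eq_mul_inv]
  exact hr.tendsto_right_zero.pos_mul_atTop hr.cavity tendsto_inv_nhdsGT_zero

lemma continuousOn_hoop (hr : IsCavitatingProfile d h lam σ r) :
    ContinuousOn (fun s => r s / s) (Ioo 0 σ) :=
  (hr.smooth.continuousOn).div continuousOn_id fun _ hs => hs.1.ne'

/-- With q = (r/s)^{d-1} and v = r'q, the radial Cauchy stress is r'/q + h'(v), and it tends to 0. A
large v would keep it above a positive value of h'. A small v would make r'/q ≤ v small while h'(v)
stays below a negative value, keeping the stress negative. -/
lemma eventually_jacobian_near_zero (hr : IsCavitatingProfile d h lam σ r)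
    (hh : IsVolumetricEnergy h) : ∃ c C, 0 < c ∧ ∀ᶠ s in 𝓝[>] (0 : ℝ),
      c ≤ deriv r s * (r s / s) ^ (d - 1) ∧ deriv r s * (r s / s) ^ (d - 1) ≤ C := by
  obtain ⟨x, hx, hx2⟩ := hh.exists_deriv_neg
  obtain ⟨y, hy, hy2⟩ := hh.exists_deriv_pos
  have hη : 0 < -deriv h x / 2 := by linarith
  refine ⟨min x (-deriv h x / 2), y, lt_min hx hη, ?_⟩
  have e1 := hr.stress_free.eventually_lt_const hy2
  have e2 := hr.stress_free.eventually_const_lt (u := deriv h x / 2) (by linarith)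
  have e3 := hr.tendsto_hoop_zero.eventually_ge_atTop 1
  filter_upwards [e1, e2, e3, Ioo_mem_nhdsGT hr.speed_pos] with s h1 h2 h3 hs
  have ha := hr.deriv_pos s hs
  set a := deriv r s
  set b := r s / s
  set q := b ^ (d - 1)
  have hq : 1 ≤ q := one_le_pow₀ h3
  have heq : radialStress d h a b / q = a / q + deriv h (a * q) := by
    rw [radialStress]; change (a + q * deriv h (a * q)) / q = _; field_simp
  rw [heq] at h1 h2
  have haq : a / q ≤ a * q := by
    rw [div_le_iff₀ (by positivity)]
    nlinarith [mul_pos ha (by positivity : 0 < q)]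
  have haq0 : 0 < a / q := by positivity
  have hv : 0 < a * q := by positivity
  constructor
  · by_contra! hlt
    have := hh.strictMonoOn_deriv.monotoneOn hv hx (hlt.le.trans (min_le_left _ _))
    have := hlt.trans_le (min_le_right _ _)
    linarith
  · by_contra! hlt
    have := hh.strictMonoOn_deriv.monotoneOn hy hv hlt.le
    linarith

/-- Near 0 the stress-free condition applies, at the shock the one-sided limit a·lam^{d-1}, and
ahead of it the Jacobian is constant. The lower bound is an upper bound for the inverse. -/
lemma exists_jacobian_bounds (hr : IsCavitatingProfile d h lam σ r) (hh : IsVolumetricEnergy h)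
    (hlam : 0 < lam) : ∃ c C, 0 < c ∧ 0 < C ∧ ∀ s, 0 < s → s ≠ σ →
      c ≤ deriv r s * (r s / s) ^ (d - 1) ∧ deriv r s * (r s / s) ^ (d - 1) ≤ C := by
  obtain ⟨c0, C0, hc0, h0⟩ := hr.eventually_jacobian_near_zero hh
  obtain ⟨a, ha, ha2, -⟩ := hr.shock
  have hlim : Tendsto (fun s => deriv r s * (r s / s) ^ (d - 1)) (𝓝[<] σ)
      (𝓝 (a * lam ^ (d - 1))) := ha2.mul (hr.tendsto_hoop_left_shock.pow _)
  have hcont : ContinuousOn (fun s => deriv r s * (r s / s) ^ (d - 1)) (Ioo 0 σ) :=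
    hr.contDiffOn_deriv.continuousOn.mul (hr.continuousOn_hoop.pow _)
  have hpos : ∀ s, 0 < s → s ≠ σ → 0 < deriv r s * (r s / s) ^ (d - 1) := fun s hs hsσ => by
    have := hr.deriv_pos' hlam hs hsσ
    have := hr.pos hlam hs.le
    positivity
  obtain ⟨C1, hC1, h1⟩ := exists_bound_of_eventually hcont (h0.mono fun s hs => hs.2)
    (hlim.eventually_le_const (lt_add_one _))
  have hinv := hlim.inv₀ (by positivity)
  obtain ⟨C2, hC2, h2⟩ := exists_bound_of_eventually
    (hcont.inv₀ fun s hs => (hpos s hs.1 hs.2.ne).ne') (C₀ := c0⁻¹)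
    (h0.mono fun s hs => inv_anti₀ hc0 hs.1)
    (hinv.eventually_le_const (lt_add_one _))
  refine ⟨min C2⁻¹ (lam * lam ^ (d - 1)), max C1 (lam * lam ^ (d - 1)), by positivity,
    by positivity, fun s hs hsσ => ?_⟩
  rcases lt_or_gt_of_ne hsσ with hlt | hlt
  · refine ⟨(min_le_left _ _).trans ?_, (h1 s ⟨hs, hlt⟩).trans (le_max_left _ _)⟩
    exact inv_le_of_inv_le₀ (hpos s hs hsσ) (h2 s ⟨hs, hlt⟩)
  · rw [(hr.hasDerivAt_ahead hlt).deriv, hr.eq_ahead s hlt.le, mul_div_cancel_right₀ _ hs.ne']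
    exact ⟨min_le_right _ _, le_max_right _ _⟩

/-- Dividing the Jacobian by (r/s)^{d-1}, which is comparable to ((1+s)/s)^{d-1}, gives the exact
rate s^{d-1} at which the radial strain degenerates at the cavity. -/
lemma exists_deriv_bounds (hr : IsCavitatingProfile d h lam σ r) (hh : IsVolumetricEnergy h)
    (hlam : 0 < lam) : ∃ c C, 0 < c ∧ 0 < C ∧ ∀ s, 0 < s → s ≠ σ →
      c * (s / (1 + s)) ^ (d - 1) ≤ deriv r s ∧ deriv r s ≤ C * (s / (1 + s)) ^ (d - 1) := by
  obtain ⟨c, C, hc, hC, hcC⟩ := hr.exists_jacobian_bounds hh hlam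
  obtain ⟨l, L, hl, hL, hlL⟩ := hr.exists_linear_bounds hlam
  refine ⟨c / L ^ (d - 1), C / l ^ (d - 1), by positivity, by positivity, fun s hs hsσ => ?_⟩
  obtain ⟨h1, h2⟩ := hcC s hs hsσ
  obtain ⟨h3, h4⟩ := hlL s hs.le
  have hr0 := hr.pos hlam hs.le
  have ha := hr.deriv_pos' hlam hs hsσ
  rw [div_pow, mul_div_assoc'] at h1 h2
  rw [le_div_iff₀ (by positivity)] at h1
  rw [div_le_iff₀ (by positivity)] at h2
  constructor
  · rw [div_pow, div_mul_div_comm, div_le_iff₀ (by positivity), ← mul_pow]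
    exact h1.trans (by gcongr)
  · rw [div_pow, div_mul_div_comm, le_div_iff₀ (by positivity), ← mul_pow]
    refine le_trans ?_ h2
    gcongr

lemma exists_deriv_le (hr : IsCavitatingProfile d h lam σ r) (hh : IsVolumetricEnergy h)
    (hlam : 0 < lam) : ∃ C, 0 < C ∧ ∀ s, 0 < s → s ≠ σ → deriv r s ≤ C := by
  obtain ⟨c, C, hc, hC, hcC⟩ := hr.exists_deriv_bounds hh hlam
  refine ⟨C, hC, fun s hs hsσ => (hcC s hs hsσ).2.trans ?_⟩
  have : (s / (1 + s)) ^ (d - 1) ≤ 1 :=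
    pow_le_one₀ (by positivity) ((div_le_one (by positivity)).2 (by linarith))
  nlinarith

lemma hasDerivAt_radialStress (hr : IsCavitatingProfile d h lam σ r) (hh : IsVolumetricEnergy h)
    (hlam : 0 < lam) (hd : 2 ≤ d) {s : ℝ} (hs : s ∈ Ioo 0 σ) :
    HasDerivAt (fun ξ => radialStress d h (deriv r ξ) (r ξ / ξ))
      (radialSpeedSq d h (deriv r s) (r s / s) * iteratedDeriv 2 r s +
        (d - 1) * (r s / s) ^ (d - 2) * (deriv h (deriv r s * (r s / s) ^ (d - 1)) +
          deriv r s * (r s / s) ^ (d - 1) *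
            iteratedDeriv 2 h (deriv r s * (r s / s) ^ (d - 1))) *
          ((deriv r s - r s / s) / s)) s := by
  have hs0 : s ≠ 0 := hs.1.ne'
  have hpos : 0 < deriv r s * (r s / s) ^ (d - 1) := by
    have := hr.deriv_pos s hs
    have := hr.pos hlam hs.1.le
    have := hs.1
    positivity
  have hb : HasDerivAt (fun ξ => r ξ / ξ) ((deriv r s - r s / s) / s) s := by
    have h1 := (hr.hasDerivAt hs.1 hs.2.ne).fun_div (hasDerivAt_id s) hs0
    refine h1.congr_deriv ?_
    simp only [id]
    field_simp
  have hbp := hb.fun_pow (d - 1)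
  have ha := hr.hasDerivAt_deriv hs
  have hv := ha.fun_mul hbp
  have hhv := (hh.hasDerivAt_deriv hpos).comp s hv
  refine (ha.add (hbp.mul hhv)).congr_deriv ?_
  obtain ⟨k, rfl⟩ : ∃ k, d = k + 2 := ⟨d - 2, by omega⟩
  simp only [radialSpeedSq, Nat.add_sub_cancel, show k + 2 - 1 = k + 1 by omega,
    Function.comp_apply]
  push_cast
  ring

/-- The differential equation solved for r'': the terms with h' coming from Φ₁, Φ₂ and the
derivative of Φ₁ cancel, leaving only h''. -/
lemma second_deriv_eq (hr : IsCavitatingProfile d h lam σ r) (hh : IsVolumetricEnergy h)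
    (hlam : 0 < lam) (hd : 2 ≤ d) {s : ℝ} (hs : s ∈ Ioo 0 σ) :
    (s ^ 2 - radialSpeedSq d h (deriv r s) (r s / s)) * iteratedDeriv 2 r s =
      (d - 1) / s * (deriv r s - r s / s) * (1 + (r s / s) ^ (d - 2) *
        (deriv r s * (r s / s) ^ (d - 1)) *
          iteratedDeriv 2 h (deriv r s * (r s / s) ^ (d - 1))) := by
  have hs0 : s ≠ 0 := hs.1.ne'
  have h1 := hr.equation s hs
  have h2 := ((hasDerivAt_id s).fun_pow (d - 1)).fun_mul (hr.hasDerivAt_radialStress hh hlam hd hs)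
  simp only [id] at h2
  rw [h2.deriv] at h1
  obtain ⟨k, rfl⟩ : ∃ k, d = k + 2 := ⟨d - 2, by omega⟩
  rw [sub_mul, h1]
  simp only [radialStress, hoopStress, Nat.add_sub_cancel, show k + 2 - 1 = k + 1 by omega]
  generalize r s / s = b
  push_cast
  field_simp
  ring

/-- The equation in divergence form, as needed for integrating the stress by parts in R. -/
lemma hasDerivAt_pow_mul_radialStress (hr : IsCavitatingProfile d h lam σ r)
    (hh : IsVolumetricEnergy h) (hlam : 0 < lam) (hd : 2 ≤ d) {s : ℝ} (hs : s ∈ Ioo 0 σ) :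
    HasDerivAt (fun ξ => ξ ^ (d - 1) * radialStress d h (deriv r ξ) (r ξ / ξ))
      (s ^ (d + 1) * iteratedDeriv 2 r s +
        (d - 1) * s ^ (d - 2) * hoopStress d h (deriv r s) (r s / s)) s := by
  have hs0 : s ≠ 0 := hs.1.ne'
  have h1 := hr.equation s hs
  have h2 := ((hasDerivAt_id s).fun_pow (d - 1)).fun_mul (hr.hasDerivAt_radialStress hh hlam hd hs)
  refine h2.differentiableAt.hasDerivAt.congr_deriv ?_
  simp only [id]
  obtain ⟨k, rfl⟩ : ∃ k, d = k + 2 := ⟨d - 2, by omega⟩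
  simp only [Nat.add_sub_cancel, show k + 2 - 1 = k + 1 by omega] at h1 ⊢
  rw [eq_sub_iff_add_eq, eq_div_iff (by positivity)] at h1
  rw [← h1]
  field_simp
  ring

/-- This quantity is r^{d-1} times the Cauchy stress, and r stays bounded at the cavity. -/
lemma tendsto_pow_mul_radialStress_zero (hr : IsCavitatingProfile d h lam σ r)
    (hlam : 0 < lam) :
    Tendsto (fun s => s ^ (d - 1) * radialStress d h (deriv r s) (r s / s)) (𝓝[>] 0) (𝓝 0) := by
  have h1 := (hr.tendsto_right_zero.pow (d - 1)).mul hr.stress_free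
  rw [mul_zero] at h1
  refine h1.congr' ?_
  filter_upwards [self_mem_nhdsWithin] with s hs
  have hs : 0 < s := hs
  have h2 : 0 < r s / s := div_pos (hr.pos hlam hs.le) hs
  have h3 : r s = s * (r s / s) := by field_simp
  generalize r s / s = b at *
  rw [h3, mul_pow]
  field_simp

/-- Behind the shock R^{d-1}w_tt is R^{d-2} times s³r'' with s = R/t, so this bound makes the
inertia integrable. It comes from `second_deriv_eq`: near 0 the coefficient of r'' is at least of
order (r/s)^{2(d-1)}, and at σ it has a nonzero limit by the Lax condition. -/
lemma exists_second_deriv_bound (hr : IsCavitatingProfile d h lam σ r)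
    (hh : IsVolumetricEnergy h) (hlam : 0 < lam) (hd : 2 ≤ d) :
    ∃ C, 0 < C ∧ ∀ s ∈ Ioo 0 σ, |s ^ 3 * iteratedDeriv 2 r s| ≤ C := by
  obtain ⟨c, C, hc, hC, hcC⟩ := hr.exists_jacobian_bounds hh hlam
  obtain ⟨D, hD, hD2⟩ := hr.exists_deriv_le hh hlam
  obtain ⟨m, M, hm, hM, hmM⟩ := hh.exists_second_bounds (C := C) hc
  obtain ⟨a, ha, ha2, -, -, hlax⟩ := hr.shock
  have hd1 : (0 : ℝ) ≤ d - 1 := by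
    have : (2 : ℝ) ≤ d := by exact_mod_cast hd
    linarith
  have hcont : ContinuousOn (fun s => |s ^ 3 * iteratedDeriv 2 r s|) (Ioo 0 σ) :=
    ((continuousOn_pow 3).mul hr.continuousOn_second).abs
  refine exists_bound_of_eventually hcont (C₀ := (d - 1) * 2 * (1 + C * M) / m)
    (C₁ := |σ ^ 2 * (d - 1) * (a - lam) * (1 + lam ^ (d - 2) * (a * lam ^ (d - 1)) *
      iteratedDeriv 2 h (a * lam ^ (d - 1))) / (σ ^ 2 - radialSpeedSq d h a lam)| + 1) ?_ ?_
  · filter_upwards [Ioo_mem_nhdsGT hr.speed_pos, Ioo_mem_nhdsGT one_pos,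
      -- The hoop strain eventually exceeds the bound D for r', which gives |r' - r/s| ≤ 2r/s below.
      hr.tendsto_hoop_zero.eventually_ge_atTop 1, hr.tendsto_hoop_zero.eventually_ge_atTop D]
      with s hs hs1 hb1 hbD
    have heq := hr.second_deriv_eq hh hlam hd hs
    have ha0 := hr.deriv_pos s hs
    have haD := hD2 s hs.1 hs.2.ne
    obtain ⟨hv1, hv2⟩ := hcC s hs.1 hs.2.ne
    obtain ⟨hm1, hm2⟩ := hmM _ hv1 hv2
    have hs0 := hs.1
    simp only [radialSpeedSq] at heq
    generalize r s / s = b at *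
    generalize deriv r s = a' at *
    generalize iteratedDeriv 2 r s = r2 at *
    generalize hv : a' * b ^ (d - 1) = v at *
    generalize iteratedDeriv 2 h v = H at *
    have hv0 : 0 < v := hc.trans_le hv1
    have hb0 : 0 < b := by linarith
    have hH0 : 0 < H := hm.trans_le hm1
    have hs2 : s ^ 2 ≤ 1 := pow_le_one₀ hs0.le hs1.2.le
    have hlow : b ^ (2 * (d - 1)) * m ≤ |s ^ 2 - (1 + b ^ (2 * (d - 1)) * H)| := by
      rw [abs_sub_comm]
      refine le_trans ?_ (le_abs_self _)
      have : b ^ (2 * (d - 1)) * m ≤ b ^ (2 * (d - 1)) * H := by gcongr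
      linarith
    have hup : |(d - 1) / s * (a' - b) * (1 + b ^ (d - 2) * v * H)| ≤
        (d - 1) / s * (2 * b) * (b ^ (d - 2) * (1 + C * M)) := by
      rw [abs_mul, abs_mul, abs_of_nonneg (by positivity : 0 ≤ (d - 1) / s),
        abs_of_nonneg (by positivity : 0 ≤ 1 + b ^ (d - 2) * v * H)]
      have h1 : |a' - b| ≤ 2 * b := by rw [abs_le]; constructor <;> linarith
      have h2 : 1 + b ^ (d - 2) * v * H ≤ b ^ (d - 2) * (1 + C * M) := by
        have h3 : 1 ≤ b ^ (d - 2) := one_le_pow₀ hb1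
        have h4 : v * H ≤ C * M := by gcongr
        nlinarith
      gcongr
    rw [← heq, abs_mul] at hup
    have h3 : b ^ (2 * (d - 1)) * m * |r2| ≤ (d - 1) / s * (2 * b) * (b ^ (d - 2) * (1 + C * M)) :=
      (mul_le_mul_of_nonneg_right hlow (abs_nonneg _)).trans hup
    obtain ⟨k, rfl⟩ : ∃ k, d = k + 2 := ⟨d - 2, by omega⟩
    simp only [Nat.add_sub_cancel, show k + 2 - 1 = k + 1 by omega] at *
    have h4 : b ^ (2 * (k + 1)) * m * |r2| * s ≤ b ^ (k + 1) * ((((k + 2 : ℕ) : ℝ) - 1) * 2 * (1 + C * M)) := by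
      calc _ ≤ (((k + 2 : ℕ) : ℝ) - 1) / s * (2 * b) * (b ^ k * (1 + C * M)) * s := by gcongr
        _ = _ := by field_simp; ring
    have h5 : m * (|r2| * s) ≤ (((k + 2 : ℕ) : ℝ) - 1) * 2 * (1 + C * M) := by
      have h6 : b ^ (k + 1) * (m * (|r2| * s)) ≤ b ^ (k + 1) * (b ^ (k + 1) * (m * (|r2| * s))) := by
        have : 1 ≤ b ^ (k + 1) := one_le_pow₀ hb1
        refine mul_le_mul_of_nonneg_left ?_ (by positivity)
        have : 0 ≤ m * (|r2| * s) := by positivity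
        nlinarith
      have h7 : b ^ (k + 1) * (b ^ (k + 1) * (m * (|r2| * s))) = b ^ (2 * (k + 1)) * m * |r2| * s := by
        ring
      exact le_of_mul_le_mul_left (h6.trans (h7.le.trans h4)) (by positivity)
    rw [abs_mul, abs_of_pos (by positivity : 0 < s ^ 3), le_div_iff₀ hm]
    calc s ^ 3 * |r2| * m = s ^ 2 * (m * (|r2| * s)) := by ring
      _ ≤ 1 * (m * (|r2| * s)) := by gcongr
      _ ≤ _ := by linarith
  · have hv0 : 0 < a * lam ^ (d - 1) := by positivity
    have hv : Tendsto (fun s => deriv r s * (r s / s) ^ (d - 1)) (𝓝[<] σ)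
      (𝓝 (a * lam ^ (d - 1))) := ha2.mul (hr.tendsto_hoop_left_shock.pow _)
    have hH := (hh.continuousAt_second hv0).tendsto.comp hv
    have hb := hr.tendsto_hoop_left_shock
    have hs : Tendsto (fun s : ℝ => s) (𝓝[<] σ) (𝓝 σ) :=
      tendsto_nhdsWithin_of_tendsto_nhds tendsto_id
    have hcc : Tendsto (fun s => radialSpeedSq d h (deriv r s) (r s / s)) (𝓝[<] σ)
        (𝓝 (radialSpeedSq d h a lam)) := ((hb.pow _).mul hH).const_add 1
    -- The Lax condition: the shock is subsonic with respect to the state behind it, so the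
    -- coefficient of r'' does not degenerate.
    have hne : σ ^ 2 - radialSpeedSq d h a lam ≠ 0 := by linarith
    have hden := (hs.pow 2).sub hcc
    have hnum := (((hs.pow 2).mul_const ((d : ℝ) - 1)).mul (ha2.sub hb)).mul
      ((((hb.pow (d - 2)).mul hv).mul hH).const_add 1)
    have hlim := (hnum.div hden hne).abs
    filter_upwards [hlim.eventually_le_const (lt_add_one _), hden.eventually_ne hne,
      Ioo_mem_nhdsLT hr.speed_pos] with s h1 h2 hs
    refine le_trans (le_of_eq ?_) h1
    congr 1
    have heq := hr.second_deriv_eq hh hlam hd hs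
    simp only [Pi.div_apply, Function.comp_apply]
    rw [eq_div_iff h2]
    have hs0 := hs.1
    calc _ = s ^ 3 * ((s ^ 2 - radialSpeedSq d h (deriv r s) (r s / s)) * iteratedDeriv 2 r s) := by
          ring
      _ = _ := by
          rw [heq]
          generalize r s / s = b
          field_simp

end IsCavitatingProfile

end Profile

/-! ### Integration in polar coordinates -/

section Polar

variable {E : Type*} [NormedAddCommGroup E] [NormedSpace ℝ E] [MeasurableSpace E] [BorelSpace E]
  [FiniteDimensional ℝ E] (μ : Measure E) [μ.IsAddHaarMeasure]

lemma integral_volumeIoiPow (n : ℕ) (f : ℝ → ℝ) :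
    ∫ x : Ioi (0 : ℝ), f x ∂(Measure.volumeIoiPow n) = ∫ x in Ioi (0 : ℝ), x ^ n * f x := by
  simp only [Measure.volumeIoiPow, ENNReal.ofReal]
  rw [integral_withDensity_eq_integral_smul,
    integral_subtype_comap measurableSet_Ioi fun a ↦ Real.toNNReal (a ^ n) • f a,
    setIntegral_congr_fun measurableSet_Ioi fun x hx ↦ ?_]
  · rw [NNReal.smul_def, Real.coe_toNNReal _ (pow_nonneg (le_of_lt hx) _), smul_eq_mul]
  · exact (measurable_subtype_coe.pow_const _).real_toNNReal

lemma integrable_volumeIoiPow_iff (n : ℕ) (f : ℝ → ℝ) :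
    Integrable (fun x : Ioi (0 : ℝ) => f x) (Measure.volumeIoiPow n) ↔
      IntegrableOn (fun x => x ^ n * f x) (Ioi 0) := by
  rw [integrableOn_iff_comap_subtypeVal measurableSet_Ioi, Measure.volumeIoiPow,
    integrable_withDensity_iff_integrable_smul', integrable_congr]
  · refine .of_forall ?_
    rintro ⟨x, hx : 0 < x⟩
    simp (disch := positivity) [ENNReal.toReal_ofReal]
  · fun_prop
  · simp

lemma integral_eq_integral_sphere_prod [Nontrivial E] (G : E → ℝ) :
    ∫ x, G x ∂μ = ∫ p : Metric.sphere (0 : E) 1 × Ioi (0 : ℝ), G (p.2.1 • p.1.1)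
      ∂(μ.toSphere.prod (Measure.volumeIoiPow (Module.finrank ℝ E - 1))) := by
  have h1 := μ.measurePreserving_homeomorphUnitSphereProd.symm
    (e := (homeomorphUnitSphereProd E).toMeasurableEquiv)
  have h2 := h1.integral_comp' (fun x : ({(0 : E)}ᶜ : Set E) => G x)
  calc ∫ x, G x ∂μ = ∫ x : ({(0)}ᶜ : Set E), G x.1 ∂(μ.comap (↑)) := by
        rw [integral_subtype_comap (measurableSet_singleton _).compl G, restrict_compl_singleton]
    _ = _ := h2.symm

lemma integrable_sphere_prod {G : E → ℝ} (hG : Integrable G μ) :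
    Integrable (fun p : Metric.sphere (0 : E) 1 × Ioi (0 : ℝ) => G (p.2.1 • p.1.1))
      (μ.toSphere.prod (Measure.volumeIoiPow (Module.finrank ℝ E - 1))) := by
  have h1 := μ.measurePreserving_homeomorphUnitSphereProd.symm
    (e := (homeomorphUnitSphereProd E).toMeasurableEquiv)
  refine h1.integrable_comp_of_integrable (g := fun x : ({(0 : E)}ᶜ : Set E) => G x) ?_
  have := hG.integrableOn (s := {(0 : E)}ᶜ)
  rwa [integrableOn_iff_comap_subtypeVal (measurableSet_singleton _).compl] at this

/-- Directions outermost, for identities that hold on every single ray. -/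
lemma integral_polar [Nontrivial E] {G : E → ℝ} (hG : Integrable G μ) :
    ∫ x, G x ∂μ = ∫ ω : Metric.sphere (0 : E) 1, (∫ R in Ioi (0 : ℝ),
      R ^ (Module.finrank ℝ E - 1) * G (R • ω.1)) ∂μ.toSphere := by
  rw [integral_eq_integral_sphere_prod, integral_prod _ (integrable_sphere_prod μ hG)]
  congr 1
  ext ω
  exact integral_volumeIoiPow _ fun R => G (R • ω.1)

/-- Radii outermost, for pulling radial factors out of the spherical integral. -/
lemma integral_polar_symm [Nontrivial E] {G : E → ℝ} (hG : Integrable G μ) :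
    ∫ x, G x ∂μ = ∫ R in Ioi (0 : ℝ), R ^ (Module.finrank ℝ E - 1) *
      ∫ ω : Metric.sphere (0 : E) 1, G (R • ω.1) ∂μ.toSphere := by
  rw [integral_eq_integral_sphere_prod, integral_prod_symm _ (integrable_sphere_prod μ hG)]
  exact integral_volumeIoiPow _ fun R => ∫ ω : Metric.sphere (0 : E) 1, G (R • ω.1) ∂μ.toSphere

lemma integrableOn_sphere_integral {G : E → ℝ} (hG : Integrable G μ) :
    IntegrableOn (fun R => R ^ (Module.finrank ℝ E - 1) *
      ∫ ω : Metric.sphere (0 : E) 1, G (R • ω.1) ∂μ.toSphere) (Ioi 0) := by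
  rw [← integrable_volumeIoiPow_iff]
  exact (integrable_sphere_prod μ hG).integral_prod_right

end Polar

/-! ### Integrability at the axis and the tangential divergence -/

section Space

variable {d : ℕ}

lemma nontrivial_euclideanSpace (hd : 1 ≤ d) : Nontrivial (EuclideanSpace ℝ (Fin d)) := by
  apply Module.nontrivial_of_finrank_pos (R := ℝ)
  simpa using Nat.pos_of_ne_zero (by omega)

lemma integrableOn_inv_norm_pow (hd : 1 ≤ d) (M : ℝ) :
    IntegrableOn (fun x : EuclideanSpace ℝ (Fin d) => (‖x‖ ^ (d - 1))⁻¹) (Metric.ball 0 M) := by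
  have : Nontrivial (EuclideanSpace ℝ (Fin d)) := nontrivial_euclideanSpace hd
  rw [integrableOn_fun_norm_addHaar volume (f := fun R => (R ^ (d - 1))⁻¹)]
  refine (integrableOn_const (C := (1 : ℝ)) (by simp)).congr_fun (fun x hx => ?_) measurableSet_Ioo
  have : 0 < x := hx.1
  simp only [finrank_euclideanSpace, Fintype.card_fin, smul_eq_mul]
  field_simp

/-- The weight |x|^{1-d} is locally integrable because the Jacobian R^{d-1} of polar coordinates
cancels it. -/
lemma integrable_of_mul_norm_pow_le (hd : 1 ≤ d) {f : EuclideanSpace ℝ (Fin d) → ℝ} {C M : ℝ}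
    (hf : AEStronglyMeasurable f) (hC : ∀ x, x ≠ 0 → ‖x‖ ≤ M → |f x| * ‖x‖ ^ (d - 1) ≤ C)
    (hM : ∀ x, M < ‖x‖ → f x = 0) : Integrable f := by
  have : Nontrivial (EuclideanSpace ℝ (Fin d)) := nontrivial_euclideanSpace hd
  have h1 : IntegrableOn f (Metric.ball 0 (M + 1)) := by
    refine ((integrableOn_inv_norm_pow hd (M + 1)).const_mul (max C 0)).mono' hf.restrict ?_
    refine ae_restrict_of_ae ?_
    filter_upwards [compl_mem_ae_iff.2 (measure_singleton (0 : EuclideanSpace ℝ (Fin d)))] with x hx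
    have hx0 : 0 < ‖x‖ := norm_pos_iff.2 hx
    rw [Real.norm_eq_abs, ← div_eq_mul_inv, le_div_iff₀ (by positivity)]
    rcases le_or_gt ‖x‖ M with hxM | hxM
    · exact (hC x hx hxM).trans (le_max_left _ _)
    · simp [hM x hxM]
  rw [← integrableOn_univ]
  refine h1.of_forall_sdiff_eq_zero MeasurableSet.univ fun x hx => hM x ?_
  have : ¬ ‖x‖ < M + 1 := by simpa using hx.2
  linarith

lemma integrable_prod_of_mul_norm_pow_le (hd : 1 ≤ d) {f : EuclideanSpace ℝ (Fin d) × ℝ → ℝ}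
    {C M : ℝ} (hf : AEStronglyMeasurable f)
    (hC : ∀ x t, x ≠ 0 → ‖x‖ ≤ M → |t| ≤ M → |f (x, t)| * ‖x‖ ^ (d - 1) ≤ C)
    (hM : ∀ x t, M < ‖x‖ ∨ M < |t| → f (x, t) = 0) : Integrable f := by
  have : Nontrivial (EuclideanSpace ℝ (Fin d)) := nontrivial_euclideanSpace hd
  have h1 : Integrable (fun x : EuclideanSpace ℝ (Fin d) =>
      (Metric.ball 0 (M + 1)).indicator (fun x => (‖x‖ ^ (d - 1))⁻¹) x) :=
    (integrable_indicator_iff measurableSet_ball).2 (integrableOn_inv_norm_pow hd (M + 1))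
  have h2 : Integrable (fun t : ℝ => (Icc (-M) M).indicator (fun _ => max C 0) t) :=
    (integrable_indicator_iff measurableSet_Icc).2 (integrableOn_const (by simp))
  refine (h1.mul_prod h2).mono' hf ?_
  have h3 : ∀ᵐ p : EuclideanSpace ℝ (Fin d) × ℝ, p.1 ≠ 0 :=
    Measure.quasiMeasurePreserving_fst.ae
      (compl_mem_ae_iff.2 (measure_singleton (0 : EuclideanSpace ℝ (Fin d))))
  filter_upwards [h3] with ⟨x, t⟩ hx
  have hx0 : 0 < ‖x‖ := norm_pos_iff.2 hx
  by_cases hxt : ‖x‖ ≤ M ∧ |t| ≤ M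
  · have hx1 : x ∈ Metric.ball (0 : EuclideanSpace ℝ (Fin d)) (M + 1) := by
      simpa using by linarith [hxt.1]
    have ht1 : t ∈ Icc (-M) M := abs_le.1 hxt.2
    simp only [indicator_of_mem hx1, indicator_of_mem ht1, Real.norm_eq_abs]
    rw [mul_comm, ← div_eq_mul_inv, le_div_iff₀ (by positivity)]
    exact (hC x t hx hxt.1 hxt.2).trans (le_max_left _ _)
  · rw [hM x t (by by_contra! hcon; exact hxt hcon), norm_zero]
    refine mul_nonneg (indicator_nonneg (fun y _ => by positivity) _)
      (indicator_nonneg (fun y _ => le_max_right _ _) _)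

/-- The part of the divergence of `u` that has zero mean on spheres: the divergence of the
tangential component of `u`. -/
noncomputable def tangentialDivergence
    (u : EuclideanSpace ℝ (Fin d) → EuclideanSpace ℝ (Fin d)) (x : EuclideanSpace ℝ (Fin d)) : ℝ :=
  ∑ i, gradMatrix u x i i - inner ℝ x (fderiv ℝ u x x) / ‖x‖ ^ 2
    - (d - 1) / ‖x‖ ^ 2 * inner ℝ x (u x)

variable {u : EuclideanSpace ℝ (Fin d) → EuclideanSpace ℝ (Fin d)}

lemma inner_fderiv_eq_sum (u : EuclideanSpace ℝ (Fin d) → EuclideanSpace ℝ (Fin d))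
    (x : EuclideanSpace ℝ (Fin d)) :
    inner ℝ x (fderiv ℝ u x x) = ∑ i, ∑ j, x i * x j * gradMatrix u x i j := by
  have hx : x = ∑ j, x j • EuclideanSpace.single j (1 : ℝ) := by
    ext k
    simp [Finset.sum_apply, Pi.single_apply]
  have h1 : fderiv ℝ u x x = ∑ j, x j • fderiv ℝ u x (EuclideanSpace.single j (1 : ℝ)) := by
    conv_lhs => rw [hx, map_sum]
    simp only [map_smul]
    rw [← hx]
  rw [PiLp.inner_apply, h1]
  refine Finset.sum_congr rfl fun i _ => ?_
  simp only [gradMatrix, Matrix.of_apply, WithLp.ofLp_sum, Finset.sum_apply, PiLp.smul_apply,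
    RCLike.inner_apply, conj_trivial, Finset.sum_mul, smul_eq_mul]
  exact Finset.sum_congr rfl fun j _ => by ring

lemma continuous_gradMatrix_apply (hu : ContDiff ℝ 1 u) (i j : Fin d) :
    Continuous fun x => gradMatrix u x i j := by
  simp only [gradMatrix, Matrix.of_apply]
  have := hu.continuous_fderiv one_ne_zero
  fun_prop

/-- The only singularity is 1/|x|, from the curvature term with x·u. -/
lemma exists_tangentialDivergence_bound (hd : 1 ≤ d) (hu : ContDiff ℝ 1 u) (hc : HasCompactSupport u) :
    ∃ C M, 0 < C ∧ 0 < M ∧ (∀ x, x ≠ 0 → ‖x‖ ≤ M → |tangentialDivergence u x| * ‖x‖ ≤ C) ∧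
      ∀ x, M < ‖x‖ → tangentialDivergence u x = 0 ∧ u x = 0 := by
  obtain ⟨M, hM, hM2⟩ := hc.isCompact.isBounded.exists_pos_norm_le
  obtain ⟨C0, hC0⟩ := hc.exists_bound_of_continuous hu.continuous
  obtain ⟨C1, hC1⟩ := (hc.fderiv ℝ).exists_bound_of_continuous (hu.continuous_fderiv one_ne_zero)
  have hzero : ∀ x, M < ‖x‖ → u x = 0 ∧ fderiv ℝ u x = 0 := fun x hx => by
    have hx2 : x ∉ tsupport u := fun h => absurd (hM2 x h) (not_le.2 hx)
    exact ⟨image_eq_zero_of_notMem_tsupport hx2, image_eq_zero_of_notMem_tsupport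
      fun h => hx2 (tsupport_fderiv_subset ℝ h)⟩
  have hC0' : 0 ≤ C0 := (norm_nonneg _).trans (hC0 0)
  have hC1' : 0 ≤ C1 := (norm_nonneg _).trans (hC1 0)
  have hd1 : (0 : ℝ) ≤ d - 1 := by
    have : (1 : ℝ) ≤ d := by exact_mod_cast hd
    linarith
  refine ⟨d * C1 * M + C1 * M + (d - 1) * C0 + 1, M, by positivity, hM, fun x hx hxM => ?_,
    fun x hx => ?_⟩
  · have hx0 : 0 < ‖x‖ := norm_pos_iff.2 hx
    have h1 : |∑ i, gradMatrix u x i i| ≤ d * C1 := by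
      refine (Finset.abs_sum_le_sum_abs _ _).trans ?_
      calc _ ≤ ∑ i : Fin d, C1 := by
            refine Finset.sum_le_sum fun i _ => ?_
            rw [gradMatrix, Matrix.of_apply, ← Real.norm_eq_abs]
            refine (PiLp.norm_apply_le _ _).trans (((fderiv ℝ u x).le_opNorm _).trans ?_)
            simpa using hC1 x
        _ = _ := by simp
    have h2 : |inner ℝ x (fderiv ℝ u x x) / ‖x‖ ^ 2| ≤ C1 := by
      rw [abs_div, abs_of_pos (by positivity : 0 < ‖x‖ ^ 2), div_le_iff₀ (by positivity)]
      calc _ ≤ ‖x‖ * ‖fderiv ℝ u x x‖ := abs_real_inner_le_norm _ _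
        _ ≤ ‖x‖ * (C1 * ‖x‖) := by
            gcongr; exact ((fderiv ℝ u x).le_opNorm _).trans (by gcongr; exact hC1 x)
        _ = _ := by ring
    have h3 : |(d - 1) / ‖x‖ ^ 2 * inner ℝ x (u x)| * ‖x‖ ≤ (d - 1) * C0 := by
      rw [abs_mul, abs_of_nonneg (by positivity : 0 ≤ ((d : ℝ) - 1) / ‖x‖ ^ 2)]
      calc _ ≤ (d - 1) / ‖x‖ ^ 2 * (‖x‖ * C0) * ‖x‖ := by
            gcongr; exact (abs_real_inner_le_norm _ _).trans (by gcongr; exact hC0 x)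
        _ = _ := by field_simp
    calc _ ≤ (|∑ i, gradMatrix u x i i| + |inner ℝ x (fderiv ℝ u x x) / ‖x‖ ^ 2|
          + |(d - 1) / ‖x‖ ^ 2 * inner ℝ x (u x)|) * ‖x‖ := by
          gcongr; exact (abs_sub _ _).trans (by gcongr; exact abs_sub _ _)
      _ ≤ d * C1 * M + C1 * M + (d - 1) * C0 := by
          rw [add_mul, add_mul]; gcongr
      _ ≤ _ := by linarith
  · obtain ⟨h1, h2⟩ := hzero x hx
    simp [tangentialDivergence, gradMatrix, h1, h2]

lemma measurable_tangentialDivergence (hu : ContDiff ℝ 1 u) :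
    Measurable (tangentialDivergence u) := by
  have h1 := continuous_gradMatrix_apply hu
  have h2 := hu.continuous
  have h3 := hu.continuous_fderiv one_ne_zero
  have h4 : Continuous fun x => fderiv ℝ u x x := by fun_prop
  refine ((Finset.measurable_sum _ fun i _ => (h1 i i).measurable).sub
    ((continuous_id.inner h4).measurable.div (by fun_prop))).sub
      (Measurable.mul (by fun_prop) (continuous_id.inner h2).measurable)

/-- A support away from 0 makes g(|x|) vanish near the origin, where the norm is not differentiable.
-/
lemma hasFDerivAt_radial {g : ℝ → ℝ} (hg : ContDiff ℝ 1 g) (hs : tsupport g ⊆ Ioi 0)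
    (x : EuclideanSpace ℝ (Fin d)) :
    HasFDerivAt (fun z : EuclideanSpace ℝ (Fin d) => g ‖z‖) ((deriv g ‖x‖ / ‖x‖) • innerSL ℝ x) x := by
  by_cases hx : x = 0
  · subst hx
    have h0 : (0 : ℝ) ∉ tsupport g := fun h => lt_irrefl (0 : ℝ) (hs h)
    have h1 : ∀ᶠ z : EuclideanSpace ℝ (Fin d) in 𝓝 0, g ‖z‖ = 0 := by
      have h2 := notMem_tsupport_iff_eventuallyEq.1 h0
      have h3 := (tendsto_norm_zero (E := EuclideanSpace ℝ (Fin d))).eventually h2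
      filter_upwards [h3] with z hz using hz
    simp only [norm_zero, div_zero, zero_smul]
    exact (hasFDerivAt_const (0 : ℝ) (0 : EuclideanSpace ℝ (Fin d))).congr_of_eventuallyEq h1
  · have hn : ‖x‖ ≠ 0 := by positivity
    have h1 : HasFDerivAt (fun z : EuclideanSpace ℝ (Fin d) => ‖z‖) (‖x‖⁻¹ • innerSL ℝ x) x := by
      have h2 := (hasStrictFDerivAt_norm_sq x).hasFDerivAt
      have h3 := h2.sqrt (by positivity)
      simp only [Real.sqrt_sq (norm_nonneg _)] at h3
      have h4 : (1 / (2 * ‖x‖)) • 2 • (innerSL ℝ) x = ‖x‖⁻¹ • innerSL ℝ x := by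
        ext v
        simp
        field_simp
      rwa [h4] at h3
    have h2 := ((hg.differentiable one_ne_zero ‖x‖).hasDerivAt).comp_hasFDerivAt x h1
    rwa [smul_smul, ← div_eq_mul_inv] at h2

lemma integral_radial_mul_divergence (hu : ContDiff ℝ 1 u) (hc : HasCompactSupport u) {g : ℝ → ℝ}
    (hg : ContDiff ℝ 1 g) (hs : tsupport g ⊆ Ioi 0) :
    ∫ x, g ‖x‖ * ∑ i, gradMatrix u x i i = - ∫ x, deriv g ‖x‖ / ‖x‖ * inner ℝ x (u x) := by
  have hgd : Continuous (deriv g) := hg.continuous_deriv le_rfl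
  have hgd0 : tsupport (deriv g) ⊆ Ioi 0 := (tsupport_deriv_subset).trans hs
  have hq : Continuous fun R => deriv g R / R := by
    refine continuous_iff_continuousAt.2 fun R => ?_
    by_cases hR : R = 0
    · subst hR
      have h0 : (0 : ℝ) ∉ tsupport (deriv g) := fun h => lt_irrefl (0 : ℝ) (hgd0 h)
      have h2 := notMem_tsupport_iff_eventuallyEq.1 h0
      refine (continuousAt_const (y := (0 : ℝ))).congr ?_
      filter_upwards [h2] with z hz
      simp [hz]
    · exact hgd.continuousAt.div continuousAt_id hR
  have hcomp : ∀ i : Fin d, ContDiff ℝ 1 fun x => u x i := fun i => by fun_prop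
  have hsupp : ∀ i : Fin d, HasCompactSupport fun x => u x i := fun i =>
    hc.comp_left (g := fun y : EuclideanSpace ℝ (Fin d) => y i) rfl
  have hfd : ∀ i j x, fderiv ℝ (fun x => u x i) x (EuclideanSpace.single j 1) = gradMatrix u x i j := by
    intro i j x
    have h1 := ((hu.differentiable one_ne_zero x).hasFDerivAt)
    have h2 := (EuclideanSpace.proj (𝕜 := ℝ) i).hasFDerivAt.comp x h1
    rw [gradMatrix, Matrix.of_apply]
    have h3 := h2.fderiv
    simp only [Function.comp_def, PiLp.proj_apply] at h3
    rw [h3]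
    simp
  have hgsupp : ∀ i j, HasCompactSupport fun x => gradMatrix u x i j := fun i j => by
    simp_rw [← hfd]
    exact ((hsupp i).fderiv ℝ).comp_left (g := fun L : EuclideanSpace ℝ (Fin d) →L[ℝ] ℝ =>
      L (EuclideanSpace.single j 1)) rfl
  have hkey : ∀ i, ∫ x, g ‖x‖ * gradMatrix u x i i = - ∫ x, deriv g ‖x‖ / ‖x‖ * (x i * u x i) := by
    intro i
    have hf' : ∀ x : EuclideanSpace ℝ (Fin d),
        fderiv ℝ (fun z : EuclideanSpace ℝ (Fin d) => g ‖z‖) x (EuclideanSpace.single i 1)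
          = deriv g ‖x‖ / ‖x‖ * x i := fun x => by
      rw [(hasFDerivAt_radial hg hs x).fderiv]
      simp [EuclideanSpace.inner_single_right]
    have hI := integral_mul_fderiv_eq_neg_fderiv_mul_of_integrable (μ := volume)
      (f := fun z : EuclideanSpace ℝ (Fin d) => g ‖z‖) (g := fun x => u x i)
      (v := EuclideanSpace.single i 1) ?_ ?_ ?_
      (fun x _ => (hasFDerivAt_radial hg hs x).differentiableAt)
      (fun x _ => (hcomp i).differentiable one_ne_zero x)
    · simp_rw [hf', hfd] at hI
      rw [hI]
      simp_rw [mul_assoc]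
    · simp_rw [hf']
      refine Continuous.integrable_of_hasCompactSupport ?_ ((hsupp i).mul_left)
      exact ((hq.comp continuous_norm).mul (by fun_prop)).mul (hcomp i).continuous
    · simp_rw [hfd]
      refine Continuous.integrable_of_hasCompactSupport ?_ ((hgsupp i i).mul_left)
      exact (hg.continuous.comp continuous_norm).mul (continuous_gradMatrix_apply hu i i)
    · refine Continuous.integrable_of_hasCompactSupport ?_ ((hsupp i).mul_left)
      exact (hg.continuous.comp continuous_norm).mul (hcomp i).continuous
  simp_rw [Finset.mul_sum]
  rw [integral_finsetSum]
  · simp_rw [hkey, PiLp.inner_apply, RCLike.inner_apply, conj_trivial, Finset.mul_sum]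
    rw [integral_finsetSum, Finset.sum_neg_distrib]
    · simp_rw [mul_comm]
    · intro i _
      refine Continuous.integrable_of_hasCompactSupport ?_ ((hsupp i).mul_right.mul_left)
      exact (hq.comp continuous_norm).mul ((hcomp i).continuous.mul (by fun_prop))
  · intro i _
    refine Continuous.integrable_of_hasCompactSupport ?_ ((hgsupp i i).mul_left)
    exact (hg.continuous.comp continuous_norm).mul (continuous_gradMatrix_apply hu i i)

/-- Integrating g(|x|) div u by parts in space leaves -∫ g'(|x|) x·u/|x|. Integrating the radial
part of the divergence by parts along each ray gives the same, so their difference, the tangential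
part, contributes nothing. -/
lemma integral_radial_mul_tangentialDivergence_of_smooth (hd : 3 ≤ d) (hu : ContDiff ℝ 1 u)
    (hc : HasCompactSupport u) {g : ℝ → ℝ} (hg : ContDiff ℝ 1 g) (hgc : HasCompactSupport g)
    (hs : tsupport g ⊆ Ioi 0) : ∫ x, g ‖x‖ * tangentialDivergence u x = 0 := by
  have hnt : Nontrivial (EuclideanSpace ℝ (Fin d)) := nontrivial_euclideanSpace (by omega)
  obtain ⟨C, M, hC, hM, hCM, hM0⟩ := exists_tangentialDivergence_bound (by omega) hu hc
  obtain ⟨Cg, hCg⟩ := hgc.exists_bound_of_continuous hg.continuous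
  have hgd : Continuous (deriv g) := hg.continuous_deriv le_rfl
  have hgm : Measurable g := hg.continuous.measurable
  obtain ⟨N, hN, hN2⟩ := hgc.isCompact.isBounded.exists_pos_norm_le
  have hfd := hu.continuous_fderiv one_ne_zero
  have hucont := hu.continuous
  have hcg : ∀ i j, Continuous fun x => gradMatrix u x i j := continuous_gradMatrix_apply hu
  have hI1 : Integrable fun x : EuclideanSpace ℝ (Fin d) => g ‖x‖ * tangentialDivergence u x := by
    refine integrable_of_mul_norm_pow_le (by omega) (C := Cg * C * M ^ (d - 2)) (M := M)
      ((hgm.comp measurable_norm).mul (measurable_tangentialDivergence hu)).aestronglyMeasurable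
      (fun x hx hxM => ?_) (fun x hx => by rw [(hM0 x hx).1, mul_zero])
    rw [abs_mul, show d - 1 = (d - 2) + 1 by omega, pow_succ]
    calc _ = |g ‖x‖| * (|tangentialDivergence u x| * ‖x‖) * ‖x‖ ^ (d - 2) := by ring
      _ ≤ _ := by
        have h1 := hCg ‖x‖
        rw [Real.norm_eq_abs] at h1
        have h0 : 0 ≤ Cg := (abs_nonneg _).trans h1
        have h2 := hCM x hx hxM
        gcongr
  have hI2 : Integrable fun x : EuclideanSpace ℝ (Fin d) => g ‖x‖ * ∑ i, gradMatrix u x i i := by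
    refine Continuous.integrable_of_hasCompactSupport (by fun_prop) (HasCompactSupport.of_support_subset_isCompact (isCompact_closedBall 0 N) ?_)
    intro x hx
    have : g ‖x‖ ≠ 0 := left_ne_zero_of_mul hx
    have h2 := hN2 _ (subset_tsupport g this)
    simpa using h2
  have hgq : ∀ q : ℝ → ℝ, Continuous q → tsupport q ⊆ Ioi 0 → ∀ k : ℕ,
      Continuous fun R => q R / R ^ k := by
    intro q hq hq0 k
    refine continuous_iff_continuousAt.2 fun R => ?_
    by_cases hR : R = 0
    · subst hR
      have h0 : (0 : ℝ) ∉ tsupport q := fun h => lt_irrefl (0 : ℝ) (hq0 h)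
      have h2 := notMem_tsupport_iff_eventuallyEq.1 h0
      refine (continuousAt_const (y := (0 : ℝ))).congr ?_
      filter_upwards [h2] with z hz
      simp [hz]
    · exact hq.continuousAt.div (by fun_prop) (pow_ne_zero _ hR)
  have hq1 := hgq (deriv g) hgd (tsupport_deriv_subset.trans hs) 1
  have hI3 : Integrable fun x : EuclideanSpace ℝ (Fin d) => deriv g ‖x‖ / ‖x‖ * inner ℝ x (u x) := by
    refine Continuous.integrable_of_hasCompactSupport ?_ (hc.mono fun x hx => ?_)
    · simp only [pow_one] at hq1
      exact (hq1.comp continuous_norm).mul (continuous_id.inner hucont)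
    · intro h0
      have h0 : u x = 0 := h0
      exact hx (by simp [h0])
  -- Along a ray R^{d-1}G is the derivative of R^{d-1} g ω·u(Rω), so G has integral zero; the first
  -- two terms of G cancel by integration by parts in space.
  set G : EuclideanSpace ℝ (Fin d) → ℝ := fun x => g ‖x‖ * ∑ i, gradMatrix u x i i
    + deriv g ‖x‖ / ‖x‖ * inner ℝ x (u x) - g ‖x‖ * tangentialDivergence u x with hG
  have hGI : Integrable G := (hI2.add hI3).sub hI1
  have h1 : ∫ x, G x = - ∫ x, g ‖x‖ * tangentialDivergence u x := by
    have e1 := integral_sub (hI2.add hI3) hI1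
    have e2 := integral_add hI2 hI3
    simp only [Pi.add_apply] at e1
    rw [e2, integral_radial_mul_divergence hu hc hg hs, neg_add_cancel, zero_sub] at e1
    exact e1
  have h2 : ∫ x, G x = 0 := by
    rw [integral_polar volume hGI]
    refine integral_eq_zero_of_ae (Eventually.of_forall fun ω => ?_)
    have hω : ‖(ω : EuclideanSpace ℝ (Fin d))‖ = 1 := by simp
    set F : ℝ → ℝ := fun R => R ^ (d - 1) * (g R * inner ℝ ω.1 (u (R • ω.1))) with hF
    have hFd : ContDiff ℝ 1 F := by
      have : ContDiff ℝ 1 fun R : ℝ => u (R • ω.1) := by fun_prop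
      exact (contDiff_id.pow _).mul (hg.mul (contDiff_const.inner ℝ this))
    have hFc : HasCompactSupport F := hgc.mul_right.mul_left
    have h3 := hFc.integral_Ioi_deriv_eq hFd 0
    have h4 : F 0 = 0 := by simp [hF, zero_pow (show d - 1 ≠ 0 by omega)]
    rw [h4, neg_zero] at h3
    refine Eq.trans ?_ h3
    refine setIntegral_congr_fun measurableSet_Ioi fun R hR => ?_
    have hR : 0 < R := hR
    have hn : ‖R • ω.1‖ = R := by rw [norm_smul, hω, Real.norm_eq_abs, abs_of_pos hR, mul_one]
    have hd1 : HasDerivAt (fun R : ℝ => u (R • ω.1)) (fderiv ℝ u (R • ω.1) ω.1) R := by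
      have h5 : HasDerivAt (fun R : ℝ => R • ω.1) ω.1 R := by
        simpa using (hasDerivAt_id R).smul_const ω.1
      exact ((hu.differentiable one_ne_zero _).hasFDerivAt).comp_hasDerivAt R h5
    have hd2 : HasDerivAt (fun R : ℝ => inner ℝ ω.1 (u (R • ω.1)))
        (inner ℝ ω.1 (fderiv ℝ u (R • ω.1) ω.1)) R := by
      simpa using (hasDerivAt_const R ω.1).inner ℝ hd1
    have hd3 := ((hasDerivAt_id R).fun_pow (d - 1)).fun_mul
      (((hg.differentiable one_ne_zero R).hasDerivAt).fun_mul hd2)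
    have hd4 := hd3.deriv
    simp only [id] at hd4
    rw [hF, hd4, hG]
    simp only [tangentialDivergence, hn, finrank_euclideanSpace, Fintype.card_fin, map_smul,
      inner_smul_left, inner_smul_right, RCLike.conj_to_real]
    obtain ⟨k, rfl⟩ : ∃ k, d = k + 2 := ⟨d - 2, by omega⟩
    simp only [show k + 2 - 1 = k + 1 by omega, Nat.add_sub_cancel]
    push_cast
    field_simp
    ring
  linarith

/-- The tangential divergence is orthogonal to radial functions. -/
lemma integral_radial_mul_tangentialDivergence (hd : 3 ≤ d) (hu : ContDiff ℝ 1 u)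
    (hc : HasCompactSupport u) {q : ℝ → ℝ} (hq : Measurable q)
    (hqb : ∀ M, ∃ K, ∀ R, 0 < R → R ≤ M → |q R| * R ≤ K) :
    ∫ x, q ‖x‖ * tangentialDivergence u x = 0 := by
  have hnt : Nontrivial (EuclideanSpace ℝ (Fin d)) := nontrivial_euclideanSpace (by omega)
  obtain ⟨C, M, hC, hM, hCM, hM0⟩ := exists_tangentialDivergence_bound (by omega) hu hc
  have hint : ∀ p : ℝ → ℝ, Measurable p → (∀ M, ∃ K, ∀ R, 0 < R → R ≤ M → |p R| * R ≤ K) →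
      Integrable fun x : EuclideanSpace ℝ (Fin d) => p ‖x‖ * tangentialDivergence u x := by
    intro p hp hpb
    obtain ⟨K, hK⟩ := hpb M
    refine integrable_of_mul_norm_pow_le (by omega) (C := K * C * M ^ (d - 3)) (M := M)
      ((hp.comp measurable_norm).mul (measurable_tangentialDivergence hu)).aestronglyMeasurable
      (fun x hx hxM => ?_) (fun x hx => by rw [(hM0 x hx).1, mul_zero])
    have hx0 : 0 < ‖x‖ := norm_pos_iff.2 hx
    -- Both factors may be as large as 1/R, and the weight R^{d-1} absorbs two such factors exactly
    -- when d ≥ 3.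
    rw [abs_mul, show d - 1 = (d - 3) + 2 by omega, pow_add]
    calc _ = (|p ‖x‖| * ‖x‖) * (|tangentialDivergence u x| * ‖x‖) * ‖x‖ ^ (d - 3) := by ring
      _ ≤ _ := by
        have h1 := hK ‖x‖ hx0 hxM
        have h0 : 0 ≤ K := le_trans (by positivity) h1
        have h2 := hCM x hx hxM
        gcongr
  -- Testing against smooth g shows that κ, the spherical integral of the tangential divergence,
  -- vanishes almost everywhere. The claim for a merely measurable q then follows from the same
  -- polar formula.
  set κ : ℝ → ℝ := fun R => R ^ (d - 1) * ∫ ω : Metric.sphere (0 : EuclideanSpace ℝ (Fin d)) 1,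
    tangentialDivergence u (R • ω.1) ∂(volume : Measure (EuclideanSpace ℝ (Fin d))).toSphere with hκ
  have hform : ∀ p : ℝ → ℝ, Measurable p → (∀ M, ∃ K, ∀ R, 0 < R → R ≤ M → |p R| * R ≤ K) →
      ∫ x : EuclideanSpace ℝ (Fin d), p ‖x‖ * tangentialDivergence u x
        = ∫ R in Ioi (0 : ℝ), p R * κ R := by
    intro p hp hpb
    rw [integral_polar_symm volume (hint p hp hpb)]
    refine setIntegral_congr_fun measurableSet_Ioi fun R hR => ?_
    have hR : 0 < R := hR
    simp only [finrank_euclideanSpace, Fintype.card_fin, hκ]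
    have h1 : ∀ ω : Metric.sphere (0 : EuclideanSpace ℝ (Fin d)) 1, ‖R • ω.1‖ = R := fun ω => by
      have hω : ‖(ω : EuclideanSpace ℝ (Fin d))‖ = 1 := by simp
      rw [norm_smul, hω, Real.norm_eq_abs, abs_of_pos hR, mul_one]
    simp_rw [h1]
    rw [integral_const_mul]
    ring
  have hκI : IntegrableOn κ (Ioi 0) := by
    have h1 := hint (fun _ => 1) measurable_const (fun M => ⟨M, fun R hR hRM => by
      simpa using hRM⟩)
    simp only [one_mul] at h1
    simpa using integrableOn_sphere_integral volume h1
  have hκ0 : ∀ᵐ R : ℝ, R ∈ Ioi (0 : ℝ) → κ R = 0 := by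
    refine isOpen_Ioi.ae_eq_zero_of_integral_contDiff_smul_eq_zero hκI.locallyIntegrableOn
      fun g hg hgc hgs => ?_
    have hg1 : ContDiff ℝ 1 g := hg.of_le (by exact_mod_cast le_top)
    obtain ⟨Cg, hCg⟩ := hgc.exists_bound_of_continuous hg.continuous
    have h1 := integral_radial_mul_tangentialDivergence_of_smooth hd hu hc hg1 hgc hgs
    rw [hform g hg.continuous.measurable fun M => ⟨Cg * M, fun R hR hRM => by
      have h2 := hCg R
      rw [Real.norm_eq_abs] at h2
      have h0 : 0 ≤ Cg := (abs_nonneg _).trans h2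
      gcongr⟩] at h1
    rw [← h1, ← integral_indicator measurableSet_Ioi]
    congr 1
    ext R
    by_cases hR : R ∈ Ioi (0 : ℝ)
    · simp [indicator_of_mem hR]
    · rw [indicator_of_notMem hR, image_eq_zero_of_notMem_tsupport fun h => hR (hgs h), zero_smul]
  rw [hform q hq hqb]
  refine setIntegral_eq_zero_of_ae_eq_zero ?_
  filter_upwards [hκ0] with R hR hR0
  rw [hR hR0, mul_zero]

end Space

/-! ### Reduction of the weak form to rays -/

section TestFunctions

variable {d : ℕ}

/-- The weak-form integrand of a radial motion of amplitude `W` and radial and hoop stresses `P`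
and `Q` at the point under consideration. -/
noncomputable def radialIntegrand (ψ : EuclideanSpace ℝ (Fin d) × ℝ → EuclideanSpace ℝ (Fin d))
    (W P Q : ℝ) (x : EuclideanSpace ℝ (Fin d)) (t : ℝ) : ℝ :=
  W / ‖x‖ * inner ℝ x (iteratedDeriv 2 (fun τ => ψ (x, τ)) t) +
    ∑ i, ∑ j, radialTensor P Q x i j * gradMatrix (fun z => ψ (z, t)) x i j

lemma momentumIntegrand_radialMotion (hd : 2 ≤ d) {h : ℝ → ℝ} {w : ℝ → ℝ → ℝ}
    (ψ : EuclideanSpace ℝ (Fin d) × ℝ → EuclideanSpace ℝ (Fin d)) {x : EuclideanSpace ℝ (Fin d)}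
    (hx : x ≠ 0) {t A : ℝ} (hw : HasDerivAt (fun R => w R t) A ‖x‖) (hA : 0 < A)
    (hB : 0 < w ‖x‖ t) (hh : DifferentiableAt ℝ h (A * (w ‖x‖ t / ‖x‖) ^ (d - 1))) :
    momentumIntegrand h (radialMotion d w) ψ x t =
      radialIntegrand ψ (w ‖x‖ t) (radialStress d h A (w ‖x‖ t / ‖x‖))
        (hoopStress d h A (w ‖x‖ t / ‖x‖)) x t := by
  have hn : 0 < ‖x‖ := norm_pos_iff.2 hx
  rw [momentumIntegrand, radialIntegrand, gradMatrix_radialMotion hx hw,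
    piolaStress_radialTensor hd hA (by positivity) hh hx, radialMotion, inner_smul_left]
  simp

lemma radialIntegrand_eq (ψ : EuclideanSpace ℝ (Fin d) × ℝ → EuclideanSpace ℝ (Fin d))
    (W P Q : ℝ) (x : EuclideanSpace ℝ (Fin d)) (t : ℝ) :
    radialIntegrand ψ W P Q x t =
      W / ‖x‖ * inner ℝ x (iteratedDeriv 2 (fun τ => ψ (x, τ)) t) +
      Q * ∑ i, gradMatrix (fun z => ψ (z, t)) x i i +
      (P - Q) / ‖x‖ ^ 2 * inner ℝ x (fderiv ℝ (fun z => ψ (z, t)) x x) := by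
  rw [radialIntegrand, inner_fderiv_eq_sum, add_assoc]
  congr 1
  simp_rw [radialTensor_apply, add_mul, Finset.sum_add_distrib, Finset.mul_sum]
  congr 1
  · refine Finset.sum_congr rfl fun i _ => ?_
    simp
  · refine Finset.sum_congr rfl fun i _ => Finset.sum_congr rfl fun j _ => ?_
    ring

variable {ψ : EuclideanSpace ℝ (Fin d) × ℝ → EuclideanSpace ℝ (Fin d)}

/-- Expresses the derivative of a slice by directional derivatives of f itself, from which joint
continuity and compact support are inherited. -/
lemma iteratedDeriv_two_time {V : Type*} [NormedAddCommGroup V] [NormedSpace ℝ V] {X : Type*}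
    [NormedAddCommGroup X] [NormedSpace ℝ X] {f : X × ℝ → V} (hf : ContDiff ℝ 2 f) (x : X) (t : ℝ) :
    iteratedDeriv 2 (fun τ => f (x, τ)) t
      = fderiv ℝ (fun p => fderiv ℝ f p (0, 1)) (x, t) (0, 1) := by
  have h0 : ∀ t : ℝ, HasDerivAt (fun τ : ℝ => (x, τ)) ((0 : X), (1 : ℝ)) t := fun t =>
    (hasDerivAt_const t x).prodMk (hasDerivAt_id t)
  have h1 : deriv (fun τ => f (x, τ)) = fun t => fderiv ℝ f (x, t) (0, 1) := by
    ext t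
    exact ((hf.differentiable two_ne_zero (x, t)).hasFDerivAt.comp_hasDerivAt t (h0 t)).deriv
  have hf1 : ContDiff ℝ 1 fun p => fderiv ℝ f p (0, 1) :=
    (hf.fderiv_right (m := 1) (by norm_num)).clm_apply contDiff_const
  rw [iteratedDeriv_succ, iteratedDeriv_one, h1]
  exact ((hf1.differentiable one_ne_zero (x, t)).hasFDerivAt.comp_hasDerivAt t (h0 t)).deriv

lemma continuous_iteratedDeriv_two_time {V : Type*} [NormedAddCommGroup V] [NormedSpace ℝ V]
    {X : Type*} [NormedAddCommGroup X] [NormedSpace ℝ X] {f : X × ℝ → V} (hf : ContDiff ℝ 2 f) :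
    Continuous fun p : X × ℝ => iteratedDeriv 2 (fun τ => f (p.1, τ)) p.2 := by
  simp_rw [iteratedDeriv_two_time hf]
  have hf1 : ContDiff ℝ 1 fun p => fderiv ℝ f p (0, 1) :=
    (hf.fderiv_right (m := 1) (by norm_num)).clm_apply contDiff_const
  exact (hf1.continuous_fderiv one_ne_zero).clm_apply continuous_const

lemma hasCompactSupport_iteratedDeriv_two_time {V : Type*} [NormedAddCommGroup V]
    [NormedSpace ℝ V] {X : Type*} [NormedAddCommGroup X] [NormedSpace ℝ X] {f : X × ℝ → V}
    (hf : ContDiff ℝ 2 f) (hc : HasCompactSupport f) :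
    HasCompactSupport fun p : X × ℝ => iteratedDeriv 2 (fun τ => f (p.1, τ)) p.2 := by
  simp_rw [iteratedDeriv_two_time hf]
  exact ((hc.fderiv_apply (𝕜 := ℝ) (0, 1)).fderiv_apply (𝕜 := ℝ) (0, 1))

lemma fderiv_slice (hψ : ContDiff ℝ 2 ψ) (x : EuclideanSpace ℝ (Fin d)) (t : ℝ)
    (v : EuclideanSpace ℝ (Fin d)) :
    fderiv ℝ (fun z => ψ (z, t)) x v = fderiv ℝ ψ (x, t) (v, 0) := by
  have h1 : HasFDerivAt (fun z : EuclideanSpace ℝ (Fin d) => (z, t))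
      (ContinuousLinearMap.inl ℝ (EuclideanSpace ℝ (Fin d)) ℝ) x := hasFDerivAt_prodMk_left x t
  have h2 := ((hψ.differentiable two_ne_zero (x, t)).hasFDerivAt.comp x h1).fderiv
  have h3 : fderiv ℝ (fun z => ψ (z, t)) x = _ := h2
  rw [h3]
  simp

lemma gradMatrix_slice (hψ : ContDiff ℝ 2 ψ) (x : EuclideanSpace ℝ (Fin d)) (t : ℝ) (i j : Fin d) :
    gradMatrix (fun z => ψ (z, t)) x i j = fderiv ℝ ψ (x, t) (EuclideanSpace.single j 1, 0) i := by
  rw [gradMatrix, Matrix.of_apply, fderiv_slice hψ]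

lemma continuous_gradMatrix_slice (hψ : ContDiff ℝ 2 ψ) (i j : Fin d) :
    Continuous fun p : EuclideanSpace ℝ (Fin d) × ℝ =>
      gradMatrix (fun z => ψ (z, p.2)) p.1 i j := by
  simp_rw [gradMatrix_slice hψ]
  have := hψ.continuous_fderiv two_ne_zero
  fun_prop

/-- The integrand is linear in W, P, Q, and x enters the coefficients of ψ and its derivatives only
through x/|x|, so there is no singularity besides that of W, P, Q. -/
lemma exists_radialIntegrand_bound (hψ : ContDiff ℝ 2 ψ) (hc : HasCompactSupport ψ) :
    ∃ C M, 0 < C ∧ 0 < M ∧ (∀ x t W P Q, |radialIntegrand ψ W P Q x t| ≤ C * (|W| + |P| + |Q|)) ∧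
      (∀ x t, ‖ψ (x, t)‖ ≤ C) ∧
      ∀ x t, M < ‖x‖ ∨ M < |t| → (∀ W P Q, radialIntegrand ψ W P Q x t = 0) ∧ ψ (x, t) = 0 := by
  obtain ⟨M, hM, hM2⟩ := hc.isCompact.isBounded.exists_pos_norm_le
  obtain ⟨C0, hC0⟩ := hc.exists_bound_of_continuous hψ.continuous
  obtain ⟨C1, hC1⟩ := (hc.fderiv ℝ).exists_bound_of_continuous (hψ.continuous_fderiv two_ne_zero)
  have hctt := hasCompactSupport_iteratedDeriv_two_time hψ hc
  obtain ⟨C2, hC2⟩ := hctt.exists_bound_of_continuous (continuous_iteratedDeriv_two_time hψ)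
  have hC0' : 0 ≤ C0 := (norm_nonneg _).trans (hC0 0)
  have hC1' : 0 ≤ C1 := (norm_nonneg _).trans (hC1 0)
  have hC2' : 0 ≤ C2 := (norm_nonneg _).trans (hC2 0)
  have hG : ∀ x t i j, |gradMatrix (fun z => ψ (z, t)) x i j| ≤ C1 := fun x t i j => by
    rw [gradMatrix_slice hψ, ← Real.norm_eq_abs]
    refine (PiLp.norm_apply_le _ _).trans (((fderiv ℝ ψ (x, t)).le_opNorm _).trans ?_)
    have : ‖((EuclideanSpace.single j (1 : ℝ), (0 : ℝ)) : EuclideanSpace ℝ (Fin d) × ℝ)‖ = 1 := by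
      simp [Prod.norm_def]
    rw [this, mul_one]
    exact hC1 _
  have hT : ∀ (P Q : ℝ) (x : EuclideanSpace ℝ (Fin d)) (i j : Fin d),
      |radialTensor P Q x i j| ≤ 2 * (|P| + |Q|) := by
    intro P Q x i j
    rw [radialTensor_apply]
    have h1 : |Q * (if i = j then 1 else 0)| ≤ |Q| := by
      rw [abs_mul]; split_ifs <;> simp
    have h2 : |(P - Q) / ‖x‖ ^ 2 * (x i * x j)| ≤ |P| + |Q| := by
      by_cases hx : x = 0
      · simp [hx]; positivity
      · have hx0 : 0 < ‖x‖ := norm_pos_iff.2 hx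
        rw [abs_mul, abs_div, abs_of_pos (by positivity : 0 < ‖x‖ ^ 2), div_mul_eq_mul_div,
          div_le_iff₀ (by positivity), abs_mul]
        have h3 : |x i| ≤ ‖x‖ := by rw [← Real.norm_eq_abs]; exact PiLp.norm_apply_le _ _
        have h4 : |x j| ≤ ‖x‖ := by rw [← Real.norm_eq_abs]; exact PiLp.norm_apply_le _ _
        rw [sq]
        gcongr
        exact abs_sub _ _
    have := abs_add_le (Q * (if i = j then 1 else 0)) ((P - Q) / ‖x‖ ^ 2 * (x i * x j))
    linarith [abs_nonneg P]
  refine ⟨C2 + d * (d * (2 * C1)) + C0 + 1, M, by positivity, hM, fun x t W P Q => ?_,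
    fun x t => ?_, fun x t hxt => ?_⟩
  · have h1 : |W / ‖x‖ * inner ℝ x (iteratedDeriv 2 (fun τ => ψ (x, τ)) t)| ≤ C2 * |W| := by
      by_cases hx : x = 0
      · simp [hx]; positivity
      · have hx0 : 0 < ‖x‖ := norm_pos_iff.2 hx
        rw [abs_mul, abs_div, abs_of_pos hx0, div_mul_eq_mul_div, div_le_iff₀ hx0]
        calc _ ≤ |W| * (‖x‖ * C2) := by
              gcongr
              exact (abs_real_inner_le_norm _ _).trans (by gcongr; exact hC2 (x, t))
          _ = _ := by ring
    have h2 : |∑ i, ∑ j, radialTensor P Q x i j * gradMatrix (fun z => ψ (z, t)) x i j| ≤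
        d * (d * (2 * C1)) * (|P| + |Q|) := by
      calc _ ≤ ∑ i : Fin d, ∑ j : Fin d, 2 * (|P| + |Q|) * C1 := by
            refine (Finset.abs_sum_le_sum_abs _ _).trans (Finset.sum_le_sum fun i _ => ?_)
            refine (Finset.abs_sum_le_sum_abs _ _).trans (Finset.sum_le_sum fun j _ => ?_)
            rw [abs_mul]
            gcongr
            exacts [hT P Q x i j, hG x t i j]
        _ = _ := by simp; ring
    rw [radialIntegrand]
    have h3 : 0 ≤ (d : ℝ) * (d * (2 * C1)) := by positivity
    have := abs_nonneg W
    have := abs_nonneg P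
    have := abs_nonneg Q
    calc _ ≤ C2 * |W| + d * (d * (2 * C1)) * (|P| + |Q|) := (abs_add_le _ _).trans (add_le_add h1 h2)
      _ ≤ (C2 + d * (d * (2 * C1)) + C0 + 1) * |W| +
          (C2 + d * (d * (2 * C1)) + C0 + 1) * (|P| + |Q|) := by gcongr <;> linarith
      _ = _ := by ring
  · have h3 : 0 ≤ (d : ℝ) * (d * (2 * C1)) := by positivity
    exact (hC0 (x, t)).trans (by linarith)
  · have hxt2 : (x, t) ∉ tsupport ψ := fun hmem => by
      have := hM2 _ hmem
      rw [Prod.norm_def, sup_le_iff, Real.norm_eq_abs] at this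
      rcases hxt with h | h
      · exact absurd this.1 (not_le.2 h)
      · exact absurd this.2 (not_le.2 h)
    have h1 : fderiv ℝ ψ (x, t) = 0 := image_eq_zero_of_notMem_tsupport
      fun h => hxt2 (tsupport_fderiv_subset ℝ h)
    have h2 : iteratedDeriv 2 (fun τ => ψ (x, τ)) t = 0 := by
      rw [iteratedDeriv_two_time hψ]
      refine image_eq_zero_of_notMem_tsupport (f := fun p : EuclideanSpace ℝ (Fin d) × ℝ =>
        fderiv ℝ (fun p => fderiv ℝ ψ p (0, 1)) p (0, 1)) fun h => hxt2 ?_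
      exact tsupport_fderiv_apply_subset ℝ _ (tsupport_fderiv_apply_subset ℝ _ h)
    refine ⟨fun W P Q => ?_, image_eq_zero_of_notMem_tsupport hxt2⟩
    simp [radialIntegrand, gradMatrix_slice hψ, h1, h2]

lemma measurable_radialIntegrand (hψ : ContDiff ℝ 2 ψ)
    {W P Q : EuclideanSpace ℝ (Fin d) × ℝ → ℝ} (hW : Measurable W) (hP : Measurable P)
    (hQ : Measurable Q) :
    Measurable fun p => radialIntegrand ψ (W p) (P p) (Q p) p.1 p.2 := by
  simp only [radialIntegrand, radialTensor_apply]
  have h1 := (continuous_iteratedDeriv_two_time hψ)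
  have h2 := fun i j => (continuous_gradMatrix_slice hψ i j).measurable
  refine Measurable.add ?_ ?_
  · exact (hW.div (by fun_prop)).mul (continuous_fst.inner h1).measurable
  · refine Finset.measurable_sum _ fun i _ => Finset.measurable_sum _ fun j _ =>
      Measurable.mul ?_ (h2 i j)
    have h3 : ∀ k, Measurable fun p : EuclideanSpace ℝ (Fin d) × ℝ => p.1 k := fun k =>
      Continuous.measurable (by fun_prop)
    exact (hQ.mul_const _).add (((hP.sub hQ).div (by fun_prop)).mul ((h3 i).mul (h3 j)))

lemma tangentialDivergence_slice (ψ : EuclideanSpace ℝ (Fin d) × ℝ → EuclideanSpace ℝ (Fin d))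
    (x : EuclideanSpace ℝ (Fin d)) (t : ℝ) :
    tangentialDivergence (fun z => ψ (z, t)) x =
      radialIntegrand ψ 0 0 1 x t - (d - 1) / ‖x‖ ^ 2 * inner ℝ x (ψ (x, t)) := by
  rw [tangentialDivergence, radialIntegrand_eq]
  ring

/-- The radial component of a test field along the ray of direction `ω`. -/
noncomputable def rayComponent (ψ : EuclideanSpace ℝ (Fin d) × ℝ → EuclideanSpace ℝ (Fin d))
    (ω : EuclideanSpace ℝ (Fin d)) (p : ℝ × ℝ) : ℝ :=
  inner ℝ ω (ψ (p.1 • ω, p.2))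

lemma contDiff_rayComponent (hψ : ContDiff ℝ 2 ψ) (ω : EuclideanSpace ℝ (Fin d)) :
    ContDiff ℝ 2 (rayComponent ψ ω) := by
  have : ContDiff ℝ 2 fun p : ℝ × ℝ => ψ (p.1 • ω, p.2) := by fun_prop
  exact contDiff_const.inner ℝ this

lemma hasCompactSupport_rayComponent (hc : HasCompactSupport ψ) {ω : EuclideanSpace ℝ (Fin d)}
    (hω : ‖ω‖ = 1) : HasCompactSupport (rayComponent ψ ω) := by
  obtain ⟨M, hM, hM2⟩ := hc.isCompact.isBounded.exists_pos_norm_le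
  refine HasCompactSupport.of_support_subset_isCompact (isCompact_closedBall 0 M) fun p hp => ?_
  have h1 : ψ (p.1 • ω, p.2) ≠ 0 := fun h0 => hp (by simp [rayComponent, h0])
  have h2 := hM2 _ (subset_tsupport ψ h1)
  rw [Prod.norm_def, norm_smul, hω, mul_one] at h2
  rwa [mem_closedBall_zero_iff, Prod.norm_def]

/-- The point of subtracting Q times the tangential divergence: only the component of ψ along ω
survives, and the three terms are those of the radial equation tested with it. No averaging over
directions is needed. -/
lemma radialIntegrand_ray (hψ : ContDiff ℝ 2 ψ) {ω : EuclideanSpace ℝ (Fin d)} (hω : ‖ω‖ = 1)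
    {R : ℝ} (hR : 0 < R) (t W P Q : ℝ) :
    radialIntegrand ψ W P Q (R • ω) t - Q * tangentialDivergence (fun z => ψ (z, t)) (R • ω) =
      W * iteratedDeriv 2 (fun τ => rayComponent ψ ω (R, τ)) t +
      P * deriv (fun ρ => rayComponent ψ ω (ρ, t)) R +
      (d - 1) / R * Q * rayComponent ψ ω (R, t) := by
  have hn : ‖R • ω‖ = R := by rw [norm_smul, hω, Real.norm_eq_abs, abs_of_pos hR, mul_one]
  have h1 : iteratedDeriv 2 (fun τ => rayComponent ψ ω (R, τ)) t
      = inner ℝ ω (iteratedDeriv 2 (fun τ => ψ (R • ω, τ)) t) := by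
    have hct : ContDiff ℝ 2 fun τ => ψ (R • ω, τ) := by fun_prop
    have e1 : deriv (fun τ => rayComponent ψ ω (R, τ))
        = fun τ => inner ℝ ω (deriv (fun τ => ψ (R • ω, τ)) τ) := by
      ext τ
      have := (hasDerivAt_const τ ω).inner ℝ ((hct.differentiable two_ne_zero τ).hasDerivAt)
      rw [inner_zero_left, add_zero] at this
      exact this.deriv
    rw [iteratedDeriv_succ, iteratedDeriv_one, e1, iteratedDeriv_succ, iteratedDeriv_one]
    have hct1 : ContDiff ℝ 1 (deriv fun τ => ψ (R • ω, τ)) := by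
      have := hct.iterate_deriv' 1 1
      simpa using this
    have := (hasDerivAt_const t ω).inner ℝ ((hct1.differentiable one_ne_zero t).hasDerivAt)
    rw [inner_zero_left, add_zero] at this
    exact this.deriv
  have h2 : deriv (fun ρ => rayComponent ψ ω (ρ, t)) R
      = inner ℝ ω (fderiv ℝ (fun z => ψ (z, t)) (R • ω) ω) := by
    have hcs : ContDiff ℝ 2 fun z => ψ (z, t) := by fun_prop
    have h5 : HasDerivAt (fun R : ℝ => R • ω) ω R := by
      simpa using (hasDerivAt_id R).smul_const ω
    have h6 := ((hcs.differentiable two_ne_zero _).hasFDerivAt).comp_hasDerivAt R h5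
    have := (hasDerivAt_const R ω).inner ℝ h6
    rw [inner_zero_left, add_zero] at this
    exact this.deriv
  rw [radialIntegrand_eq, tangentialDivergence, hn, h1, h2, rayComponent]
  simp only [map_smul, inner_smul_left, inner_smul_right, RCLike.conj_to_real]
  field_simp
  ring

lemma integral_polar_prod (hd : 1 ≤ d) {G : EuclideanSpace ℝ (Fin d) × ℝ → ℝ}
    (hG : Integrable G) :
    ∫ p, G p = ∫ ω : Metric.sphere (0 : EuclideanSpace ℝ (Fin d)) 1,
      (∫ R in Ioi (0 : ℝ), R ^ (d - 1) * ∫ t, G (R • ω.1, t))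
        ∂(volume : Measure (EuclideanSpace ℝ (Fin d))).toSphere := by
  have hnt : Nontrivial (EuclideanSpace ℝ (Fin d)) := nontrivial_euclideanSpace hd
  rw [Measure.volume_eq_prod] at hG ⊢
  rw [integral_prod _ hG, integral_polar volume hG.integral_prod_left]
  simp

/-- Reduction of the weak form of a radial motion to a problem in the radius and time. -/
lemma integral_radialIntegrand_eq_zero (hd : 3 ≤ d) (hψ : ContDiff ℝ 2 ψ)
    (hc : HasCompactSupport ψ) {W P Q : ℝ → ℝ → ℝ} (hW : Measurable (Function.uncurry W))
    (hP : Measurable (Function.uncurry P)) (hQ : Measurable (Function.uncurry Q))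
    (hb : ∀ M, ∃ K, ∀ R t, 0 < R → R ≤ M → |t| ≤ M →
      |W R t| ≤ K ∧ |P R t| * R ^ (d - 1) ≤ K ∧ |Q R t| * R ≤ K)
    (hray : ∀ F : ℝ × ℝ → ℝ, ContDiff ℝ 2 F → HasCompactSupport F →
      ∫ R in Ioi (0 : ℝ), R ^ (d - 1) * ∫ t, (W R t * iteratedDeriv 2 (fun τ => F (R, τ)) t +
        P R t * deriv (fun ρ => F (ρ, t)) R + (d - 1) / R * Q R t * F (R, t)) = 0) :
    Integrable (fun p : EuclideanSpace ℝ (Fin d) × ℝ =>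
      radialIntegrand ψ (W ‖p.1‖ p.2) (P ‖p.1‖ p.2) (Q ‖p.1‖ p.2) p.1 p.2) ∧
    ∫ p : EuclideanSpace ℝ (Fin d) × ℝ,
      radialIntegrand ψ (W ‖p.1‖ p.2) (P ‖p.1‖ p.2) (Q ‖p.1‖ p.2) p.1 p.2 = 0 := by
  have hnt : Nontrivial (EuclideanSpace ℝ (Fin d)) := nontrivial_euclideanSpace (by omega)
  obtain ⟨C, M, hC, hM, hCb, hψC, hM0⟩ := exists_radialIntegrand_bound hψ hc
  obtain ⟨K, hK⟩ := hb M
  have hd1 : (0 : ℝ) ≤ d - 1 := by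
    have : (3 : ℝ) ≤ d := by exact_mod_cast hd
    linarith
  have hmn : Measurable fun p : EuclideanSpace ℝ (Fin d) × ℝ => (‖p.1‖, p.2) := by fun_prop
  have hWm := hW.comp hmn
  have hPm := hP.comp hmn
  have hQm := hQ.comp hmn
  have hJ : Integrable (fun p : EuclideanSpace ℝ (Fin d) × ℝ =>
      radialIntegrand ψ (W ‖p.1‖ p.2) (P ‖p.1‖ p.2) (Q ‖p.1‖ p.2) p.1 p.2) := by
    refine integrable_prod_of_mul_norm_pow_le (by omega) (M := M)
      (C := C * (K * M ^ (d - 1) + K + K * M ^ (d - 2)))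
      (measurable_radialIntegrand hψ hWm hPm hQm).aestronglyMeasurable (fun x t hx hxM htM => ?_)
      (fun x t hxt => (hM0 x t hxt).1 _ _ _)
    have hx0 : 0 < ‖x‖ := norm_pos_iff.2 hx
    obtain ⟨h1, h2, h3⟩ := hK ‖x‖ t hx0 hxM htM
    have hK0 : 0 ≤ K := (abs_nonneg _).trans h1
    calc _ ≤ C * (|W ‖x‖ t| + |P ‖x‖ t| + |Q ‖x‖ t|) * ‖x‖ ^ (d - 1) := by
          gcongr; exact hCb _ _ _ _ _
      _ = C * (|W ‖x‖ t| * ‖x‖ ^ (d - 1) + |P ‖x‖ t| * ‖x‖ ^ (d - 1)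
          + (|Q ‖x‖ t| * ‖x‖) * ‖x‖ ^ (d - 2)) := by
          rw [show d - 1 = (d - 2) + 1 by omega, pow_succ]; ring
      _ ≤ _ := by gcongr
  have hT : Integrable (fun p : EuclideanSpace ℝ (Fin d) × ℝ =>
      Q ‖p.1‖ p.2 * tangentialDivergence (fun z => ψ (z, p.2)) p.1) := by
    simp_rw [tangentialDivergence_slice]
    have hm : Measurable fun p : EuclideanSpace ℝ (Fin d) × ℝ => radialIntegrand ψ 0 0 1 p.1 p.2 :=
      measurable_radialIntegrand hψ measurable_const measurable_const measurable_const
    refine integrable_prod_of_mul_norm_pow_le (by omega) (M := M)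
      (C := K * (C * M + (d - 1) * C) * M ^ (d - 3))
      (hQm.mul (hm.sub (Measurable.mul (by fun_prop)
        (continuous_fst.inner hψ.continuous).measurable))).aestronglyMeasurable
      (fun x t hx hxM htM => ?_) (fun x t hxt => ?_)
    · have hx0 : 0 < ‖x‖ := norm_pos_iff.2 hx
      obtain ⟨h1, h2, h3⟩ := hK ‖x‖ t hx0 hxM htM
      have hK0 : 0 ≤ K := (abs_nonneg _).trans h1
      have h4 : |radialIntegrand ψ 0 0 1 x t - (d - 1) / ‖x‖ ^ 2 * inner ℝ x (ψ (x, t))| * ‖x‖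
          ≤ C * M + (d - 1) * C := by
        have h5 : |radialIntegrand ψ 0 0 1 x t| ≤ C := by simpa using hCb x t 0 0 1
        have h6 : |(d - 1) / ‖x‖ ^ 2 * inner ℝ x (ψ (x, t))| * ‖x‖ ≤ (d - 1) * C := by
          rw [abs_mul, abs_of_nonneg (by positivity : 0 ≤ ((d : ℝ) - 1) / ‖x‖ ^ 2)]
          calc _ ≤ (d - 1) / ‖x‖ ^ 2 * (‖x‖ * C) * ‖x‖ := by
                gcongr; exact (abs_real_inner_le_norm _ _).trans (by gcongr; exact hψC x t)
            _ = _ := by field_simp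
        calc _ ≤ (|radialIntegrand ψ 0 0 1 x t| + |(d - 1) / ‖x‖ ^ 2 * inner ℝ x (ψ (x, t))|) * ‖x‖ := by
              gcongr; exact abs_sub _ _
          _ ≤ _ := by rw [add_mul]; gcongr
      rw [abs_mul, show d - 1 = (d - 3) + 2 by omega, pow_add]
      calc _ = (|Q ‖x‖ t| * ‖x‖) * (|radialIntegrand ψ 0 0 1 x t
            - (d - 1) / ‖x‖ ^ 2 * inner ℝ x (ψ (x, t))| * ‖x‖) * ‖x‖ ^ (d - 3) := by ring
        _ ≤ _ := by gcongr
    · rw [(hM0 x t hxt).1, (hM0 x t hxt).2]; simp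
  refine ⟨hJ, ?_⟩
  have hT0 : ∫ p : EuclideanSpace ℝ (Fin d) × ℝ,
      Q ‖p.1‖ p.2 * tangentialDivergence (fun z => ψ (z, p.2)) p.1 = 0 := by
    -- At each fixed time Q is a radial function, so the subtracted term integrates to zero.
    have hslice : ∀ t : ℝ, ∫ x : EuclideanSpace ℝ (Fin d),
        Q ‖x‖ t * tangentialDivergence (fun z => ψ (z, t)) x = 0 := by
      intro t
      have hcs : HasCompactSupport fun z => ψ (z, t) := by
        refine HasCompactSupport.of_support_subset_isCompact (isCompact_closedBall 0 M) fun x hx => ?_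
        rw [mem_closedBall_zero_iff]
        by_contra! hcon
        exact hx (hM0 x t (Or.inl hcon)).2
      have hct : ContDiff ℝ 1 fun z => ψ (z, t) :=
        (hψ.of_le (by norm_num)).comp (contDiff_id.prodMk contDiff_const)
      have hqm : Measurable fun R => Q R t :=
        hQ.comp (measurable_id.prodMk measurable_const)
      refine integral_radial_mul_tangentialDivergence hd hct hcs hqm fun N => ?_
      obtain ⟨K', hK'⟩ := hb (max N |t|)
      exact ⟨K', fun R hR hRN => (hK' R t hR (hRN.trans (le_max_left _ _)) (le_max_right _ _)).2.2⟩
    rw [Measure.volume_eq_prod] at hT ⊢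
    rw [integral_prod_symm _ hT]
    simp only [hslice, integral_zero]
  have hsub := integral_sub hJ hT
  rw [hT0, sub_zero] at hsub
  rw [← hsub]
  -- The remainder vanishes on every ray separately by `hray`.
  refine (integral_polar_prod (by omega) (hJ.sub hT)).trans ?_
  refine integral_eq_zero_of_ae (Eventually.of_forall fun ω => ?_)
  have hω : ‖(ω : EuclideanSpace ℝ (Fin d))‖ = 1 := by simp
  refine Eq.trans ?_ (hray (rayComponent ψ ω) (contDiff_rayComponent hψ ω)
    (hasCompactSupport_rayComponent hc hω))
  refine setIntegral_congr_fun measurableSet_Ioi fun R hR => ?_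
  have hR : 0 < R := hR
  have hn : ‖R • ω.1‖ = R := by rw [norm_smul, hω, Real.norm_eq_abs, abs_of_pos hR, mul_one]
  refine congrArg _ ?_
  refine integral_congr_ae (Eventually.of_forall fun t => ?_)
  simp only [Pi.sub_apply, hn]
  exact radialIntegrand_ray hψ hω hR t _ _ _

end TestFunctions

/-! ### Bounds for the self-similar motion in space-time -/

section Fields

variable {d : ℕ} {h : ℝ → ℝ} {lam σ : ℝ} {r : ℝ → ℝ}

/-- A jointly measurable function that agrees with the self-similar amplitude for `R ≥ 0`. -/
noncomputable def cavityAmplitude (lam : ℝ) (r : ℝ → ℝ) (R t : ℝ) : ℝ :=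
  if t ≤ 0 then lam * R else t * r (max (R / t) 0)

/-- The radial strain of the self-similar motion, with the value `lam` at the shock. -/
noncomputable def cavityStrain (lam σ : ℝ) (r : ℝ → ℝ) (R t : ℝ) : ℝ :=
  if t ≤ 0 then lam else if R / t = σ then lam else deriv r (R / t)

lemma cavityAmplitude_eq (lam : ℝ) (r : ℝ → ℝ) {R : ℝ} (hR : 0 ≤ R) (t : ℝ) :
    cavityAmplitude lam r R t = selfSimilarAmplitude lam r R t := by
  rw [cavityAmplitude, selfSimilarAmplitude]
  split_ifs with ht
  · rfl
  · rw [max_eq_left (div_nonneg hR (not_le.1 ht).le)]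

lemma measurable_cavityStrain (lam σ : ℝ) (r : ℝ → ℝ) :
    Measurable (Function.uncurry (cavityStrain lam σ r)) := by
  have hq : Measurable fun p : ℝ × ℝ => p.1 / p.2 := by fun_prop
  refine Measurable.ite (measurableSet_le measurable_snd measurable_const) measurable_const ?_
  exact Measurable.ite (measurableSet_eq_fun hq measurable_const) measurable_const
    ((measurable_deriv r).comp hq)

namespace IsCavitatingProfile

lemma measurable_cavityAmplitude (hr : IsCavitatingProfile d h lam σ r) :
    Measurable (Function.uncurry (cavityAmplitude lam r)) := by
  have hc : Continuous fun s => r (max s 0) :=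
    hr.continuousOn.comp_continuous (by fun_prop) fun s => mem_Ici.2 (le_max_right _ _)
  have hq : Measurable fun p : ℝ × ℝ => p.1 / p.2 := by fun_prop
  refine Measurable.ite (measurableSet_le measurable_snd measurable_const) (by fun_prop) ?_
  exact measurable_snd.mul (hc.measurable.comp hq)

/-- The profile bounds rescaled to s = R/t. Writing max t 0 for the time covers the homogeneous
state t ≤ 0 as well. -/
lemma exists_field_bounds (hr : IsCavitatingProfile d h lam σ r) (hh : IsVolumetricEnergy h)
    (hlam : 0 < lam) : ∃ c C, 0 < c ∧ 0 < C ∧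
      (∀ R t, 0 ≤ R → c * (max t 0 + R) ≤ cavityAmplitude lam r R t ∧
        cavityAmplitude lam r R t ≤ C * (max t 0 + R)) ∧
      ∀ R t, 0 < R → c * (R / (max t 0 + R)) ^ (d - 1) ≤ cavityStrain lam σ r R t ∧
        cavityStrain lam σ r R t ≤ C * (R / (max t 0 + R)) ^ (d - 1) ∧
        c ≤ cavityStrain lam σ r R t * (cavityAmplitude lam r R t / R) ^ (d - 1) := by
  obtain ⟨c1, C1, hc1, hC1, h1⟩ := hr.exists_linear_bounds hlam
  obtain ⟨c2, C2, hc2, hC2, h2⟩ := hr.exists_deriv_bounds hh hlam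
  obtain ⟨c3, C3, hc3, hC3, h3⟩ := hr.exists_jacobian_bounds hh hlam
  have hσ := hr.speed_pos
  -- The value of (s/(1+s))^{d-1} at the shock, where the strain was set to lam; C is taken at least
  -- lam/q so that the upper bound holds there too.
  set q := (σ / (1 + σ)) ^ (d - 1) with hq
  have hq0 : 0 < q := by positivity
  have hq1 : q ≤ 1 := pow_le_one₀ (by positivity) ((div_le_one (by positivity)).2 (by linarith))
  set c := min (min c1 lam) (min c2 (min c3 (lam * lam ^ (d - 1)))) with hc
  set C := max (max C1 (lam / q)) C2 with hC
  have hcl : c ≤ lam := (min_le_left _ _).trans (min_le_right _ _)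
  have hcc1 : c ≤ c1 := (min_le_left _ _).trans (min_le_left _ _)
  have hcc2 : c ≤ c2 := (min_le_right _ _).trans (min_le_left _ _)
  have hcc3 : c ≤ c3 := (min_le_right _ _).trans ((min_le_right _ _).trans (min_le_left _ _))
  have hcc4 : c ≤ lam * lam ^ (d - 1) :=
    (min_le_right _ _).trans ((min_le_right _ _).trans (min_le_right _ _))
  have hCq : lam ≤ C * q := by
    rw [← div_le_iff₀ hq0]; exact (le_max_right _ _).trans (le_max_left _ _)
  have hC0 : 0 < C := by positivity
  have hCl : lam ≤ C := hCq.trans (by nlinarith)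
  have hCC1 : C1 ≤ C := (le_max_left _ _).trans (le_max_left _ _)
  have hCC2 : C2 ≤ C := le_max_right _ _
  have hc0 : 0 < c := by positivity
  refine ⟨c, C, hc0, hC0, fun R t hR => ?_, fun R t hR => ?_⟩
  · rcases le_or_gt t 0 with ht | ht
    · rw [cavityAmplitude, if_pos ht, max_eq_right ht, zero_add]
      constructor <;> gcongr
    · rw [cavityAmplitude, if_neg (not_le.2 ht), max_eq_left ht.le, max_eq_left (by positivity)]
      obtain ⟨h4, h5⟩ := h1 (R / t) (by positivity)
      have h6 : t + R = t * (1 + R / t) := by field_simp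
      rw [h6]
      constructor
      · calc _ = t * (c * (1 + R / t)) := by ring
          _ ≤ t * (c1 * (1 + R / t)) := by gcongr
          _ ≤ _ := by gcongr
      · calc _ ≤ t * (C1 * (1 + R / t)) := by gcongr
          _ ≤ t * (C * (1 + R / t)) := by gcongr
          _ = _ := by ring
  · rcases le_or_gt t 0 with ht | ht
    · rw [cavityAmplitude, if_pos ht, cavityStrain, if_pos ht, max_eq_right ht, zero_add,
        div_self hR.ne', one_pow, mul_one, mul_one, mul_div_cancel_right₀ _ hR.ne']
      exact ⟨hcl, hCl, hcc4⟩
    · rw [cavityAmplitude, if_neg (not_le.2 ht), cavityStrain, if_neg (not_le.2 ht),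
        max_eq_left ht.le, max_eq_left (by positivity)]
      have h6 : R / (t + R) = R / t / (1 + R / t) := by field_simp
      have h7 : t * r (R / t) / R = r (R / t) / (R / t) := by field_simp
      rw [h6, h7]
      have hs : 0 < R / t := by positivity
      generalize R / t = s at *
      split_ifs with hsσ
      · rw [hsσ, ← hq, hr.eq_ahead σ le_rfl, mul_div_cancel_right₀ _ hσ.ne']
        refine ⟨le_trans ?_ hcl, hCq, hcc4⟩
        nlinarith
      · obtain ⟨h8, h9⟩ := h2 s hs hsσ
        refine ⟨le_trans (by gcongr) h8, h9.trans (by gcongr), hcc3.trans (h3 s hs hsσ).1⟩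

lemma cavityStrain_pos (hr : IsCavitatingProfile d h lam σ r) (hlam : 0 < lam) {R : ℝ}
    (hR : 0 < R) (t : ℝ) : 0 < cavityStrain lam σ r R t := by
  rw [cavityStrain]
  split_ifs with h1 h2
  · exact hlam
  · exact hlam
  · exact hr.deriv_pos' hlam (div_pos hR (not_le.1 h1)) h2

/-- The hoop stress is less singular than the radial one: its factor w_R(w/R)^{d-2} is the bounded
Jacobian divided by w/R, which is bounded below. So Φ₂ is no worse than w/R. -/
lemma exists_stress_field_bounds (hr : IsCavitatingProfile d h lam σ r) (hh : IsVolumetricEnergy h)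
    (hlam : 0 < lam) (hd : 3 ≤ d) (M : ℝ) : ∃ K, ∀ R t, 0 < R → R ≤ M → |t| ≤ M →
      |cavityAmplitude lam r R t| ≤ K ∧
      |radialStress d h (cavityStrain lam σ r R t) (cavityAmplitude lam r R t / R)| * R ^ (d - 1) ≤ K ∧
      |hoopStress d h (cavityStrain lam σ r R t) (cavityAmplitude lam r R t / R)| * R ≤ K := by
  obtain ⟨c, C, hc, hC, h1, h2⟩ := hr.exists_field_bounds hh hlam
  obtain ⟨K0, hK0, hK⟩ := exists_stress_bound hh (d := d) (by omega) (C := C) hc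
  set D := |deriv h c| + |deriv h (C * C ^ (d - 1))| with hD
  have hD0 : 0 ≤ D := by positivity
  refine ⟨max (C * (M + M)) (max (K0 * (M + M) ^ (d - 1))
    (C * (M + M) + C * C ^ (d - 1) * D * (M / c))), fun R t hR hRM htM => ?_⟩
  obtain ⟨h3, h4⟩ := h1 R t hR.le
  obtain ⟨h5, h6, h7⟩ := h2 R t hR
  have ha := hr.cavityStrain_pos hlam hR t
  have hM : 0 < M := hR.trans_le hRM
  have ht : max t 0 ≤ M := max_le ((le_abs_self t).trans htM) hM.le
  have ht0 : 0 ≤ max t 0 := le_max_right _ _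
  generalize max t 0 = T at *
  have hTR : 0 < T + R := by linarith
  generalize cavityStrain lam σ r R t = a at *
  have hw : 0 < cavityAmplitude lam r R t := lt_of_lt_of_le (by positivity) h3
  generalize cavityAmplitude lam r R t = w at *
  have hk : 0 < R / (T + R) := by positivity
  have hk1 : R / (T + R) ≤ 1 := (div_le_one hTR).2 (by linarith)
  have hBk : w / R * (R / (T + R)) ≤ C := by
    rw [div_mul_div_cancel₀ hR.ne', div_le_iff₀ hTR]; exact h4
  have hv2 : a * (w / R) ^ (d - 1) ≤ C * C ^ (d - 1) := by
    calc a * (w / R) ^ (d - 1) ≤ C * (R / (T + R)) ^ (d - 1) * (w / R) ^ (d - 1) := by gcongr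
      _ = C * (w / R * (R / (T + R))) ^ (d - 1) := by ring
      _ ≤ _ := by gcongr
  have hwM : w ≤ C * (M + M) := h4.trans (by gcongr)
  refine ⟨?_, ?_, ?_⟩
  · rw [abs_of_pos hw]
    exact hwM.trans (le_max_left _ _)
  · refine le_trans ?_ ((le_max_left _ _).trans (le_max_right _ _))
    have h8 := (hK _ a (w / R) hk hk1 ha.le h6 (by positivity) hBk h7).1
    calc _ = |radialStress d h a (w / R)| * (R / (T + R)) ^ (d - 1) * (T + R) ^ (d - 1) := by
          rw [mul_assoc, ← mul_pow, div_mul_cancel₀ _ hTR.ne']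
      _ ≤ K0 * (M + M) ^ (d - 1) := by gcongr
  · refine le_trans ?_ ((le_max_right _ _).trans (le_max_right _ _))
    have hder := hh.abs_deriv_le hc h7 hv2
    rw [← hD] at hder
    obtain ⟨n, rfl⟩ : ∃ n, d = n + 3 := ⟨d - 3, by omega⟩
    simp only [show n + 3 - 1 = n + 2 by omega, show n + 3 - 2 = n + 1 by omega, hoopStress] at *
    have hB : c ≤ w / R := by
      rw [le_div_iff₀ hR]; exact le_trans (by gcongr; linarith) h3
    have hB0 : 0 < w / R := by positivity
    have h9 : a * (w / R) ^ (n + 1) ≤ C * C ^ (n + 2) / c := by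
      rw [le_div_iff₀ hc]
      calc a * (w / R) ^ (n + 1) * c ≤ a * (w / R) ^ (n + 1) * (w / R) := by gcongr
        _ = a * (w / R) ^ (n + 2) := by ring
        _ ≤ _ := hv2
    calc _ ≤ (|w / R| + |a * (w / R) ^ (n + 1) * deriv h (a * (w / R) ^ (n + 2))|) * R := by
          gcongr; exact abs_add_le _ _
      _ = w + a * (w / R) ^ (n + 1) * |deriv h (a * (w / R) ^ (n + 2))| * R := by
          rw [abs_mul, abs_of_pos hB0, abs_of_pos (by positivity : 0 < a * (w / R) ^ (n + 1)),
            add_mul, div_mul_cancel₀ _ hR.ne']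
      _ ≤ C * (M + M) + C * C ^ (n + 2) / c * D * M := by gcongr
      _ = _ := by ring

end IsCavitatingProfile

lemma measurable_radialStress {X : Type*} [MeasurableSpace X] {f g : X → ℝ} (hf : Measurable f)
    (hg : Measurable g) : Measurable fun x => radialStress d h (f x) (g x) := by
  have := (measurable_deriv h).comp (hf.mul (hg.pow_const (d - 1)))
  exact hf.add ((hg.pow_const _).mul this)

lemma measurable_hoopStress {X : Type*} [MeasurableSpace X] {f g : X → ℝ} (hf : Measurable f)
    (hg : Measurable g) : Measurable fun x => hoopStress d h (f x) (g x) := by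
  have := (measurable_deriv h).comp (hf.mul (hg.pow_const (d - 1)))
  exact hg.add ((hf.mul (hg.pow_const _)).mul this)

/-- In the homogeneous state the stress is hydrostatic, which makes the weak form ahead of the shock
an exact R-derivative. -/
lemma hoopStress_self (hd : 2 ≤ d) (lam : ℝ) : hoopStress d h lam lam = radialStress d h lam lam := by
  obtain ⟨n, rfl⟩ : ∃ n, d = n + 2 := ⟨d - 2, by omega⟩
  simp only [hoopStress, radialStress, Nat.add_sub_cancel, show n + 2 - 1 = n + 1 by omega]
  ring

end Fields

/-- At the shock only the one-sided limits are meaningful, so the value of f at a is replaced by its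
limit. -/
lemma integral_Ioi_of_hasDerivAt_of_tendsto_nhdsGT {f f' : ℝ → ℝ} {a fa m : ℝ}
    (hderiv : ∀ x ∈ Ioi a, HasDerivAt f (f' x) x) (hint : IntegrableOn f' (Ioi a))
    (ha : Tendsto f (𝓝[>] a) (𝓝 fa)) (hm : Tendsto f atTop (𝓝 m)) :
    ∫ x in Ioi a, f' x = m - fa := by
  have h1 : ∀ x, a < x → Function.update f a fa =ᶠ[𝓝 x] f := fun x hx => by
    filter_upwards [Ioi_mem_nhds hx] with y hy
    exact Function.update_of_ne (ne_of_gt hy) _ _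
  have h2 := integral_Ioi_of_hasDerivAt_of_tendsto (f := Function.update f a fa) (a := a) (m := m)
    ?_ (fun x hx => (hderiv x hx).congr_of_eventuallyEq (h1 x hx)) hint ?_
  · rwa [Function.update_self] at h2
  · rw [← continuousWithinAt_Ioi_iff_Ici, ContinuousWithinAt, Function.update_self]
    refine ha.congr' ?_
    filter_upwards [self_mem_nhdsWithin] with y hy
    exact (Function.update_of_ne (ne_of_gt hy) _ _).symm
  · refine hm.congr' ?_
    filter_upwards [eventually_gt_atTop a] with y hy
    exact (Function.update_of_ne (ne_of_gt hy) _ _).symm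

/-! ### Slices of test functions in radius and time -/

section Slices

variable {F : ℝ × ℝ → ℝ}

lemma hasDerivAt_time_slice (hF : ContDiff ℝ 2 F) (R t : ℝ) :
    HasDerivAt (fun τ => F (R, τ)) (deriv (fun τ => F (R, τ)) t) t ∧
    HasDerivAt (deriv fun τ => F (R, τ)) (iteratedDeriv 2 (fun τ => F (R, τ)) t) t := by
  have hs : ContDiff ℝ 2 fun τ => F (R, τ) := by fun_prop
  have h1 : ContDiff ℝ 1 (deriv fun τ => F (R, τ)) := by simpa using hs.iterate_deriv' 1 1
  rw [iteratedDeriv_two_eq]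
  exact ⟨(hs.differentiable two_ne_zero t).hasDerivAt, (h1.differentiable one_ne_zero t).hasDerivAt⟩

lemma deriv_radius_slice (hF : ContDiff ℝ 2 F) (R t : ℝ) :
    HasDerivAt (fun ρ => F (ρ, t)) (deriv (fun ρ => F (ρ, t)) R) R ∧
      deriv (fun ρ => F (ρ, t)) R = fderiv ℝ F (R, t) (1, 0) := by
  have hs : ContDiff ℝ 2 fun ρ => F (ρ, t) := by fun_prop
  have h0 : HasDerivAt (fun ρ : ℝ => (ρ, t)) ((1 : ℝ), (0 : ℝ)) R :=
    (hasDerivAt_id R).prodMk (hasDerivAt_const R t)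
  exact ⟨(hs.differentiable two_ne_zero R).hasDerivAt,
    ((hF.differentiable two_ne_zero (R, t)).hasFDerivAt.comp_hasDerivAt R h0).deriv⟩

lemma continuous_deriv_radius (hF : ContDiff ℝ 2 F) :
    Continuous fun p : ℝ × ℝ => deriv (fun ρ => F (ρ, p.2)) p.1 := by
  simp_rw [(deriv_radius_slice hF _ _).2]
  exact (hF.continuous_fderiv two_ne_zero).clm_apply continuous_const

/-- A common bound, and a common box containing the supports, of a test function and those of its
derivatives that occur in the weak form. -/
lemma exists_slice_bounds (hF : ContDiff ℝ 2 F) (hc : HasCompactSupport F) :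
    ∃ C M, 0 < C ∧ 0 < M ∧
      (∀ R t, |F (R, t)| ≤ C ∧ |iteratedDeriv 2 (fun τ => F (R, τ)) t| ≤ C ∧
        |deriv (fun ρ => F (ρ, t)) R| ≤ C) ∧
      ∀ R t, M < |R| ∨ M < |t| → F (R, t) = 0 ∧ iteratedDeriv 2 (fun τ => F (R, τ)) t = 0 ∧
        deriv (fun ρ => F (ρ, t)) R = 0 ∧ deriv (fun τ => F (R, τ)) t = 0 := by
  obtain ⟨M, hM, hM2⟩ := hc.isCompact.isBounded.exists_pos_norm_le
  obtain ⟨C0, hC0⟩ := hc.exists_bound_of_continuous hF.continuous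
  have hc1 : HasCompactSupport fun p : ℝ × ℝ => fderiv ℝ F p (1, 0) := hc.fderiv_apply (𝕜 := ℝ) (1, 0)
  obtain ⟨C1, hC1⟩ := hc1.exists_bound_of_continuous
    ((hF.continuous_fderiv two_ne_zero).clm_apply continuous_const)
  obtain ⟨C2, hC2⟩ := (hasCompactSupport_iteratedDeriv_two_time hF hc).exists_bound_of_continuous
    (continuous_iteratedDeriv_two_time hF)
  refine ⟨max 1 (max C0 (max C1 C2)), M, by positivity, hM, fun R t => ⟨?_, ?_, ?_⟩,
    fun R t hRt => ?_⟩
  · exact (hC0 (R, t)).trans (by simp)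
  · exact (hC2 (R, t)).trans (by simp)
  · rw [(deriv_radius_slice hF R t).2]
    exact (hC1 (R, t)).trans (by simp)
  · have hloc : ∀ᶠ p in 𝓝 (R, t), F p = 0 := by
      have hmem : (R, t) ∉ tsupport F := fun hmem => by
        have := hM2 _ hmem
        rw [Prod.norm_def, sup_le_iff, Real.norm_eq_abs, Real.norm_eq_abs] at this
        rcases hRt with h | h
        · exact absurd this.1 (not_le.2 h)
        · exact absurd this.2 (not_le.2 h)
      exact notMem_tsupport_iff_eventuallyEq.1 hmem
    have ht : (fun τ => F (R, τ)) =ᶠ[𝓝 t] fun _ => 0 :=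
      (Continuous.tendsto (by fun_prop : Continuous fun τ : ℝ => (R, τ)) t).eventually hloc
    have hR : (fun ρ => F (ρ, t)) =ᶠ[𝓝 R] fun _ => 0 :=
      (Continuous.tendsto (by fun_prop : Continuous fun ρ : ℝ => (ρ, t)) R).eventually hloc
    refine ⟨hloc.self_of_nhds, ?_, ?_, ?_⟩
    · rw [ht.iteratedDeriv_eq]; simp
    · rw [hR.deriv_eq]; simp
    · rw [ht.deriv_eq]; simp

end Slices

lemma integrable_of_bounded_support {X : Type*} [MeasurableSpace X] {μ : Measure X} {f : X → ℝ}
    {S : Set X} {C : ℝ} (hμ : μ S ≠ ⊤) (hf : AEStronglyMeasurable f μ)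
    (hC : ∀ᵐ x ∂μ, |f x| ≤ C) (h0 : ∀ x, x ∉ S → f x = 0) : Integrable f μ := by
  have h1 : IntegrableOn f S μ :=
    (integrableOn_const (C := C) hμ).mono' hf.restrict (ae_restrict_of_ae hC)
  rw [← integrableOn_univ]
  exact h1.of_forall_sdiff_eq_zero MeasurableSet.univ fun x hx => h0 x hx.2

/-! ### Integration by parts in time and in radius -/

section RayIdentity

variable {d : ℕ} {h : ℝ → ℝ} {lam σ : ℝ} {r : ℝ → ℝ} {F : ℝ × ℝ → ℝ}

/-- `R^{d-1} w_tt F` behind the shock, for the self-similar amplitude `w`. -/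
noncomputable def inertiaTerm (d : ℕ) (σ : ℝ) (r : ℝ → ℝ) (F : ℝ × ℝ → ℝ) (p : ℝ × ℝ) : ℝ :=
  if p.1 < σ * p.2 then
    p.1 ^ (d - 2) * ((p.1 / p.2) ^ 3 * iteratedDeriv 2 r (p.1 / p.2)) * F p else 0

/-- The radial stress of the self-similar motion. -/
noncomputable def cavityRadialStress (d : ℕ) (h : ℝ → ℝ) (lam σ : ℝ) (r : ℝ → ℝ) (R t : ℝ) : ℝ :=
  radialStress d h (cavityStrain lam σ r R t) (cavityAmplitude lam r R t / R)

/-- The hoop stress of the self-similar motion. -/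
noncomputable def cavityHoopStress (d : ℕ) (h : ℝ → ℝ) (lam σ : ℝ) (r : ℝ → ℝ) (R t : ℝ) : ℝ :=
  hoopStress d h (cavityStrain lam σ r R t) (cavityAmplitude lam r R t / R)

lemma measurable_inertiaTerm (hF : Continuous F) : Measurable (inertiaTerm d σ r F) := by
  have hq : Measurable fun p : ℝ × ℝ => p.1 / p.2 := by fun_prop
  have hi : Measurable (iteratedDeriv 2 r) := by
    rw [iteratedDeriv_two_eq]; exact measurable_deriv _
  refine Measurable.ite (measurableSet_lt measurable_fst (by fun_prop)) ?_ measurable_const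
  exact ((measurable_fst.pow_const _).mul ((hq.pow_const 3).mul (hi.comp hq))).mul hF.measurable

namespace IsCavitatingProfile

lemma measurable_cavityRadialStress (hr : IsCavitatingProfile d h lam σ r) :
    Measurable (Function.uncurry (cavityRadialStress d h lam σ r)) :=
  measurable_radialStress (measurable_cavityStrain lam σ r)
    (hr.measurable_cavityAmplitude.div measurable_fst)

lemma measurable_cavityHoopStress (hr : IsCavitatingProfile d h lam σ r) :
    Measurable (Function.uncurry (cavityHoopStress d h lam σ r)) :=
  measurable_hoopStress (measurable_cavityStrain lam σ r)
    (hr.measurable_cavityAmplitude.div measurable_fst)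

lemma exists_inertiaTerm_bound (hr : IsCavitatingProfile d h lam σ r) (hh : IsVolumetricEnergy h)
    (hlam : 0 < lam) (hd : 2 ≤ d) (hF : ContDiff ℝ 2 F) (hc : HasCompactSupport F) :
    ∃ K M, 0 < M ∧ (∀ R t, 0 < R → |inertiaTerm d σ r F (R, t)| ≤ K) ∧
      ∀ R t, M < |R| ∨ M < |t| → inertiaTerm d σ r F (R, t) = 0 := by
  obtain ⟨C, M, hC, hM, hCb, hM0⟩ := exists_slice_bounds hF hc
  obtain ⟨D, hD, hDb⟩ := hr.exists_second_deriv_bound hh hlam hd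
  have h0 : ∀ R t, M < |R| ∨ M < |t| → inertiaTerm d σ r F (R, t) = 0 := fun R t hRt => by
    simp [inertiaTerm, (hM0 R t hRt).1]
  refine ⟨M ^ (d - 2) * D * C, M, hM, fun R t hR => ?_, h0⟩
  by_cases hRM : M < |R|
  · rw [h0 R t (Or.inl hRM), abs_zero]; positivity
  · rw [abs_of_pos hR] at hRM
    rw [inertiaTerm]
    split_ifs with hlt
    · have hlt : R < σ * t := hlt
      have ht : 0 < t := by
        by_contra! hcon
        have := mul_nonpos_of_nonneg_of_nonpos hr.speed_pos.le hcon
        linarith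
      have h1 := hDb (R / t) ⟨by positivity, (div_lt_iff₀ ht).2 hlt⟩
      rw [abs_mul, abs_mul, abs_of_pos (by positivity : 0 < R ^ (d - 2))]
      have := (hCb R t).1
      have := not_lt.1 hRM
      dsimp only
      gcongr
    · rw [abs_zero]; positivity

lemma tendsto_div_left_shock (hr : IsCavitatingProfile d h lam σ r) {R : ℝ} (hR : 0 < R) :
    Tendsto (fun t => R / t) (𝓝[>] (R / σ)) (𝓝[<] σ) := by
  have hσ := hr.speed_pos
  have hT : 0 < R / σ := by positivity
  refine tendsto_nhdsWithin_iff.2 ⟨?_, ?_⟩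
  · have h1 : Tendsto (fun t => R / t) (𝓝[>] (R / σ)) (𝓝 (R / (R / σ))) :=
      tendsto_const_nhds.div (tendsto_nhdsWithin_of_tendsto_nhds tendsto_id) hT.ne'
    rwa [div_div_cancel₀ hR.ne'] at h1
  · filter_upwards [self_mem_nhdsWithin] with t ht
    have ht : R / σ < t := ht
    rw [mem_Iio, div_lt_iff₀ (hT.trans ht), mul_comm]
    exact (div_lt_iff₀ hσ).1 ht

/-- For fixed R the shock passes at t = R/σ. There w is continuous, but w_t = r - s r' jumps from 0
to σ(lam - a), which is the boundary term. -/
lemma integral_time (hr : IsCavitatingProfile d h lam σ r) (hh : IsVolumetricEnergy h)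
    (hlam : 0 < lam) (hd : 2 ≤ d) (hF : ContDiff ℝ 2 F) (hc : HasCompactSupport F) {a : ℝ}
    (ha : Tendsto (deriv r) (𝓝[<] σ) (𝓝 a)) {R : ℝ} (hR : 0 < R) :
    ∫ t, R ^ (d - 1) * (cavityAmplitude lam r R t * iteratedDeriv 2 (fun τ => F (R, τ)) t) =
      R ^ (d - 1) * (σ * (lam - a)) * F (R, R / σ) + ∫ t, inertiaTerm d σ r F (R, t) := by
  obtain ⟨C, M, hC, hM, hCb, hM0⟩ := exists_slice_bounds hF hc
  obtain ⟨K, N, hN, hKb, hN0⟩ := hr.exists_inertiaTerm_bound hh hlam hd hF hc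
  obtain ⟨c1, C1, hc1, hC1, hw, -⟩ := hr.exists_field_bounds hh hlam
  have hσ := hr.speed_pos
  have hT : 0 < R / σ := by positivity
  have hFs : ContDiff ℝ 2 fun τ => F (R, τ) := by fun_prop
  have hF1 : ContDiff ℝ 1 (deriv fun τ => F (R, τ)) := by simpa using hFs.iterate_deriv' 1 1
  have hfin : volume (Icc (-M) M) ≠ ⊤ := by simp
  have hfinN : volume (Icc (-N) N) ≠ ⊤ := by simp
  have hH : Integrable fun t => inertiaTerm d σ r F (R, t) := by
    refine integrable_of_bounded_support hfinN (C := K)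
      ((measurable_inertiaTerm hF.continuous).comp
        (measurable_const.prodMk measurable_id)).aestronglyMeasurable
      (Eventually.of_forall fun t => hKb R t hR) fun t ht => hN0 R t (Or.inr ?_)
    by_contra! hcon
    exact ht (abs_le.1 hcon)
  have hG : Integrable fun t =>
      R ^ (d - 1) * (cavityAmplitude lam r R t * iteratedDeriv 2 (fun τ => F (R, τ)) t) := by
    refine integrable_of_bounded_support hfin
      (C := R ^ (d - 1) * (C1 * (M + R) * C)) ?_ (Eventually.of_forall fun t => ?_) fun t ht => ?_
    · refine (((hr.measurable_cavityAmplitude.comp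
        (measurable_const.prodMk measurable_id)).mul ?_).const_mul _).aestronglyMeasurable
      rw [iteratedDeriv_two_eq]; exact measurable_deriv _
    · by_cases htM : M < |t|
      · rw [(hM0 R t (Or.inr htM)).2.1, mul_zero, mul_zero, abs_zero]; positivity
      · rw [abs_mul, abs_mul, abs_of_pos (by positivity : 0 < R ^ (d - 1))]
        obtain ⟨h1, h2⟩ := hw R t hR.le
        have h3 : 0 ≤ cavityAmplitude lam r R t :=
          le_trans (mul_nonneg hc1.le (add_nonneg (le_max_right _ _) hR.le)) h1
        rw [abs_of_nonneg h3]
        have h4 : cavityAmplitude lam r R t ≤ C1 * (M + R) := by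
          refine h2.trans ?_
          gcongr
          exact max_le ((le_abs_self t).trans (not_lt.1 htM)) hM.le
        have := (hCb R t).2.1
        gcongr
    · have htM : M < |t| := by
        by_contra! hcon
        exact ht (abs_le.1 hcon)
      rw [(hM0 R t (Or.inr htM)).2.1, mul_zero, mul_zero]
  have hH0 : ∀ t ∈ Iic (R / σ), inertiaTerm d σ r F (R, t) = 0 := fun t ht => by
    rw [inertiaTerm, if_neg]
    rw [not_lt, mul_comm]
    exact (le_div_iff₀ hσ).1 ht
  have hleft : ∫ t in Iic (R / σ),
      R ^ (d - 1) * (cavityAmplitude lam r R t * iteratedDeriv 2 (fun τ => F (R, τ)) t) =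
      R ^ (d - 1) * (lam * R * deriv (fun τ => F (R, τ)) (R / σ)) := by
    have h1 : ∀ t ∈ Iic (R / σ), R ^ (d - 1) * (cavityAmplitude lam r R t *
        iteratedDeriv 2 (fun τ => F (R, τ)) t) =
        R ^ (d - 1) * (lam * R) * deriv (deriv fun τ => F (R, τ)) t := fun t ht => by
      have h2 : cavityAmplitude lam r R t = lam * R := by
        rw [cavityAmplitude]
        split_ifs with ht0
        · rfl
        · have ht0 : 0 < t := not_le.1 ht0
          rw [max_eq_left (by positivity), hr.eq_ahead]
          · field_simp
          · rw [le_div_iff₀ ht0, mul_comm]; exact (le_div_iff₀ hσ).1 ht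
      rw [h2, iteratedDeriv_two_eq]; ring
    rw [setIntegral_congr_fun measurableSet_Iic h1, integral_const_mul,
      HasCompactSupport.integral_Iic_deriv_eq hF1]
    · ring
    · refine HasCompactSupport.of_support_subset_isCompact (K := Icc (-M) M) isCompact_Icc
        fun t ht => abs_le.1 ?_
      by_contra! hcon
      exact ht (hM0 R t (Or.inr hcon)).2.2.2
  have hright : ∫ t in Ioi (R / σ),
      (R ^ (d - 1) * (cavityAmplitude lam r R t * iteratedDeriv 2 (fun τ => F (R, τ)) t) -
        inertiaTerm d σ r F (R, t)) =
      0 - R ^ (d - 1) * (lam * R * deriv (fun τ => F (R, τ)) (R / σ) -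
        (σ * (lam - a)) * F (R, R / σ)) := by
    refine integral_Ioi_of_hasDerivAt_of_tendsto_nhdsGT
      -- The primitive R^{d-1}(wF_t - w_tF), whose derivative is R^{d-1}(wF_tt - w_ttF).
      (f := fun t => R ^ (d - 1) * (t * r (R / t) * deriv (fun τ => F (R, τ)) t -
        (r (R / t) - R / t * deriv r (R / t)) * F (R, t))) (fun t ht => ?_)
      (hG.sub hH).integrableOn ?_ ?_
    · have ht : R / σ < t := ht
      have ht0 : 0 < t := hT.trans ht
      have hlt : R < σ * t := by rw [mul_comm]; exact (div_lt_iff₀ hσ).1 ht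
      have hs : R / t ∈ Ioo 0 σ := ⟨by positivity, (div_lt_iff₀ ht0).2 hlt⟩
      obtain ⟨hf0, hf1⟩ := hasDerivAt_time_slice hF R t
      have hq : HasDerivAt (fun t => R / t) (-R / t ^ 2) t := by
        have := (hasDerivAt_inv ht0.ne').const_mul R
        simpa [div_eq_mul_inv] using this
      have hr0 : HasDerivAt (fun t => r (R / t)) (deriv r (R / t) * (-R / t ^ 2)) t :=
        (hr.hasDerivAt hs.1 hs.2.ne).comp t hq
      have hr1 : HasDerivAt (fun t => deriv r (R / t)) (iteratedDeriv 2 r (R / t) * (-R / t ^ 2)) t :=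
        (hr.hasDerivAt_deriv hs).comp t hq
      have hd1 := ((((hasDerivAt_id t).fun_mul hr0).fun_mul hf1).fun_sub
        ((hr0.fun_sub (hq.fun_mul hr1)).fun_mul hf0)).const_mul (R ^ (d - 1))
      refine hd1.congr_deriv ?_
      rw [inertiaTerm, if_pos hlt, cavityAmplitude, if_neg (not_le.2 ht0), max_eq_left hs.1.le]
      obtain ⟨n, rfl⟩ : ∃ n, d = n + 2 := ⟨d - 2, by omega⟩
      simp only [id, Nat.add_sub_cancel, show n + 2 - 1 = n + 1 by omega]
      field_simp
      ring
    · have h1 := hr.tendsto_div_left_shock hR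
      have hid : Tendsto (fun t : ℝ => t) (𝓝[>] (R / σ)) (𝓝 (R / σ)) :=
        tendsto_nhdsWithin_of_tendsto_nhds tendsto_id
      have h2 := hr.tendsto_left_shock.comp h1
      have h3 := ha.comp h1
      have h4 := (hF1.continuous.tendsto (R / σ)).comp hid
      have h5 := (hFs.continuous.tendsto (R / σ)).comp hid
      have h6 := h1.mono_right (nhdsWithin_le_nhds)
      have h7 := (((hid.mul h2).mul h4).sub ((h2.sub (h6.mul h3)).mul h5)).const_mul (R ^ (d - 1))
      have h8 : R ^ (d - 1) * (lam * R * deriv (fun τ => F (R, τ)) (R / σ) -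
          σ * (lam - a) * F (R, R / σ)) = R ^ (d - 1) * (R / σ * (lam * σ) *
          deriv (fun τ => F (R, τ)) (R / σ) - (lam * σ - σ * a) * F (R, R / σ)) := by
        field_simp
      rw [h8]
      exact h7
    · refine tendsto_const_nhds.congr' ?_
      filter_upwards [eventually_gt_atTop M] with t ht
      have := hM0 R t (Or.inr (ht.trans_le (le_abs_self t)))
      rw [this.1, this.2.2.2]; ring
  rw [← integral_add_compl (measurableSet_Iic (a := R / σ)) hG,
    ← integral_add_compl (measurableSet_Iic (a := R / σ)) hH, hleft, compl_Iic,
    setIntegral_eq_zero_of_forall_eq_zero hH0]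
  rw [integral_sub hG.integrableOn hH.integrableOn] at hright
  linarith

/-- For fixed t the stress is integrated by parts on both sides of the shock R = σt. The jump of Φ₁
remains, the cavity contributes nothing, and the equation turns the volume term behind the shock
into inertia. -/
lemma integral_radius (hr : IsCavitatingProfile d h lam σ r) (hh : IsVolumetricEnergy h)
    (hlam : 0 < lam) (hd : 3 ≤ d) (hF : ContDiff ℝ 2 F) (hc : HasCompactSupport F) {a : ℝ}
    (ha0 : 0 < a) (ha : Tendsto (deriv r) (𝓝[<] σ) (𝓝 a)) {t : ℝ}
    (hG : IntegrableOn (fun R => R ^ (d - 1) * (cavityRadialStress d h lam σ r R t *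
      deriv (fun ρ => F (ρ, t)) R + (d - 1) / R * cavityHoopStress d h lam σ r R t * F (R, t)))
      (Ioi 0)) :
    ∫ R in Ioi (0 : ℝ), R ^ (d - 1) * (cavityRadialStress d h lam σ r R t *
      deriv (fun ρ => F (ρ, t)) R + (d - 1) / R * cavityHoopStress d h lam σ r R t * F (R, t)) =
      (Ioi (0 : ℝ)).indicator (fun t => (σ * t) ^ (d - 1) *
        (radialStress d h a lam - radialStress d h lam lam) * F (σ * t, t)) t -
      ∫ R in Ioi (0 : ℝ), inertiaTerm d σ r F (R, t) := by
  obtain ⟨C, M, hC, hM, hCb, hM0⟩ := exists_slice_bounds hF hc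
  obtain ⟨K, N, hN, hKb, hN0⟩ := hr.exists_inertiaTerm_bound hh hlam (by omega) hF hc
  have hσ := hr.speed_pos
  have hFs : ContDiff ℝ 2 fun ρ => F (ρ, t) := by fun_prop
  set T := max (σ * t) 0 with hT
  have hT0 : 0 ≤ T := le_max_right _ _
  have hH : IntegrableOn (fun R => inertiaTerm d σ r F (R, t)) (Ioi 0) := by
    refine integrable_of_bounded_support (S := Icc (-N) N)
      (ne_top_of_le_ne_top (by simp) (Measure.restrict_apply_le _ _)) (C := K)
      ((measurable_inertiaTerm hF.continuous).comp
        (measurable_id.prodMk measurable_const)).aestronglyMeasurable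
      ((ae_restrict_mem measurableSet_Ioi).mono fun R hR => hKb R t hR)
      fun R hR => hN0 R t (Or.inl ?_)
    by_contra! hcon
    exact hR (abs_le.1 hcon)
  have hH0 : ∀ R ∈ Ioi T, inertiaTerm d σ r F (R, t) = 0 := fun R hR => by
    rw [inertiaTerm, if_neg]
    exact not_lt.2 ((le_max_left _ _).trans (le_of_lt hR))
  have hbeyond : ∫ R in Ioi T, R ^ (d - 1) * (cavityRadialStress d h lam σ r R t *
      deriv (fun ρ => F (ρ, t)) R + (d - 1) / R * cavityHoopStress d h lam σ r R t * F (R, t)) =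
      - (radialStress d h lam lam * (T ^ (d - 1) * F (T, t))) := by
    have h1 : ∀ R ∈ Ioi T, R ^ (d - 1) * (cavityRadialStress d h lam σ r R t *
        deriv (fun ρ => F (ρ, t)) R + (d - 1) / R * cavityHoopStress d h lam σ r R t * F (R, t)) =
        radialStress d h lam lam * deriv (fun R => R ^ (d - 1) * F (R, t)) R := fun R hR => by
      have hR0 : 0 < R := hT0.trans_lt hR
      have h2 : cavityStrain lam σ r R t = lam ∧ cavityAmplitude lam r R t / R = lam := by
        rw [cavityStrain, cavityAmplitude]
        split_ifs with ht hs
        · exact ⟨rfl, by field_simp⟩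
        · have ht0 : 0 < t := not_le.1 ht
          rw [max_eq_left (by positivity), hr.eq_ahead _ hs.ge]
          exact ⟨rfl, by field_simp⟩
        · have ht0 : 0 < t := not_le.1 ht
          have h3 : σ < R / t := (lt_div_iff₀ ht0).2 ((le_max_left _ _).trans_lt hR)
          rw [max_eq_left (by positivity), hr.eq_ahead _ h3.le, (hr.hasDerivAt_ahead h3).deriv]
          exact ⟨rfl, by field_simp⟩
      have h4 := (((hasDerivAt_id R).fun_pow (d - 1)).fun_mul (deriv_radius_slice hF R t).1).deriv
      simp only [id] at h4
      rw [h4, cavityRadialStress, cavityHoopStress, h2.1, h2.2, hoopStress_self (by omega)]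
      obtain ⟨n, rfl⟩ : ∃ n, d = n + 2 := ⟨d - 2, by omega⟩
      simp only [Nat.add_sub_cancel, show n + 2 - 1 = n + 1 by omega]
      push_cast
      field_simp
      ring
    rw [setIntegral_congr_fun measurableSet_Ioi h1, integral_const_mul,
      HasCompactSupport.integral_Ioi_deriv_eq]
    · ring
    · exact (contDiff_id.pow _).mul (hFs.of_le (by norm_num))
    · refine HasCompactSupport.of_support_subset_isCompact (K := Icc (-M) M) isCompact_Icc
        fun R hR => abs_le.1 ?_
      by_contra! hcon
      exact right_ne_zero_of_mul hR (hM0 R t (Or.inl hcon)).1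
  rcases le_or_gt t 0 with ht | ht
  · have hT' : T = 0 := max_eq_right (mul_nonpos_of_nonneg_of_nonpos hσ.le ht)
    rw [hT'] at hbeyond hH0
    rw [hbeyond, setIntegral_eq_zero_of_forall_eq_zero hH0, indicator_of_notMem (by simpa using ht)]
    simp [zero_pow (show d - 1 ≠ 0 by omega)]
  · have hT' : T = σ * t := max_eq_left (by positivity)
    have hTpos : 0 < T := by rw [hT']; positivity
    -- The primitive is R^{d-1}Φ₁F; its limit 0 at the cavity is the stress-free condition.
    have hbehind : ∫ R in (0 : ℝ)..T, (R ^ (d - 1) * (cavityRadialStress d h lam σ r R t *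
        deriv (fun ρ => F (ρ, t)) R + (d - 1) / R * cavityHoopStress d h lam σ r R t * F (R, t)) +
        inertiaTerm d σ r F (R, t)) =
        t ^ (d - 1) * (σ ^ (d - 1) * radialStress d h a lam) * F (T, t) -
          t ^ (d - 1) * 0 * F (0, t) := by
      refine intervalIntegral.integral_eq_sub_of_hasDerivAt_of_tendsto (f := fun R =>
        t ^ (d - 1) * ((R / t) ^ (d - 1) * radialStress d h (deriv r (R / t)) (r (R / t) / (R / t)))
          * F (R, t)) hTpos (fun R hR => ?_) ?_ ?_ ?_
      · have hR0 : 0 < R := hR.1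
        have hlt : R < σ * t := hT' ▸ hR.2
        have hs : R / t ∈ Ioo 0 σ := ⟨by positivity, (div_lt_iff₀ ht).2 hlt⟩
        have hq : HasDerivAt (fun R => R / t) (1 / t) R := (hasDerivAt_id R).div_const t
        have h1 := HasDerivAt.comp R (hr.hasDerivAt_pow_mul_radialStress hh hlam (by omega) hs) hq
        refine ((h1.const_mul (t ^ (d - 1))).fun_mul (deriv_radius_slice hF R t).1).congr_deriv ?_
        have h2 : t * r (R / t) / R = r (R / t) / (R / t) := by field_simp
        rw [inertiaTerm, if_pos hlt, cavityRadialStress, cavityHoopStress, cavityStrain,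
          cavityAmplitude, if_neg (not_le.2 ht), if_neg (not_le.2 ht), if_neg hs.2.ne,
          max_eq_left hs.1.le, h2]
        obtain ⟨n, rfl⟩ : ∃ n, d = n + 2 := ⟨d - 2, by omega⟩
        simp only [Nat.add_sub_cancel, show n + 2 - 1 = n + 1 by omega, Function.comp_apply]
        generalize radialStress (n + 2) h (deriv r (R / t)) (r (R / t) / (R / t)) = A
        generalize hoopStress (n + 2) h (deriv r (R / t)) (r (R / t) / (R / t)) = B
        generalize iteratedDeriv 2 r (R / t) = D
        push_cast
        simp only [div_pow]
        field_simp
        ring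
      · rw [intervalIntegrable_iff_integrableOn_Ioc_of_le hT0]
        exact (hG.mono_set Ioc_subset_Ioi_self).add (hH.mono_set Ioc_subset_Ioi_self)
      · have h1 : Tendsto (fun R => R / t) (𝓝[>] 0) (𝓝[>] 0) := by
          refine tendsto_nhdsWithin_iff.2 ⟨?_, ?_⟩
          · have : Tendsto (fun R : ℝ => R / t) (𝓝[>] 0) (𝓝 (0 / t)) :=
              (tendsto_nhdsWithin_of_tendsto_nhds tendsto_id).div_const t
            rwa [zero_div] at this
          · filter_upwards [self_mem_nhdsWithin] with R hR using div_pos hR ht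
        exact (((hr.tendsto_pow_mul_radialStress_zero hlam).comp h1).const_mul _).mul
          ((hFs.continuous.tendsto 0).mono_left nhdsWithin_le_nhds)
      · have h1 : Tendsto (fun R => R / t) (𝓝[<] T) (𝓝[<] σ) := by
          refine tendsto_nhdsWithin_iff.2 ⟨?_, ?_⟩
          · have : Tendsto (fun R : ℝ => R / t) (𝓝[<] T) (𝓝 (T / t)) :=
              (tendsto_nhdsWithin_of_tendsto_nhds tendsto_id).div_const t
            rwa [hT', mul_div_cancel_right₀ _ ht.ne', ← hT'] at this
          · filter_upwards [self_mem_nhdsWithin] with R hR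
            have hR : R < T := hR
            exact (div_lt_iff₀ ht).2 (hT' ▸ hR)
        have hb := hr.tendsto_hoop_left_shock
        have hv : ContinuousAt (deriv h) (a * lam ^ (d - 1)) :=
          (hh.hasDerivAt_deriv (by positivity)).continuousAt
        have hP : Tendsto (fun s => radialStress d h (deriv r s) (r s / s)) (𝓝[<] σ)
            (𝓝 (radialStress d h a lam)) :=
          ha.add ((hb.pow (d - 1)).mul (hv.tendsto.comp (ha.mul (hb.pow (d - 1)))))
        have hs : Tendsto (fun s : ℝ => s ^ (d - 1)) (𝓝[<] σ) (𝓝 (σ ^ (d - 1))) :=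
          (tendsto_nhdsWithin_of_tendsto_nhds tendsto_id).pow _
        exact (((hs.mul hP).comp h1).const_mul _).mul
          ((hFs.continuous.tendsto T).mono_left nhdsWithin_le_nhds)
    have hsplit : Ioi (0 : ℝ) = Ioc 0 T ∪ Ioi T := (Ioc_union_Ioi_eq_Ioi hT0).symm
    have hdisj : Disjoint (Ioc 0 T) (Ioi T) := by
      rw [Set.disjoint_left]; intro x hx hx2; exact absurd hx.2 (not_le.2 hx2)
    have hs1 : Ioc 0 T ⊆ Ioi 0 := Ioc_subset_Ioi_self
    have hs2 : Ioi T ⊆ Ioi 0 := Ioi_subset_Ioi hT0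
    rw [indicator_of_mem (show t ∈ Ioi (0 : ℝ) from ht), hsplit,
      setIntegral_union hdisj measurableSet_Ioi (hG.mono_set hs1) (hG.mono_set hs2),
      setIntegral_union hdisj measurableSet_Ioi (hH.mono_set hs1) (hH.mono_set hs2),
      hbeyond, setIntegral_eq_zero_of_forall_eq_zero hH0]
    rw [intervalIntegral.integral_of_le hT0, integral_add (hG.mono_set hs1) (hH.mono_set hs1)]
      at hbehind
    rw [hT'] at hbehind ⊢
    rw [mul_pow]
    linarith

end IsCavitatingProfile

end RayIdentity

/-! ### The cavitating motion is a weak solution -/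

section WeakSolution

variable {d : ℕ} {h : ℝ → ℝ} {lam σ : ℝ} {r : ℝ → ℝ}

namespace IsCavitatingProfile

/-- The inertia terms of `integral_time` and `integral_radius` cancel. After the substitution R = σt
the two shock terms are multiples of one integral, and they cancel by the Rankine–Hugoniot
condition. -/
lemma integral_ray_eq_zero (hr : IsCavitatingProfile d h lam σ r) (hh : IsVolumetricEnergy h)
    (hlam : 0 < lam) (hd : 3 ≤ d) {F : ℝ × ℝ → ℝ} (hF : ContDiff ℝ 2 F) (hc : HasCompactSupport F) :
    ∫ R in Ioi (0 : ℝ), R ^ (d - 1) * ∫ t,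
      (cavityAmplitude lam r R t * iteratedDeriv 2 (fun τ => F (R, τ)) t +
        cavityRadialStress d h lam σ r R t * deriv (fun ρ => F (ρ, t)) R +
        (d - 1) / R * cavityHoopStress d h lam σ r R t * F (R, t)) = 0 := by
  obtain ⟨C, M, hC, hM, hCb, hM0⟩ := exists_slice_bounds hF hc
  obtain ⟨K, hK⟩ := hr.exists_stress_field_bounds hh hlam hd M
  obtain ⟨D, N, hN, hDb, hN0⟩ := hr.exists_inertiaTerm_bound hh hlam (by omega) hF hc
  obtain ⟨a, ha0, ha, hRH, -⟩ := hr.shock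
  have hσ := hr.speed_pos
  have hd1 : (0 : ℝ) ≤ d - 1 := by
    have : (3 : ℝ) ≤ d := by exact_mod_cast hd
    linarith
  -- Joint integrability on the half plane allows opposite orders of integration: time first for the
  -- inertia part `G₁`, radius first for the stress part `G₂`.
  set μ : Measure (ℝ × ℝ) := (volume.restrict (Ioi 0)).prod volume with hμ
  have hpos : ∀ᵐ p ∂μ, 0 < p.1 :=
    Measure.quasiMeasurePreserving_fst.ae (ae_restrict_mem measurableSet_Ioi)
  have hbox : ∀ N : ℝ, μ (Icc (-N) N ×ˢ Icc (-N) N) ≠ ⊤ := fun N => by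
    rw [hμ, Measure.prod_prod]
    refine ENNReal.mul_ne_top (ne_top_of_le_ne_top ?_ (Measure.restrict_apply_le _ _)) ?_ <;> simp
  have hout : ∀ (N : ℝ) (p : ℝ × ℝ), p ∉ Icc (-N) N ×ˢ Icc (-N) N → N < |p.1| ∨ N < |p.2| := by
    intro N p hp
    by_contra! hcon
    exact hp ⟨abs_le.1 hcon.1, abs_le.1 hcon.2⟩
  set G₁ : ℝ × ℝ → ℝ := fun p => p.1 ^ (d - 1) * (cavityAmplitude lam r p.1 p.2 *
    iteratedDeriv 2 (fun τ => F (p.1, τ)) p.2) with hG₁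
  set G₂ : ℝ × ℝ → ℝ := fun p => p.1 ^ (d - 1) * (cavityRadialStress d h lam σ r p.1 p.2 *
      deriv (fun ρ => F (ρ, p.2)) p.1 +
      (d - 1) / p.1 * cavityHoopStress d h lam σ r p.1 p.2 * F (p.1, p.2)) with hG₂
  have hI₁ : Integrable G₁ μ := by
    refine integrable_of_bounded_support (hbox M) (C := M ^ (d - 1) * (K * C)) ?_ ?_ fun p hp => ?_
    · exact ((measurable_fst.pow_const _).mul (hr.measurable_cavityAmplitude.mul
        (continuous_iteratedDeriv_two_time hF).measurable)).aestronglyMeasurable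
    · filter_upwards [hpos] with ⟨R, t⟩ hR
      have hR : 0 < R := hR
      by_cases hout : M < |R| ∨ M < |t|
      · have hK0 : 0 ≤ K := (abs_nonneg _).trans (hK M 0 hM le_rfl (by simpa using hM.le)).1
        simp only [hG₁, (hM0 R t hout).2.1, mul_zero, abs_zero]
        positivity
      · push Not at hout
        have h1 := hK R t hR ((le_abs_self R).trans hout.1) hout.2
        have h2 := hCb R t
        have h3 := (le_abs_self R).trans hout.1
        have h4 := h1.1
        have hK0 : 0 ≤ K := (abs_nonneg _).trans h4
        simp only [hG₁]
        rw [abs_mul, abs_mul, abs_of_pos (by positivity : 0 < R ^ (d - 1))]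
        gcongr
        exact h2.2.1
    · simp only [hG₁, (hM0 p.1 p.2 (hout M p hp)).2.1, mul_zero]
  have hI₂ : Integrable G₂ μ := by
    refine integrable_of_bounded_support (hbox M) (C := K * C + (d - 1) * M ^ (d - 3) * K * C)
      ?_ ?_ fun p hp => ?_
    · exact ((measurable_fst.pow_const _).mul ((hr.measurable_cavityRadialStress.mul
        (continuous_deriv_radius hF).measurable).add (((measurable_const.div measurable_fst).mul
          hr.measurable_cavityHoopStress).mul hF.continuous.measurable))).aestronglyMeasurable
    · filter_upwards [hpos] with ⟨R, t⟩ hR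
      have hR : 0 < R := hR
      by_cases hout : M < |R| ∨ M < |t|
      · have hK0 : 0 ≤ K := (abs_nonneg _).trans (hK M 0 hM le_rfl (by simpa using hM.le)).1
        simp only [hG₂, (hM0 R t hout).2.2.1, (hM0 R t hout).1, mul_zero, abs_zero, add_zero]
        positivity
      · push Not at hout
        obtain ⟨h1, h1', h1''⟩ := hK R t hR ((le_abs_self R).trans hout.1) hout.2
        obtain ⟨h2, h2', h2''⟩ := hCb R t
        have h3 := (le_abs_self R).trans hout.1
        have hK0 : 0 ≤ K := (abs_nonneg _).trans h1
        simp only [hG₂]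
        change |R ^ (d - 1) * (cavityRadialStress d h lam σ r R t * _ + _)| ≤ _
        change |cavityRadialStress d h lam σ r R t| * _ ≤ _ at h1'
        change |cavityHoopStress d h lam σ r R t| * _ ≤ _ at h1''
        generalize cavityRadialStress d h lam σ r R t = P at *
        generalize cavityHoopStress d h lam σ r R t = Q at *
        generalize deriv (fun ρ => F (ρ, t)) R = f' at *
        generalize F (R, t) = f at *
        calc _ = |P * R ^ (d - 1) * f' + (d - 1) * R ^ (d - 3) * (Q * R) * f| := by
              congr 1
              obtain ⟨n, rfl⟩ : ∃ n, d = n + 3 := ⟨d - 3, by omega⟩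
              simp only [Nat.add_sub_cancel, show n + 3 - 1 = n + 2 by omega]
              field_simp
              ring
          _ ≤ |P| * R ^ (d - 1) * |f'| + (d - 1) * R ^ (d - 3) * (|Q| * R) * |f| := by
              refine (abs_add_le _ _).trans (le_of_eq ?_)
              simp only [abs_mul, abs_of_nonneg hd1, abs_of_pos hR, abs_pow]
          _ ≤ _ := by gcongr
    · simp only [hG₂, (hM0 p.1 p.2 (hout M p hp)).2.2.1, (hM0 p.1 p.2 (hout M p hp)).1, mul_zero,
        add_zero]
  have hIH : Integrable (inertiaTerm d σ r F) μ := by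
    refine integrable_of_bounded_support (hbox N) (C := D)
      (measurable_inertiaTerm hF.continuous).aestronglyMeasurable ?_ fun p hp =>
        hN0 p.1 p.2 (hout N p hp)
    filter_upwards [hpos] with p hp using hDb p.1 p.2 hp
  set A : ℝ → ℝ := fun R => R ^ (d - 1) * F (R, R / σ) with hA
  have hAint : IntegrableOn A (Ioi 0) := by
    refine Integrable.integrableOn (Continuous.integrable_of_hasCompactSupport (by fun_prop)
      (HasCompactSupport.of_support_subset_isCompact (K := Icc (-M) M) isCompact_Icc
        fun R hR => abs_le.1 ?_))
    by_contra! hcon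
    exact right_ne_zero_of_mul hR (hM0 R _ (Or.inl hcon)).1
  have e1 : ∫ p, G₁ p ∂μ = σ * (lam - a) * (∫ R in Ioi 0, A R) +
      ∫ p, inertiaTerm d σ r F p ∂μ := by
    rw [hμ, integral_prod _ hI₁, integral_prod _ hIH, ← integral_const_mul,
      ← integral_add (hAint.const_mul _) hIH.integral_prod_left]
    refine setIntegral_congr_fun measurableSet_Ioi fun R hR => ?_
    refine (hr.integral_time hh hlam (by omega) hF hc ha hR).trans ?_
    simp only [hA]
    ring
  have e2 : ∫ p, G₂ p ∂μ = (radialStress d h a lam - radialStress d h lam lam) *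
      (σ⁻¹ * ∫ R in Ioi 0, A R) - ∫ p, inertiaTerm d σ r F p ∂μ := by
    have hAσ : IntegrableOn (fun t => A (σ * t)) (Ioi 0) := by
      have := (integrableOn_Ioi_comp_mul_left_iff A 0 hσ).2 (by rwa [mul_zero])
      exact this
    have h1 : ∫ t in Ioi 0, A (σ * t) = σ⁻¹ * ∫ R in Ioi 0, A R := by
      have := integral_comp_mul_left_Ioi A 0 hσ
      rwa [mul_zero, smul_eq_mul] at this
    have h2 : Integrable fun t => (Ioi (0 : ℝ)).indicator (fun t =>
        (radialStress d h a lam - radialStress d h lam lam) * A (σ * t)) t :=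
      (integrable_indicator_iff measurableSet_Ioi).2 (hAσ.const_mul _)
    rw [← h1, ← integral_const_mul, ← integral_indicator measurableSet_Ioi, hμ,
      integral_prod_symm _ hI₂, integral_prod_symm _ hIH, ← integral_sub h2 hIH.integral_prod_right]
    refine integral_congr_ae ?_
    filter_upwards [hI₂.prod_left_ae] with t ht
    refine (hr.integral_radius hh hlam hd hF hc ha0 ha ht).trans ?_
    congr 1
    by_cases ht0 : t ∈ Ioi (0 : ℝ)
    · rw [indicator_of_mem ht0, indicator_of_mem ht0]
      simp only [hA]
      rw [mul_div_cancel_left₀ _ hσ.ne']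
      ring
    · rw [indicator_of_notMem ht0, indicator_of_notMem ht0]
  have e3 : ∫ p, (G₁ p + G₂ p) ∂μ = 0 := by
    rw [integral_add hI₁ hI₂, e1, e2]
    -- The Rankine–Hugoniot condition.
    have : radialStress d h a lam - radialStress d h lam lam = -(σ ^ 2 * (lam - a)) := by linarith
    rw [this]
    field_simp
    ring
  refine Eq.trans ?_ e3
  have e4 := integral_prod _ (hI₁.add hI₂)
  simp only [Pi.add_apply] at e4
  rw [hμ, e4]
  refine setIntegral_congr_fun measurableSet_Ioi fun R hR => ?_
  rw [← integral_const_mul]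
  refine integral_congr_ae (Eventually.of_forall fun t => ?_)
  simp only [hG₁, hG₂]
  ring

variable {ψ : EuclideanSpace ℝ (Fin d) × ℝ → EuclideanSpace ℝ (Fin d)}

lemma integrable_and_integral_radialIntegrand (hr : IsCavitatingProfile d h lam σ r)
    (hh : IsVolumetricEnergy h) (hlam : 0 < lam) (hd : 3 ≤ d) (hψ : ContDiff ℝ 2 ψ)
    (hc : HasCompactSupport ψ) :
    Integrable (fun p : EuclideanSpace ℝ (Fin d) × ℝ =>
      radialIntegrand ψ (cavityAmplitude lam r ‖p.1‖ p.2) (cavityRadialStress d h lam σ r ‖p.1‖ p.2)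
        (cavityHoopStress d h lam σ r ‖p.1‖ p.2) p.1 p.2) ∧
    ∫ p : EuclideanSpace ℝ (Fin d) × ℝ,
      radialIntegrand ψ (cavityAmplitude lam r ‖p.1‖ p.2) (cavityRadialStress d h lam σ r ‖p.1‖ p.2)
        (cavityHoopStress d h lam σ r ‖p.1‖ p.2) p.1 p.2 = 0 :=
  integral_radialIntegrand_eq_zero hd hψ hc hr.measurable_cavityAmplitude
    hr.measurable_cavityRadialStress hr.measurable_cavityHoopStress
    (hr.exists_stress_field_bounds hh hlam hd)
    (fun _ hF hFc => hr.integral_ray_eq_zero hh hlam hd hF hFc)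

/-- The cone meets each line x = const in a single time. Off it and the axis the pointwise gradient
is classical. -/
lemma ae_not_on_shock (hr : IsCavitatingProfile d h lam σ r) (hd : 1 ≤ d) :
    ∀ᵐ p : EuclideanSpace ℝ (Fin d) × ℝ, p.1 ≠ 0 ∧ ‖p.1‖ ≠ σ * p.2 := by
  have hnt : Nontrivial (EuclideanSpace ℝ (Fin d)) := nontrivial_euclideanSpace hd
  have h1 : ∀ᵐ p : EuclideanSpace ℝ (Fin d) × ℝ, p.1 ≠ 0 :=
    Measure.quasiMeasurePreserving_fst.ae
      (compl_mem_ae_iff.2 (measure_singleton (0 : EuclideanSpace ℝ (Fin d))))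
  have h2 : ∀ᵐ p : EuclideanSpace ℝ (Fin d) × ℝ, ‖p.1‖ ≠ σ * p.2 := by
    have hm : MeasurableSet {p : EuclideanSpace ℝ (Fin d) × ℝ | ‖p.1‖ = σ * p.2} :=
      measurableSet_eq_fun (by fun_prop) (by fun_prop)
    have h3 : volume {p : EuclideanSpace ℝ (Fin d) × ℝ | ‖p.1‖ = σ * p.2} = 0 := by
      rw [Measure.volume_eq_prod, Measure.measure_prod_null hm]
      refine Eventually.of_forall fun x => ?_
      refine measure_mono_null (t := {‖x‖ / σ}) (fun t ht => ?_) (measure_singleton _)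
      have ht : ‖x‖ = σ * t := ht
      rw [mem_singleton_iff, ht, mul_div_cancel_left₀ _ hr.speed_pos.ne']
    have := compl_mem_ae_iff.2 h3
    filter_upwards [this] with p hp using hp
  exact h1.and h2

lemma hasDerivAt_amplitude (hr : IsCavitatingProfile d h lam σ r) {R t : ℝ} (hR : 0 < R)
    (hRt : R ≠ σ * t) :
    HasDerivAt (fun R => selfSimilarAmplitude lam r R t) (cavityStrain lam σ r R t) R := by
  simp only [selfSimilarAmplitude, cavityStrain]
  split_ifs with ht hs
  · simpa using (hasDerivAt_id R).const_mul lam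
  · exact absurd ((div_eq_iff (not_le.1 ht).ne').1 hs) hRt
  · have ht0 : 0 < t := not_le.1 ht
    have h0 : HasDerivAt r (deriv r (R / t)) (R / t) := hr.hasDerivAt (div_pos hR ht0) hs
    have hq : HasDerivAt (fun R => R / t) (1 / t) R := (hasDerivAt_id R).div_const t
    refine ((HasDerivAt.comp R h0 hq).const_mul t).congr_deriv ?_
    field_simp

lemma momentumIntegrand_ae_eq (hr : IsCavitatingProfile d h lam σ r)
    (hh : IsVolumetricEnergy h) (hlam : 0 < lam) (hd : 3 ≤ d)
    (ψ : EuclideanSpace ℝ (Fin d) × ℝ → EuclideanSpace ℝ (Fin d)) :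
    (fun p : EuclideanSpace ℝ (Fin d) × ℝ =>
      momentumIntegrand h (radialMotion d (selfSimilarAmplitude lam r)) ψ p.1 p.2) =ᵐ[volume]
    fun p => radialIntegrand ψ (cavityAmplitude lam r ‖p.1‖ p.2)
      (cavityRadialStress d h lam σ r ‖p.1‖ p.2) (cavityHoopStress d h lam σ r ‖p.1‖ p.2)
      p.1 p.2 := by
  obtain ⟨c, C, hc, hC, hw, hs⟩ := hr.exists_field_bounds hh hlam
  filter_upwards [hr.ae_not_on_shock (by omega)] with ⟨x, t⟩ ⟨hx, hxt⟩
  have hx0 : 0 < ‖x‖ := norm_pos_iff.2 hx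
  have hw0 : 0 < selfSimilarAmplitude lam r ‖x‖ t := by
    rw [← cavityAmplitude_eq lam r hx0.le]
    exact lt_of_lt_of_le (mul_pos hc (add_pos_of_nonneg_of_pos (le_max_right _ _) hx0))
      (hw _ t hx0.le).1
  have hv := (hs ‖x‖ t hx0).2.2
  rw [cavityAmplitude_eq lam r hx0.le] at hv
  simp only [cavityRadialStress, cavityHoopStress, cavityAmplitude_eq lam r hx0.le]
  exact momentumIntegrand_radialMotion (by omega) ψ hx (hr.hasDerivAt_amplitude hx0 hxt)
    (hr.cavityStrain_pos hlam hx0 t) hw0 (hh.differentiableAt (hc.trans_le hv))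

lemma isWeakSolution (hr : IsCavitatingProfile d h lam σ r) (hh : IsVolumetricEnergy h)
    (hlam : 0 < lam) (hd : 3 ≤ d) :
    IsWeakSolution h (radialMotion d (selfSimilarAmplitude lam r)) := by
  intro ψ hψ hc
  have hψ2 : ContDiff ℝ 2 ψ := contDiff_infty.1 hψ 2
  obtain ⟨h1, h2⟩ := hr.integrable_and_integral_radialIntegrand hh hlam hd hψ2 hc
  have hae := hr.momentumIntegrand_ae_eq hh hlam hd ψ
  have hI := h1.congr hae.symm
  refine ⟨hI, ?_⟩
  rw [← integral_congr_ae hae, Measure.volume_eq_prod] at h2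
  rw [Measure.volume_eq_prod] at hI
  rw [integral_prod_symm _ hI] at h2
  exact h2

end IsCavitatingProfile

end WeakSolution

/-! ### Mollification of the odd extension -/

section Mollifier

variable {φ : ℝ → ℝ}

namespace IsRadialMollifier

lemma continuous (hφ : IsRadialMollifier φ) : Continuous φ := hφ.smooth.continuous

lemma eq_zero_of_one_lt (hφ : IsRadialMollifier φ) {x : ℝ} (hx : 1 < |x|) : φ x = 0 :=
  image_eq_zero_of_notMem_tsupport fun h =>
    absurd (abs_le.2 (mem_Icc.1 (hφ.support_subset h))) (not_le.2 hx)

lemma deriv_eq_zero_of_one_lt (hφ : IsRadialMollifier φ) {x : ℝ} (hx : 1 < |x|) :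
    deriv φ x = 0 :=
  image_eq_zero_of_notMem_tsupport fun h =>
    absurd (abs_le.2 (mem_Icc.1 (hφ.support_subset (tsupport_deriv_subset (𝕜 := ℝ) h))))
      (not_le.2 hx)

lemma hasCompactSupport (hφ : IsRadialMollifier φ) : HasCompactSupport φ :=
  isCompact_Icc.of_isClosed_subset (isClosed_tsupport φ) hφ.support_subset

lemma integrable (hφ : IsRadialMollifier φ) : Integrable φ :=
  hφ.continuous.integrable_of_hasCompactSupport hφ.hasCompactSupport

lemma hasDerivAt (hφ : IsRadialMollifier φ) (x : ℝ) : HasDerivAt φ (deriv φ x) x :=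
  ((hφ.smooth.differentiable (by simp)) x).hasDerivAt

lemma continuous_deriv (hφ : IsRadialMollifier φ) : Continuous (deriv φ) :=
  hφ.smooth.continuous_deriv (by simp)

lemma exists_bound (hφ : IsRadialMollifier φ) :
    ∃ K, 0 < K ∧ (∀ x, φ x ≤ K) ∧ ∀ x, |deriv φ x| ≤ K := by
  obtain ⟨K₁, h₁⟩ := hφ.hasCompactSupport.exists_bound_of_continuous hφ.continuous
  obtain ⟨K₂, h₂⟩ := hφ.hasCompactSupport.deriv.exists_bound_of_continuous hφ.continuous_deriv
  refine ⟨max 1 (max K₁ K₂), by positivity, fun x => ?_, fun x => ?_⟩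
  · exact (le_abs_self _).trans ((h₁ x).trans ((le_max_left _ _).trans (le_max_right _ _)))
  · exact (h₂ x).trans ((le_max_right _ _).trans (le_max_right _ _))

/-- Where φ(0) > 0 enters: it is the source of the lower bounds for the mollified strains. -/
lemma exists_pos_near_zero (hφ : IsRadialMollifier φ) :
    ∃ δ m, 0 < δ ∧ δ ≤ 1 ∧ 0 < m ∧ ∀ x, |x| ≤ δ → m ≤ φ x := by
  have h0 := hφ.pos_zero
  have := (hφ.continuous.tendsto 0).eventually (lt_mem_nhds (half_lt_self h0))
  obtain ⟨ε, hε, h⟩ := Metric.eventually_nhds_iff.1 this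
  refine ⟨min 1 (ε / 2), φ 0 / 2, by positivity, min_le_left _ _, by positivity, fun x hx => ?_⟩
  refine (h ?_).le
  rw [Real.dist_eq, sub_zero]
  exact (hx.trans (min_le_right _ _)).trans_lt (half_lt_self hε)

lemma integrable_comp_sub (hφ : IsRadialMollifier φ) (x : ℝ) : Integrable fun ρ => φ (x - ρ) :=
  hφ.integrable.comp_sub_left x

lemma integrable_comp_add (hφ : IsRadialMollifier φ) (x : ℝ) : Integrable fun ρ => φ (x + ρ) :=
  hφ.integrable.comp_add_left x

/-- The even reflection of the mollifier has unit mass on the half line. -/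
lemma integral_add_reflection (hφ : IsRadialMollifier φ) (x : ℝ) :
    ∫ ρ in Ioi 0, (φ (x - ρ) + φ (x + ρ)) = 1 := by
  rw [integral_add (hφ.integrable_comp_sub x).integrableOn (hφ.integrable_comp_add x).integrableOn]
  have h1 : ∫ ρ in Ioi 0, φ (x + ρ) = ∫ ρ in Iic 0, φ (x - ρ) := by
    have := integral_comp_neg_Ioi 0 (fun ρ => φ (x - ρ))
    simpa using this
  rw [h1, add_comm, intervalIntegral.integral_Iic_add_Ioi
    (hφ.integrable_comp_sub x).integrableOn (hφ.integrable_comp_sub x).integrableOn,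
    integral_sub_left_eq_self φ volume x, hφ.integral_one]

lemma integral_comp_sub (hφ : IsRadialMollifier φ) {x : ℝ} (hx : 1 < x) :
    ∫ ρ in Ioi 0, φ (x - ρ) = 1 := by
  rw [← hφ.integral_add_reflection x]
  refine setIntegral_congr_fun measurableSet_Ioi fun ρ hρ => ?_
  have hρ : 0 < ρ := hρ
  simp [hφ.eq_zero_of_one_lt (x := x + ρ) (by rw [abs_of_pos] <;> linarith)]

lemma reflection_eq_zero (hφ : IsRadialMollifier φ) {x ρ : ℝ} (h : |x| + 1 < ρ) :
    φ (x - ρ) = 0 ∧ φ (x + ρ) = 0 := by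
  have h1 := le_abs_self x
  have h2 := neg_abs_le x
  refine ⟨hφ.eq_zero_of_one_lt ?_, hφ.eq_zero_of_one_lt ?_⟩
  · rw [abs_of_neg] <;> linarith
  · rw [abs_of_pos] <;> linarith

lemma deriv_reflection_eq_zero (hφ : IsRadialMollifier φ) {x ρ : ℝ}
    (h : |x| + 1 < ρ) : deriv φ (x - ρ) = 0 ∧ deriv φ (x + ρ) = 0 := by
  have h1 := le_abs_self x
  have h2 := neg_abs_le x
  refine ⟨hφ.deriv_eq_zero_of_one_lt ?_, hφ.deriv_eq_zero_of_one_lt ?_⟩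
  · rw [abs_of_neg] <;> linarith
  · rw [abs_of_pos] <;> linarith

end IsRadialMollifier

/-- The mollification of the odd extension of `W`. -/
noncomputable def oddMollification (φ W : ℝ → ℝ) (x : ℝ) : ℝ :=
  ∫ ρ in Ioi (0 : ℝ), (φ (x - ρ) - φ (x + ρ)) * W ρ

/-- The derivative of `oddMollification φ W` when `V` is the derivative of `W` on `(0, ∞)`. -/
noncomputable def oddMollificationDeriv (φ W V : ℝ → ℝ) (x : ℝ) : ℝ :=
  2 * φ x * W 0 + ∫ ρ in Ioi (0 : ℝ), (φ (x - ρ) + φ (x + ρ)) * V ρ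

lemma oddMollification_zero (hφ : IsRadialMollifier φ) (W : ℝ → ℝ) :
    oddMollification φ W 0 = 0 := by
  simp [oddMollification, hφ.even]

lemma integrableOn_Ioi_mul {g V : ℝ → ℝ} (x : ℝ) (hg : Continuous g)
    (hg0 : ∀ ρ, 0 < ρ → |x| + 1 < ρ → g ρ = 0) (hVm : AEStronglyMeasurable V (volume.restrict (Ioi 0)))
    {D : ℝ} (hV : ∀ ρ, 0 < ρ → ρ ≤ |x| + 1 → |V ρ| ≤ D) :
    IntegrableOn (fun ρ => g ρ * V ρ) (Ioi 0) := by
  obtain ⟨K, hK⟩ := (isCompact_Icc (a := (0 : ℝ)) (b := |x| + 1)).exists_bound_of_continuousOn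
    hg.continuousOn
  have hK0 : 0 ≤ K := (norm_nonneg _).trans (hK 0 ⟨le_rfl, by positivity⟩)
  refine Integrable.mono' (g := (Icc 0 (|x| + 1)).indicator fun _ => K * D) ?_
    (hg.aestronglyMeasurable.mul hVm) ?_
  · exact ((integrable_indicator_iff measurableSet_Icc).2
      (integrableOn_const measure_Icc_lt_top.ne)).integrableOn
  · filter_upwards [ae_restrict_mem measurableSet_Ioi] with ρ hρ
    have hρ : 0 < ρ := hρ
    by_cases h : ρ ≤ |x| + 1
    · rw [indicator_of_mem (show ρ ∈ Icc 0 (|x| + 1) from ⟨hρ.le, h⟩), norm_mul]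
      exact mul_le_mul (hK ρ ⟨hρ.le, h⟩) (hV ρ hρ h) (norm_nonneg _) hK0
    · rw [hg0 ρ hρ (not_le.1 h), zero_mul, norm_zero]
      exact indicator_nonneg (fun y hy => mul_nonneg hK0
        ((abs_nonneg _).trans (hV (|x| + 1) (by positivity) le_rfl))) _

namespace IsRadialMollifier

lemma hasDerivAt_oddMollification (hφ : IsRadialMollifier φ) {W V : ℝ → ℝ} {s : Set ℝ}
    (hs : s.Countable) (hWc : ContinuousOn W (Ici 0))
    (hW : ∀ ρ, 0 < ρ → ρ ∉ s → HasDerivAt W (V ρ) ρ) (hVm : Measurable V) {D : ℝ}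
    (hV : ∀ ρ, 0 < ρ → |V ρ| ≤ D) (x : ℝ) :
    HasDerivAt (oddMollification φ W) (oddMollificationDeriv φ W V x) x := by
  obtain ⟨K, hK0, hK, hK'⟩ := hφ.exists_bound
  have hφc := hφ.continuous
  have hφc' := hφ.continuous_deriv
  have hWm : AEStronglyMeasurable W (volume.restrict (Ioi 0)) :=
    (hWc.mono Ioi_subset_Ici_self).aestronglyMeasurable measurableSet_Ioi
  obtain ⟨E, hE⟩ := (isCompact_Icc (a := (0 : ℝ)) (b := |x| + 2)).exists_bound_of_continuousOn
    (hWc.mono Icc_subset_Ici_self)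
  have hE0 : 0 ≤ E := (norm_nonneg _).trans (hE 0 ⟨le_rfl, by positivity⟩)
  have hWint : ∀ g : ℝ → ℝ, Continuous g → (∀ ρ, 0 < ρ → |x| + 1 < ρ → g ρ = 0) →
      IntegrableOn (fun ρ => g ρ * W ρ) (Ioi 0) := fun g hg hg0 =>
    integrableOn_Ioi_mul x hg hg0 hWm fun ρ h1 h2 => hE ρ ⟨h1.le, by linarith⟩
  -- The derivative is first put on φ under the integral. Integration by parts in ρ then moves it to
  -- W, and the boundary value at ρ = 0 is the term 2φ(x)W(0): half the jump of the odd extension is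
  -- W(0).
  have key := hasDerivAt_integral_of_dominated_loc_of_deriv_le (μ := volume.restrict (Ioi 0))
    (F := fun y ρ => (φ (y - ρ) - φ (y + ρ)) * W ρ)
    (F' := fun y ρ => (deriv φ (y - ρ) - deriv φ (y + ρ)) * W ρ) (x₀ := x)
    (bound := (Icc 0 (|x| + 2)).indicator fun _ => (K + K) * E) (s := Metric.ball x 1)
    (Metric.ball_mem_nhds x one_pos)
    (Eventually.of_forall fun y => (by fun_prop : Continuous fun ρ =>
      φ (y - ρ) - φ (y + ρ)).aestronglyMeasurable.mul hWm)
    (hWint _ (by fun_prop) fun ρ h1 h2 => by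
      rw [(hφ.reflection_eq_zero h2).1, (hφ.reflection_eq_zero h2).2, sub_zero])
    ((by fun_prop : Continuous fun ρ =>
      deriv φ (x - ρ) - deriv φ (x + ρ)).aestronglyMeasurable.mul hWm) ?_
    ((integrable_indicator_iff measurableSet_Icc).2
      (integrableOn_const measure_Icc_lt_top.ne)).integrableOn ?_
  · refine key.2.congr_deriv ?_
    set N := |x| + 2 with hN
    have hN0 : 0 ≤ N := by positivity
    have hI1 : IntegrableOn (fun ρ => (deriv φ (x + ρ) - deriv φ (x - ρ)) * W ρ) (Ioi 0) :=
      hWint _ (by fun_prop) fun ρ h1 h2 => by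
        rw [(hφ.deriv_reflection_eq_zero h2).1, (hφ.deriv_reflection_eq_zero h2).2, sub_zero]
    have hI2 : IntegrableOn (fun ρ => (φ (x - ρ) + φ (x + ρ)) * V ρ) (Ioi 0) :=
      integrableOn_Ioi_mul x (by fun_prop) (fun ρ h1 h2 => by
        rw [(hφ.reflection_eq_zero h2).1, (hφ.reflection_eq_zero h2).2, add_zero])
        hVm.aestronglyMeasurable fun ρ h1 _ => hV ρ h1
    have hI := hI1.add hI2
    -- W is differentiable only off the countable set s, in the application the shock; continuity of
    -- W there suffices.
    have h1 := integral_eq_of_hasDerivAt_off_countable_of_le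
      (fun ρ => (φ (x - ρ) + φ (x + ρ)) * W ρ)
      (fun ρ => (deriv φ (x + ρ) - deriv φ (x - ρ)) * W ρ + (φ (x - ρ) + φ (x + ρ)) * V ρ)
      hN0 hs ?_ ?_ ?_
    · have h2 := hφ.reflection_eq_zero (x := x) (ρ := N) (by linarith)
      have h3 : ∫ ρ in Ioi 0, ((deriv φ (x + ρ) - deriv φ (x - ρ)) * W ρ +
          (φ (x - ρ) + φ (x + ρ)) * V ρ) = -(2 * φ x * W 0) := by
        rw [intervalIntegral.integral_of_le hN0] at h1
        rw [setIntegral_eq_of_subset_of_forall_sdiff_eq_zero measurableSet_Ioi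
          (Ioc_subset_Ioi_self : Ioc 0 N ⊆ _), h1, h2.1, h2.2]
        · simp only [sub_zero, add_zero]
          ring
        · rintro ρ ⟨h4, h5⟩
          have h4 : 0 < ρ := h4
          have h6 : |x| + 1 < ρ := by
            by_contra! hcon
            exact h5 ⟨h4, by linarith⟩
          simp [hφ.reflection_eq_zero h6, hφ.deriv_reflection_eq_zero h6]
      rw [integral_add hI1 hI2] at h3
      have h4 : ∫ ρ in Ioi 0, (deriv φ (x - ρ) - deriv φ (x + ρ)) * W ρ =
          -∫ ρ in Ioi 0, (deriv φ (x + ρ) - deriv φ (x - ρ)) * W ρ := by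
        rw [← integral_neg]
        refine integral_congr_ae (Eventually.of_forall fun ρ => ?_)
        simp only
        ring
      rw [h4, oddMollificationDeriv]
      linarith
    · exact (by fun_prop : Continuous fun ρ => φ (x - ρ) + φ (x + ρ)).continuousOn.mul
        (hWc.mono Icc_subset_Ici_self)
    · rintro ρ ⟨⟨h2, -⟩, h3⟩
      have ha : HasDerivAt (fun ρ => φ (x - ρ)) (-deriv φ (x - ρ)) ρ := by
        have := (hφ.hasDerivAt (x - ρ)).comp_const_sub x ρ
        exact this
      have hb : HasDerivAt (fun ρ => φ (x + ρ)) (deriv φ (x + ρ)) ρ :=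
        (hφ.hasDerivAt (x + ρ)).comp_const_add x ρ
      refine ((ha.add hb).mul (hW ρ h2 h3)).congr_deriv ?_
      simp only [Pi.add_apply]
      ring
    · rw [intervalIntegrable_iff_integrableOn_Ioc_of_le hN0]
      exact hI.mono_set Ioc_subset_Ioi_self
  · filter_upwards [ae_restrict_mem measurableSet_Ioi] with ρ hρ y hy
    have hρ : 0 < ρ := hρ
    have hy : |y| ≤ |x| + 1 := by
      rw [Metric.mem_ball, Real.dist_eq] at hy
      have := abs_sub_abs_le_abs_sub y x
      linarith
    by_cases h : ρ ≤ |x| + 2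
    · rw [indicator_of_mem (show ρ ∈ Icc 0 (|x| + 2) from ⟨hρ.le, h⟩), norm_mul]
      exact mul_le_mul ((abs_sub _ _).trans (add_le_add (hK' _) (hK' _))) (hE ρ ⟨hρ.le, h⟩)
        (norm_nonneg _) (by positivity)
    · have h0 := hφ.deriv_reflection_eq_zero (x := y) (ρ := ρ) (by linarith)
      rw [h0.1, h0.2, sub_zero, zero_mul, norm_zero]
      exact indicator_nonneg (fun y hy => by positivity) _
  · refine Eventually.of_forall fun ρ y _ => ?_
    exact ((hφ.hasDerivAt (y - ρ)).comp_sub_const y ρ |>.sub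
      ((hφ.hasDerivAt (y + ρ)).comp_add_const y ρ)).mul_const _

end IsRadialMollifier

end Mollifier

/-! ### Bounds for functions with controlled slope and for the reflected kernel -/

section MollifierBounds

variable {φ : ℝ → ℝ}

lemma sub_le_mul_sub_of_hasDerivAt {M A : ℝ → ℝ} (hM : ∀ x, HasDerivAt M (A x) x) {a b C : ℝ}
    (hab : a ≤ b) (hA : ∀ x, a < x → x < b → A x ≤ C) : M b - M a ≤ C * (b - a) := by
  refine (convex_Icc a b).image_sub_le_mul_sub_of_deriv_le
    (fun x _ => (hM x).continuousAt.continuousWithinAt)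
    (fun x _ => (hM x).differentiableAt.differentiableWithinAt) (fun x hx => ?_)
    a (left_mem_Icc.2 hab) b (right_mem_Icc.2 hab) hab
  rw [interior_Icc] at hx
  rw [(hM x).deriv]
  exact hA x hx.1 hx.2

lemma mul_sub_le_sub_of_hasDerivAt {M A : ℝ → ℝ} (hM : ∀ x, HasDerivAt M (A x) x) {a b C : ℝ}
    (hab : a ≤ b) (hA : ∀ x, a < x → x < b → C ≤ A x) : C * (b - a) ≤ M b - M a := by
  have := sub_le_mul_sub_of_hasDerivAt (fun x => (hM x).neg) (C := -C) hab
    fun x h1 h2 => neg_le_neg (hA x h1 h2)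
  simp only [Pi.neg_apply] at this
  linarith

/-- Makes M comparable to (T+x+1)x/(x+1), the shape of an odd regularisation of T + x: slope of
order 1 + T in the core, bounded slope outside. The upper bound integrates the slope over [0,1] and
[1,x]. -/
lemma linear_bounds_of_hasDerivAt {M A : ℝ → ℝ} {T c C δ : ℝ} {k : ℕ} (hT : 0 ≤ T) (hc : 0 < c)
    (hδ : 0 < δ) (hδ1 : δ ≤ 1) (hM : ∀ x, HasDerivAt M (A x) x) (hM0 : M 0 = 0)
    (h1 : ∀ x, 0 ≤ x → c * ((x + 1) / (T + x + 1)) ^ k ≤ A x)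
    (h2 : ∀ x, 0 ≤ x → A x ≤ C * (1 + T)) (h3 : ∀ x, 1 < x → A x ≤ C)
    (h4 : ∀ x, 0 ≤ x → x ≤ δ → c * (1 + T) ≤ A x) {x : ℝ} (hx : 0 ≤ x) :
    c * δ / (4 * 3 ^ k) * (T + x + 1) * x ≤ M x * (x + 1) ∧
      M x * (x + 1) ≤ 2 * C * (T + x + 1) * x := by
  have hA0 : ∀ x, 0 ≤ x → 0 ≤ A x := fun x hx => le_trans (by positivity) (h1 x hx)
  have hC : 0 ≤ C := (hA0 2 zero_le_two).trans (h3 2 one_lt_two)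
  have h3k : (1 : ℝ) ≤ 3 ^ k := one_le_pow₀ (by norm_num)
  have hcδ : c * δ ≤ c := mul_le_of_le_one_right hc.le hδ1
  constructor
  · have hmono : ∀ a b, 0 ≤ a → a ≤ b → M a ≤ M b := fun a b ha hab => by
      have := mul_sub_le_sub_of_hasDerivAt hM hab (C := 0) fun y hy _ => hA0 y (ha.trans hy.le)
      linarith
    have hsmall : ∀ y, 0 ≤ y → y ≤ δ → c * (1 + T) * y ≤ M y := fun y hy hyδ => by
      have := mul_sub_le_sub_of_hasDerivAt hM hy (C := c * (1 + T))
        fun z hz hz' => h4 z hz.le (hz'.le.trans hyδ)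
      rwa [hM0, sub_zero, sub_zero] at this
    have hq1 : c * δ / (4 * 3 ^ k) ≤ c * δ / 4 :=
      div_le_div_of_nonneg_left (by positivity) (by norm_num) (by linarith)
    have hq0 : 0 < c * δ / (4 * 3 ^ k) := by positivity
    -- Three regimes for the lower bound: the steep slope up to δ, the value already reached at δ
    -- while x ≤ T + 1, and the outer slope once x ≥ T + 1.
    rcases le_total x δ with hxδ | hxδ
    · have := hsmall x hx hxδ
      calc c * δ / (4 * 3 ^ k) * (T + x + 1) * x ≤ c * (T + x + 1) * x := by gcongr; linarith
        _ ≤ c * (1 + T) * x * (x + 1) := by nlinarith [mul_nonneg hc.le (mul_nonneg hT (mul_nonneg hx hx))]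
        _ ≤ _ := by gcongr
    · rcases le_total x (T + 1) with hxT | hxT
      · have := (hsmall δ hδ.le le_rfl).trans (hmono δ x hδ.le hxδ)
        calc c * δ / (4 * 3 ^ k) * (T + x + 1) * x ≤ c * δ / 4 * (2 * (T + 1)) * (x + 1) := by
              gcongr <;> linarith
          _ ≤ c * (1 + T) * δ * (x + 1) := by
              have : 0 ≤ c * δ * (1 + T) * (x + 1) := by positivity
              nlinarith
          _ ≤ _ := by gcongr
      -- On [x/2, x] with x ≥ T + 1 the quotient (y+1)/(T+y+1) is at least 1/3, which is the source
      -- of 3^k.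
      · have h5 := mul_sub_le_sub_of_hasDerivAt hM (a := x / 2) (b := x) (by linarith)
          (C := c / 3 ^ k) fun y hy _ => by
            refine le_trans ?_ (h1 y (by linarith))
            rw [div_eq_mul_one_div, ← one_div_pow]
            have h6 : (1 / 3 : ℝ) ≤ (y + 1) / (T + y + 1) := by
              rw [div_le_div_iff₀ (by norm_num) (by linarith)]
              linarith
            gcongr
        have h6 := hmono 0 (x / 2) le_rfl (by linarith)
        rw [hM0] at h6
        have h7 : c / 3 ^ k * (x / 2) ≤ M x := by linarith
        calc c * δ / (4 * 3 ^ k) * (T + x + 1) * x ≤ c / (4 * 3 ^ k) * (2 * x) * (x + 1) := by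
              gcongr <;> linarith
          _ = c / 3 ^ k * (x / 2) * (x + 1) := by field_simp; ring
          _ ≤ _ := by gcongr
  · rcases le_total x 1 with hx1 | hx1
    · have h5 := sub_le_mul_sub_of_hasDerivAt hM hx (C := C * (1 + T)) fun y hy _ => h2 y hy.le
      rw [hM0, sub_zero, sub_zero] at h5
      calc M x * (x + 1) ≤ C * (1 + T) * x * (x + 1) := by gcongr
        _ = C * x * ((1 + T) * (x + 1)) := by ring
        _ ≤ C * x * (2 * (T + x + 1)) := by
            refine mul_le_mul_of_nonneg_left ?_ (by positivity)
            nlinarith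
        _ = _ := by ring
    · have h5 := sub_le_mul_sub_of_hasDerivAt hM zero_le_one (C := C * (1 + T))
        fun y hy _ => h2 y hy.le
      have h6 := sub_le_mul_sub_of_hasDerivAt hM hx1 (C := C) fun y hy _ => h3 y hy
      rw [hM0] at h5
      calc M x * (x + 1) ≤ C * (T + x + 1) * (2 * x) := by
            gcongr
            · nlinarith
            · linarith
        _ = _ := by ring

namespace IsRadialMollifier

lemma reflection_nonneg (hφ : IsRadialMollifier φ) (x ρ : ℝ) : 0 ≤ φ (x - ρ) + φ (x + ρ) :=
  add_nonneg (hφ.nonneg _) (hφ.nonneg _)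

lemma integrableOn_reflection_mul (hφ : IsRadialMollifier φ) {V : ℝ → ℝ} (x : ℝ)
    (hVm : Measurable V) {D : ℝ} (hV : ∀ ρ, 0 < ρ → |V ρ| ≤ D) :
    IntegrableOn (fun ρ => (φ (x - ρ) + φ (x + ρ)) * V ρ) (Ioi 0) := by
  have := hφ.continuous
  exact integrableOn_Ioi_mul x (by fun_prop) (fun ρ h1 h2 => by
    rw [(hφ.reflection_eq_zero h2).1, (hφ.reflection_eq_zero h2).2, add_zero])
    hVm.aestronglyMeasurable fun ρ h1 _ => hV ρ h1

/-- The reflected kernel is a probability density on the half line vanishing beyond x + 1, so an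
average cannot exceed the supremum. -/
lemma integral_reflection_mul_le (hφ : IsRadialMollifier φ) {V : ℝ → ℝ} {x : ℝ} (hx : 0 ≤ x)
    (hVm : Measurable V) {D : ℝ} (hV : ∀ ρ, 0 < ρ → |V ρ| ≤ D) {U : ℝ}
    (hU : ∀ ρ, 0 < ρ → ρ ≤ x + 1 → V ρ ≤ U) :
    ∫ ρ in Ioi 0, (φ (x - ρ) + φ (x + ρ)) * V ρ ≤ U := by
  have h0 : ∫ ρ in Ioi 0, (φ (x - ρ) + φ (x + ρ)) * U = U := by
    rw [integral_mul_const, hφ.integral_add_reflection, one_mul]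
  rw [← h0]
  refine setIntegral_mono_on (hφ.integrableOn_reflection_mul x hVm hV)
    (((hφ.integrable_comp_sub x).add (hφ.integrable_comp_add x)).mul_const U).integrableOn
    measurableSet_Ioi fun ρ hρ => ?_
  by_cases h : ρ ≤ x + 1
  · exact mul_le_mul_of_nonneg_left (hU ρ hρ h) (hφ.reflection_nonneg x ρ)
  · have := hφ.reflection_eq_zero (x := x) (ρ := ρ) (by rw [abs_of_nonneg hx]; linarith)
    rw [this.1, this.2, add_zero, zero_mul, zero_mul]

/-- Only the window [x+δ/2, x+δ] is used: there the kernel is at least m. Its distance from 0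
matters because the strain degenerates at the cavity. -/
lemma le_integral_reflection_mul (hφ : IsRadialMollifier φ) {V : ℝ → ℝ} {x : ℝ} (hx : 0 ≤ x)
    (hVm : Measurable V) {D : ℝ} (hV : ∀ ρ, 0 < ρ → |V ρ| ≤ D) (hV0 : ∀ ρ, 0 < ρ → 0 ≤ V ρ)
    {δ m L : ℝ} (hδ : 0 < δ) (hL : 0 ≤ L) (hm : ∀ y, |y| ≤ δ → m ≤ φ y)
    (hVL : ∀ ρ, x + δ / 2 ≤ ρ → L ≤ V ρ) :
    m * L * (δ / 2) ≤ ∫ ρ in Ioi 0, (φ (x - ρ) + φ (x + ρ)) * V ρ := by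
  have hI := hφ.integrableOn_reflection_mul x hVm hV
  have hsub : Icc (x + δ / 2) (x + δ) ⊆ Ioi 0 := fun ρ hρ => mem_Ioi.2 (by linarith [hρ.1])
  calc m * L * (δ / 2) = ∫ _ρ in Icc (x + δ / 2) (x + δ), m * L := by
        rw [setIntegral_const, Measure.real, Real.volume_Icc,
          show x + δ - (x + δ / 2) = δ / 2 by ring, ENNReal.toReal_ofReal (by positivity),
          smul_eq_mul, mul_comm]
    _ ≤ ∫ ρ in Icc (x + δ / 2) (x + δ), (φ (x - ρ) + φ (x + ρ)) * V ρ := by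
        refine setIntegral_mono_on (integrableOn_const measure_Icc_lt_top.ne) (hI.mono_set hsub)
          measurableSet_Icc fun ρ hρ => ?_
        have h1 : m ≤ φ (x - ρ) := hm _ (abs_le.2 ⟨by linarith [hρ.2], by linarith [hρ.1]⟩)
        exact mul_le_mul (h1.trans (le_add_of_nonneg_right (hφ.nonneg _))) (hVL ρ hρ.1) hL
          (hφ.reflection_nonneg x ρ)
    _ ≤ _ := by
        refine setIntegral_mono_set hI ?_ hsub.eventuallyLE
        filter_upwards [ae_restrict_mem measurableSet_Ioi] with ρ hρ
        exact mul_nonneg (hφ.reflection_nonneg x ρ) (hV0 ρ hρ)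

end IsRadialMollifier

end MollifierBounds

/-! ### The motion mollified at unit scale -/

section Core

variable {d : ℕ} {h : ℝ → ℝ} {lam σ : ℝ} {r φ : ℝ → ℝ}

/-- The amplitude of the self-similar motion, mollified at unit scale. -/
noncomputable def coreAmplitude (φ : ℝ → ℝ) (lam : ℝ) (r : ℝ → ℝ) (x τ : ℝ) : ℝ :=
  oddMollification φ (fun ρ => cavityAmplitude lam r ρ τ) x

/-- The radial strain belonging to `coreAmplitude`. -/
noncomputable def coreStrain (φ : ℝ → ℝ) (lam σ : ℝ) (r : ℝ → ℝ) (x τ : ℝ) : ℝ :=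
  oddMollificationDeriv φ (fun ρ => cavityAmplitude lam r ρ τ) (fun ρ => cavityStrain lam σ r ρ τ) x

namespace IsCavitatingProfile

lemma continuousOn_cavityAmplitude (hr : IsCavitatingProfile d h lam σ r) (τ : ℝ) :
    ContinuousOn (fun ρ => cavityAmplitude lam r ρ τ) (Ici 0) := by
  have hc : Continuous fun s => r (max s 0) :=
    hr.continuousOn.comp_continuous (by fun_prop) fun s => mem_Ici.2 (le_max_right _ _)
  simp only [cavityAmplitude]
  split_ifs with ht
  · fun_prop
  · exact (continuous_const.mul (hc.comp (continuous_id.div_const τ))).continuousOn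

lemma hasDerivAt_cavityAmplitude (hr : IsCavitatingProfile d h lam σ r) {R t : ℝ} (hR : 0 < R)
    (hRt : R ≠ σ * t) :
    HasDerivAt (fun R => cavityAmplitude lam r R t) (cavityStrain lam σ r R t) R := by
  refine (hr.hasDerivAt_amplitude hR hRt).congr_of_eventuallyEq ?_
  filter_upwards [lt_mem_nhds hR] with R hR
  exact cavityAmplitude_eq lam r hR.le t

lemma measurable_slice_cavityStrain (lam σ : ℝ) (r : ℝ → ℝ) (τ : ℝ) :
    Measurable fun ρ => cavityStrain lam σ r ρ τ :=
  (measurable_cavityStrain lam σ r).comp (measurable_id.prodMk measurable_const)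

lemma exists_cavityStrain_bound (hr : IsCavitatingProfile d h lam σ r)
    (hh : IsVolumetricEnergy h) (hlam : 0 < lam) :
    ∃ D, ∀ ρ τ, 0 < ρ → |cavityStrain lam σ r ρ τ| ≤ D := by
  obtain ⟨c, C, hc, hC, -, h2⟩ := hr.exists_field_bounds hh hlam
  refine ⟨C, fun ρ τ hρ => ?_⟩
  have hT : 0 ≤ max τ 0 := le_max_right _ _
  rw [abs_of_pos (hr.cavityStrain_pos hlam hρ τ)]
  refine (h2 ρ τ hρ).2.1.trans (mul_le_of_le_one_right hC.le (pow_le_one₀ (by positivity) ?_))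
  rw [div_le_one (by positivity)]
  linarith

lemma hasDerivAt_coreAmplitude (hr : IsCavitatingProfile d h lam σ r)
    (hh : IsVolumetricEnergy h) (hlam : 0 < lam) (hφ : IsRadialMollifier φ) (x τ : ℝ) :
    HasDerivAt (fun x => coreAmplitude φ lam r x τ) (coreStrain φ lam σ r x τ) x := by
  obtain ⟨D, hD⟩ := hr.exists_cavityStrain_bound hh hlam
  exact hφ.hasDerivAt_oddMollification (countable_singleton (σ * τ))
    (hr.continuousOn_cavityAmplitude τ)
    (fun ρ h1 h2 => hr.hasDerivAt_cavityAmplitude h1 h2)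
    (measurable_slice_cavityStrain lam σ r τ) (fun ρ hρ => hD ρ τ hρ) x

/-- The strain splits into the cavity term 2φ(x)w(0,τ), of order at most max τ 0 and absent for x >
1, and an average of the original strain, which keeps the rate R^{d-1} with R replaced by x + 1. -/
lemma exists_coreStrain_bounds (hr : IsCavitatingProfile d h lam σ r)
    (hh : IsVolumetricEnergy h) (hlam : 0 < lam) (hφ : IsRadialMollifier φ) :
    ∃ c C δ, 0 < c ∧ 0 < C ∧ 0 < δ ∧ δ ≤ 1 ∧ ∀ x τ, 0 ≤ x →
      c * ((x + 1) / (max τ 0 + x + 1)) ^ (d - 1) ≤ coreStrain φ lam σ r x τ ∧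
      coreStrain φ lam σ r x τ ≤ C * (1 + max τ 0) ∧
      (1 < x → coreStrain φ lam σ r x τ ≤ C * ((x + 1) / (max τ 0 + x + 1)) ^ (d - 1)) ∧
      (x ≤ δ → c * (1 + max τ 0) ≤ coreStrain φ lam σ r x τ) := by
  obtain ⟨c, C, hc, hC, h1, h2⟩ := hr.exists_field_bounds hh hlam
  obtain ⟨D, hD⟩ := hr.exists_cavityStrain_bound hh hlam
  obtain ⟨K, hK0, hK, -⟩ := hφ.exists_bound
  obtain ⟨δ, m, hδ, hδ1, hm, hδm⟩ := hφ.exists_pos_near_zero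
  -- The constant from `le_integral_reflection_mul`: kernel height m, strain on the window, window
  -- length δ/2.
  set e := m * (c * (δ / 2) ^ (d - 1)) * (δ / 2) with he
  have he0 : 0 < e := by positivity
  have hemc : e ≤ m * c := by
    have h3 : (δ / 2) ^ (d - 1) ≤ 1 := pow_le_one₀ (by positivity) (by linarith)
    have h4 : (δ / 2) ^ (d - 1) * (δ / 2) ≤ 1 := mul_le_one₀ h3 (by positivity) (by linarith)
    calc e = m * c * ((δ / 2) ^ (d - 1) * (δ / 2)) := by rw [he]; ring
      _ ≤ m * c * 1 := by gcongr
      _ = _ := mul_one _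
  have h2d : (1 : ℝ) ≤ 2 ^ (d - 1) := one_le_pow₀ (by norm_num)
  refine ⟨e / (2 * 2 ^ (d - 1)), 2 * K * C + C, δ / 2, by positivity, by positivity, by positivity,
    by linarith, fun x τ hx => ?_⟩
  have hee : e / (2 * 2 ^ (d - 1)) ≤ e := div_le_self he0.le (by linarith)
  have hstr : coreStrain φ lam σ r x τ = 2 * φ x * cavityAmplitude lam r 0 τ +
    ∫ ρ in Ioi (0 : ℝ), (φ (x - ρ) + φ (x + ρ)) * cavityStrain lam σ r ρ τ := rfl
  have hmeas := measurable_slice_cavityStrain lam σ r τ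
  have hT : 0 ≤ max τ 0 := le_max_right _ _
  obtain ⟨hW1, hW2⟩ := h1 0 τ le_rfl
  rw [add_zero] at hW1 hW2
  have hφx := hφ.nonneg x
  have hW0 : 0 ≤ cavityAmplitude lam r 0 τ := le_trans (by positivity) hW1
  have hI1 : ∫ ρ in Ioi (0 : ℝ), (φ (x - ρ) + φ (x + ρ)) * cavityStrain lam σ r ρ τ ≤
      C * ((x + 1) / (max τ 0 + x + 1)) ^ (d - 1) := by
    refine hφ.integral_reflection_mul_le hx hmeas (fun ρ hρ => hD ρ τ hρ) fun ρ hρ hρx => ?_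
    refine (h2 ρ τ hρ).2.1.trans ?_
    gcongr C * ?_ ^ (d - 1)
    rw [div_le_div_iff₀ (by positivity) (by positivity)]
    nlinarith
  have hI2 : e * ((x + 1) / (max τ 0 + x + 1)) ^ (d - 1) ≤
      ∫ ρ in Ioi (0 : ℝ), (φ (x - ρ) + φ (x + ρ)) * cavityStrain lam σ r ρ τ := by
    have := hφ.le_integral_reflection_mul hx hmeas (fun ρ hρ => hD ρ τ hρ)
      (fun ρ hρ => (hr.cavityStrain_pos hlam hρ τ).le) hδ
      (L := c * (δ / 2 * ((x + 1) / (max τ 0 + x + 1))) ^ (d - 1)) (by positivity) hδm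
      fun ρ hρ => by
        have hρ0 : 0 < ρ := by linarith
        refine le_trans ?_ (h2 ρ τ hρ0).1
        gcongr c * ?_ ^ (d - 1)
        rw [← mul_div_assoc, div_le_div_iff₀ (by positivity) (by positivity)]
        have h3 : δ / 2 * (x + 1) ≤ ρ := by nlinarith
        have h4 : δ / 2 * (x + 1) ≤ x + 1 := by nlinarith
        nlinarith [mul_le_mul_of_nonneg_right h3 hT, mul_le_mul_of_nonneg_right h4 hρ0.le]
    refine le_trans (le_of_eq ?_) this
    rw [he, mul_pow]
    ring
  have hk0 : 0 ≤ (x + 1) / (max τ 0 + x + 1) := by positivity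
  have hk1 : (x + 1) / (max τ 0 + x + 1) ≤ 1 := by
    rw [div_le_one (by positivity)]
    linarith
  have hk2 : 1 / (1 + max τ 0) ≤ (x + 1) / (max τ 0 + x + 1) := by
    rw [div_le_div_iff₀ (by positivity) (by positivity)]
    nlinarith
  rw [hstr]
  generalize (x + 1) / (max τ 0 + x + 1) = k at *
  generalize ∫ ρ in Ioi (0 : ℝ), (φ (x - ρ) + φ (x + ρ)) * cavityStrain lam σ r ρ τ = I at *
  generalize max τ 0 = T at *
  generalize cavityAmplitude lam r 0 τ = W at *
  have hkd0 : 0 ≤ k ^ (d - 1) := pow_nonneg hk0 _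
  have hkd1 : k ^ (d - 1) ≤ 1 := pow_le_one₀ hk0 hk1
  have hφW : 0 ≤ 2 * φ x * W := by positivity
  refine ⟨?_, ?_, fun hx1 => ?_, fun hxδ => ?_⟩
  · calc _ ≤ e * k ^ (d - 1) := by gcongr
      _ ≤ _ := by linarith
  · have h3 : 2 * φ x * W ≤ 2 * K * (C * T) := by
      have := hK x
      gcongr
    have h4 : C * k ^ (d - 1) ≤ C := mul_le_of_le_one_right hC.le hkd1
    nlinarith [mul_nonneg hK0.le hC.le, mul_nonneg hC.le hT]
  · rw [hφ.eq_zero_of_one_lt (by rwa [abs_of_nonneg hx]), mul_zero, zero_mul, zero_add]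
    refine hI1.trans ?_
    gcongr
    nlinarith [mul_nonneg hK0.le hC.le]
  · have hmx : m ≤ φ x := hδm x (by rw [abs_of_nonneg hx]; linarith)
    -- For T ≤ 1 the averaged strain is already bounded below; for T ≥ 1 the cavity term supplies
    -- the growth in T.
    rcases le_total T 1 with hT1 | hT1
    · have h3 : (1 / 2 : ℝ) ≤ k := by
        refine le_trans ?_ hk2
        gcongr
        linarith
      have h4 : (1 / 2 : ℝ) ^ (d - 1) ≤ k ^ (d - 1) := by gcongr
      calc e / (2 * 2 ^ (d - 1)) * (1 + T) ≤ e / (2 * 2 ^ (d - 1)) * 2 := by gcongr; linarith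
        _ = e * (1 / 2) ^ (d - 1) := by rw [one_div_pow]; field_simp
        _ ≤ e * k ^ (d - 1) := by gcongr
        _ ≤ _ := by linarith
    · have h3 : 2 * m * (c * T) ≤ 2 * φ x * W := by gcongr
      have h4 : 0 ≤ I := le_trans (by positivity) hI2
      calc e / (2 * 2 ^ (d - 1)) * (1 + T) ≤ m * c * (2 * T) := by
            gcongr
            · exact hee.trans hemc
            · linarith
        _ ≤ _ := by linarith

/-- Bounds for the motion mollified at unit scale. -/
lemma exists_core_bounds (hr : IsCavitatingProfile d h lam σ r)
    (hh : IsVolumetricEnergy h) (hlam : 0 < lam) (hφ : IsRadialMollifier φ) :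
    ∃ c C δ, 0 < c ∧ 0 < C ∧ 0 < δ ∧ δ ≤ 1 ∧ ∀ x τ, 0 ≤ x →
      c * ((x + 1) / (max τ 0 + x + 1)) ^ (d - 1) ≤ coreStrain φ lam σ r x τ ∧
      coreStrain φ lam σ r x τ ≤ C * (1 + max τ 0) ∧
      (1 < x → coreStrain φ lam σ r x τ ≤ C * ((x + 1) / (max τ 0 + x + 1)) ^ (d - 1)) ∧
      (x ≤ δ → c * (1 + max τ 0) ≤ coreStrain φ lam σ r x τ) ∧
      c * (max τ 0 + x + 1) * x ≤ coreAmplitude φ lam r x τ * (x + 1) ∧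
      coreAmplitude φ lam r x τ * (x + 1) ≤ C * (max τ 0 + x + 1) * x := by
  obtain ⟨c, C, δ, hc, hC, hδ, hδ1, hb⟩ := hr.exists_coreStrain_bounds hh hlam hφ
  have h3k : (1 : ℝ) ≤ 3 ^ (d - 1) := one_le_pow₀ (by norm_num)
  have hc' : c * δ / (4 * 3 ^ (d - 1)) ≤ c := by
    rw [div_le_iff₀ (by positivity)]
    nlinarith
  refine ⟨c * δ / (4 * 3 ^ (d - 1)), 2 * C, δ, by positivity, by positivity, hδ, hδ1,
    fun x τ hx => ?_⟩
  have hT : 0 ≤ max τ 0 := le_max_right _ _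
  obtain ⟨h1, h2, h3, h4⟩ := hb x τ hx
  obtain ⟨h5, h6⟩ := linear_bounds_of_hasDerivAt (M := fun x => coreAmplitude φ lam r x τ) hT hc hδ
    hδ1 (fun x => hr.hasDerivAt_coreAmplitude hh hlam hφ x τ) (oddMollification_zero hφ _)
    (fun x hx => (hb x τ hx).1) (fun x hx => (hb x τ hx).2.1)
    (fun x hx => ((hb x τ (by linarith)).2.2.1 hx).trans
      (mul_le_of_le_one_right hC.le (pow_le_one₀ (div_nonneg (by linarith) (by linarith))
        ((div_le_one (by linarith)).2 (by linarith)))))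
    (fun x hx hx' => (hb x τ hx).2.2.2 hx') hx
  refine ⟨le_trans ?_ h1, h2.trans ?_, fun hx1 => (h3 hx1).trans ?_, fun hxδ => le_trans ?_ (h4 hxδ),
    h5, h6⟩
  · gcongr
  · gcongr
    linarith
  · gcongr
    linarith
  · gcongr

end IsCavitatingProfile

end Core

/-! ### Self-similarity and convergence of the mollified motions -/

section Scaling

variable {d : ℕ} {h : ℝ → ℝ} {lam σ : ℝ} {r φ : ℝ → ℝ}

/-- Homogeneity of degree one is what reduces mollification at scale 1/n to unit scale. -/
lemma cavityAmplitude_mul (lam : ℝ) (r : ℝ → ℝ) {k : ℝ} (hk : 0 < k) (R t : ℝ) :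
    cavityAmplitude lam r (k * R) (k * t) = k * cavityAmplitude lam r R t := by
  have hkt : k * t ≤ 0 ↔ t ≤ 0 := ⟨fun h => nonpos_of_mul_nonpos_right h hk,
    mul_nonpos_of_nonneg_of_nonpos hk.le⟩
  simp only [cavityAmplitude, hkt, mul_div_mul_left _ _ hk.ne']
  split_ifs <;> ring

lemma cavityStrain_mul (lam σ : ℝ) (r : ℝ → ℝ) {k : ℝ} (hk : 0 < k) (R t : ℝ) :
    cavityStrain lam σ r (k * R) (k * t) = cavityStrain lam σ r R t := by
  have hkt : k * t ≤ 0 ↔ t ≤ 0 := ⟨fun h => nonpos_of_mul_nonpos_right h hk,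
    mul_nonpos_of_nonneg_of_nonpos hk.le⟩
  simp only [cavityStrain, hkt, mul_div_mul_left _ _ hk.ne']

namespace IsCavitatingProfile

lemma measurable_slice_cavityAmplitude (hr : IsCavitatingProfile d h lam σ r) (τ : ℝ) :
    Measurable fun ρ => cavityAmplitude lam r ρ τ :=
  hr.measurable_cavityAmplitude.comp (measurable_id.prodMk measurable_const)

lemma integrableOn_mul_cavityAmplitude (hr : IsCavitatingProfile d h lam σ r) {g : ℝ → ℝ}
    (hg : Continuous g) (x : ℝ) (hg0 : ∀ ρ, 0 < ρ → |x| + 1 < ρ → g ρ = 0) (τ : ℝ) :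
    IntegrableOn (fun ρ => g ρ * cavityAmplitude lam r ρ τ) (Ioi 0) := by
  obtain ⟨E, hE⟩ := (isCompact_Icc (a := (0 : ℝ)) (b := |x| + 1)).exists_bound_of_continuousOn
    ((hr.continuousOn_cavityAmplitude τ).mono Icc_subset_Ici_self)
  exact integrableOn_Ioi_mul x hg hg0 (hr.measurable_slice_cavityAmplitude τ).aestronglyMeasurable
    fun ρ h1 h2 => hE ρ ⟨h1.le, h2⟩

/-- Substitute nρ for ρ and use the homogeneity of w; all dependence on n then sits in the arguments
and the factor 1/n. -/
lemma mollifiedAmplitude_eq (hr : IsCavitatingProfile d h lam σ r) (hφ : IsRadialMollifier φ)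
    {n : ℕ} (hn : 1 ≤ n) (R t : ℝ) :
    mollifiedAmplitude φ n (selfSimilarAmplitude lam r) R t =
      coreAmplitude φ lam r (n * R) (n * t) / n := by
  have hn0 : (0 : ℝ) < n := by exact_mod_cast hn
  have hφc := hφ.continuous
  have hscale : ∀ g : ℝ → ℝ, ∫ ρ in Ioi (0 : ℝ), n * g (n * ρ) * selfSimilarAmplitude lam r ρ t =
      (∫ ρ in Ioi (0 : ℝ), g ρ * cavityAmplitude lam r ρ (n * t)) / n := fun g => by
    have h1 := integral_comp_mul_left_Ioi
      (fun ρ => g ρ * cavityAmplitude lam r ρ (n * t)) 0 hn0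
    rw [mul_zero, smul_eq_mul] at h1
    rw [div_eq_inv_mul, ← h1]
    refine setIntegral_congr_fun measurableSet_Ioi fun ρ hρ => ?_
    rw [cavityAmplitude_mul lam r hn0, cavityAmplitude_eq lam r (le_of_lt hρ)]
    ring
  have h1 := hscale fun ρ => φ (n * R - ρ)
  have h2 := hscale fun ρ => φ (n * R + ρ)
  simp only [← mul_sub, ← mul_add] at h1 h2
  rw [mollifiedAmplitude, h1, h2, ← sub_div, ← integral_sub, coreAmplitude, oddMollification]
  · simp only [sub_mul]
  · exact hr.integrableOn_mul_cavityAmplitude (by fun_prop) (n * R)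
      (fun ρ _ h => (hφ.reflection_eq_zero h).1) _
  · exact hr.integrableOn_mul_cavityAmplitude (by fun_prop) (n * R)
      (fun ρ _ h => (hφ.reflection_eq_zero h).2) _

lemma hasDerivAt_mollifiedAmplitude (hr : IsCavitatingProfile d h lam σ r)
    (hh : IsVolumetricEnergy h) (hlam : 0 < lam) (hφ : IsRadialMollifier φ) {n : ℕ} (hn : 1 ≤ n)
    (R t : ℝ) :
    HasDerivAt (fun R => mollifiedAmplitude φ n (selfSimilarAmplitude lam r) R t)
      (coreStrain φ lam σ r (n * R) (n * t)) R := by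
  have hn0 : (0 : ℝ) < n := by exact_mod_cast hn
  simp only [hr.mollifiedAmplitude_eq hφ hn]
  have h1 := hr.hasDerivAt_coreAmplitude hh hlam hφ (n * R) (n * t)
  have h2 : HasDerivAt (fun R : ℝ => n * R) (n : ℝ) R := by
    simpa using (hasDerivAt_id R).const_mul (n : ℝ)
  refine ((HasDerivAt.comp R h1 h2).div_const (n : ℝ)).congr_deriv ?_
  field_simp

lemma measurable_coreAmplitude (hr : IsCavitatingProfile d h lam σ r)
    (hφ : IsRadialMollifier φ) : Measurable (Function.uncurry (coreAmplitude φ lam r)) := by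
  have hφc := hφ.continuous
  have h1 : Measurable fun p : (ℝ × ℝ) × ℝ =>
      (φ (p.1.1 - p.2) - φ (p.1.1 + p.2)) * cavityAmplitude lam r p.2 p.1.2 :=
    (by fun_prop : Continuous fun p : (ℝ × ℝ) × ℝ =>
      φ (p.1.1 - p.2) - φ (p.1.1 + p.2)).measurable.mul
      (hr.measurable_cavityAmplitude.comp (measurable_snd.prodMk (measurable_snd.comp measurable_fst)))
  exact (h1.stronglyMeasurable.integral_prod_right' (ν := volume.restrict (Ioi 0))).measurable

lemma measurable_coreStrain (hr : IsCavitatingProfile d h lam σ r)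
    (hφ : IsRadialMollifier φ) : Measurable (Function.uncurry (coreStrain φ lam σ r)) := by
  have hφc := hφ.continuous
  have h1 : Measurable fun p : (ℝ × ℝ) × ℝ =>
      (φ (p.1.1 - p.2) + φ (p.1.1 + p.2)) * cavityStrain lam σ r p.2 p.1.2 :=
    (by fun_prop : Continuous fun p : (ℝ × ℝ) × ℝ =>
      φ (p.1.1 - p.2) + φ (p.1.1 + p.2)).measurable.mul
      ((measurable_cavityStrain lam σ r).comp
        (measurable_snd.prodMk (measurable_snd.comp measurable_fst)))
  have h2 := (h1.stronglyMeasurable.integral_prod_right' (ν := volume.restrict (Ioi 0))).measurable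
  have h3 : Measurable fun p : ℝ × ℝ => 2 * φ p.1 * cavityAmplitude lam r 0 p.2 :=
    (by fun_prop : Continuous fun p : ℝ × ℝ => 2 * φ p.1).measurable.mul
      (hr.measurable_cavityAmplitude.comp (measurable_const.prodMk measurable_snd))
  exact h3.add h2

end IsCavitatingProfile

/-- An approximate identity in the variable nρ. Once nR > 1 the kernel no longer reaches the axis
and has full mass on the half line. -/
lemma IsRadialMollifier.tendsto_integral_comp_div (hφ : IsRadialMollifier φ) {g : ℝ → ℝ}
    (hg : Measurable g) {R : ℝ} (hR : 0 < R) (hgR : ContinuousAt g R) :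
    Tendsto (fun n : ℕ => ∫ ρ in Ioi 0, φ (n * R - ρ) * g (ρ / n)) atTop (𝓝 (g R)) := by
  have hφc := hφ.continuous
  rw [Metric.tendsto_nhds]
  intro ε hε
  obtain ⟨δ, hδ, hgδ⟩ := Metric.continuousAt_iff.1 hgR (ε / 2) (half_pos hε)
  filter_upwards [(tendsto_natCast_atTop_atTop (R := ℝ)).eventually_gt_atTop (max R⁻¹ δ⁻¹)] with n hn
  have hn1 : R⁻¹ < n := (le_max_left _ _).trans_lt hn
  have hn2 : δ⁻¹ < n := (le_max_right _ _).trans_lt hn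
  have hn0 : (0 : ℝ) < n := (inv_pos.2 hR).trans hn1
  have hnR : 1 < n * R := by rwa [inv_lt_iff_one_lt_mul₀ hR] at hn1
  have hb : ∀ ρ, |φ (n * R - ρ) * (g (ρ / n) - g R)| ≤ ε / 2 * φ (n * R - ρ) := fun ρ => by
    rw [abs_mul, abs_of_nonneg (hφ.nonneg _), mul_comm]
    by_cases h : |n * R - ρ| ≤ 1
    · refine mul_le_mul_of_nonneg_right (hgδ ?_).le (hφ.nonneg _)
      rw [Real.dist_eq, show ρ / n - R = -(n * R - ρ) / n by field_simp; ring, abs_div, abs_neg,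
        abs_of_pos hn0]
      calc _ ≤ 1 / (n : ℝ) := by gcongr
        _ < δ := by rwa [one_div, inv_lt_comm₀ hn0 hδ]
    · rw [hφ.eq_zero_of_one_lt (not_le.1 h), mul_zero, mul_zero]
  have hint : Integrable (fun ρ => ε / 2 * φ (n * R - ρ)) (volume.restrict (Ioi 0)) :=
    ((hφ.integrable_comp_sub (n * R)).const_mul _).integrableOn
  have hint1 : Integrable (fun ρ => φ (n * R - ρ) * (g (ρ / n) - g R)) (volume.restrict (Ioi 0)) :=
    hint.mono' ((by fun_prop : Measurable fun ρ => φ (n * R - ρ)).mul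
      ((hg.comp (measurable_id.div_const _)).sub_const _)).aestronglyMeasurable
      (Eventually.of_forall hb)
  have hint2 : Integrable (fun ρ => φ (n * R - ρ) * g R) (volume.restrict (Ioi 0)) :=
    ((hφ.integrable_comp_sub (n * R)).mul_const _).integrableOn
  have h1 : ∫ ρ in Ioi 0, φ (n * R - ρ) * g (ρ / n) =
      (∫ ρ in Ioi 0, φ (n * R - ρ) * (g (ρ / n) - g R)) + g R := by
    have h2 : ∫ ρ in Ioi 0, φ (n * R - ρ) * g R = g R := by
      rw [integral_mul_const, hφ.integral_comp_sub hnR, one_mul]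
    refine Eq.trans ?_ (congrArg (fun z => (∫ ρ in Ioi 0, φ (n * R - ρ) * (g (ρ / n) - g R)) + z) h2)
    rw [← integral_add hint1 hint2]
    refine integral_congr_ae (Eventually.of_forall fun ρ => ?_)
    simp only
    ring
  rw [h1, Real.dist_eq, add_sub_cancel_right]
  refine (norm_integral_le_of_norm_le hint
    (f := fun ρ => φ (n * R - ρ) * (g (ρ / n) - g R)) (Eventually.of_forall hb)).trans_lt ?_
  rw [integral_const_mul, hφ.integral_comp_sub hnR, mul_one]
  exact half_lt_self hε

namespace IsCavitatingProfile

lemma tendsto_coreAmplitude (hr : IsCavitatingProfile d h lam σ r) (hφ : IsRadialMollifier φ)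
    {R t : ℝ} (hR : 0 < R) (hRt : R ≠ σ * t) :
    Tendsto (fun n : ℕ => coreAmplitude φ lam r (n * R) (n * t) / n) atTop
      (𝓝 (cavityAmplitude lam r R t)) := by
  refine (hφ.tendsto_integral_comp_div (hr.measurable_slice_cavityAmplitude t) hR
    (hr.hasDerivAt_cavityAmplitude hR hRt).continuousAt).congr' ?_
  filter_upwards [(tendsto_natCast_atTop_atTop (R := ℝ)).eventually_gt_atTop R⁻¹] with n hn
  have hn0 : (0 : ℝ) < n := (inv_pos.2 hR).trans hn
  have hnR : 1 < n * R := by rwa [inv_lt_iff_one_lt_mul₀ hR] at hn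
  rw [coreAmplitude, oddMollification, ← integral_div]
  refine setIntegral_congr_fun measurableSet_Ioi fun ρ hρ => ?_
  have hρ : 0 < ρ := hρ
  have h1 := cavityAmplitude_mul lam r hn0 (ρ / n) t
  rw [mul_div_cancel₀ _ hn0.ne'] at h1
  rw [hφ.eq_zero_of_one_lt (x := n * R + ρ) (by rw [abs_of_pos] <;> linarith), sub_zero, h1]
  field_simp

lemma continuousAt_cavityStrain (hr : IsCavitatingProfile d h lam σ r) {R t : ℝ} (hR : 0 < R)
    (hRt : R ≠ σ * t) : ContinuousAt (fun R => cavityStrain lam σ r R t) R := by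
  simp only [cavityStrain]
  split_ifs with ht
  · exact continuousAt_const
  · have ht0 : 0 < t := not_le.1 ht
    have hne : R / t ≠ σ := fun h => hRt ((div_eq_iff ht0.ne').1 h)
    have h1 : ContinuousAt (fun R => deriv r (R / t)) R :=
      ContinuousAt.comp (g := deriv r) (hr.continuousAt_deriv (div_pos hR ht0) hne)
        (continuous_id.div_const t).continuousAt
    refine h1.congr ?_
    have h2 : ∀ᶠ R in 𝓝 R, R / t ≠ σ :=
      (continuous_id.div_const t).continuousAt.eventually_ne hne
    filter_upwards [h2] with R h2
    rw [if_neg h2]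

lemma tendsto_coreStrain (hr : IsCavitatingProfile d h lam σ r) (hφ : IsRadialMollifier φ)
    {R t : ℝ} (hR : 0 < R) (hRt : R ≠ σ * t) :
    Tendsto (fun n : ℕ => coreStrain φ lam σ r (n * R) (n * t)) atTop
      (𝓝 (cavityStrain lam σ r R t)) := by
  refine (hφ.tendsto_integral_comp_div (measurable_slice_cavityStrain lam σ r t) hR
    (hr.continuousAt_cavityStrain hR hRt)).congr' ?_
  filter_upwards [(tendsto_natCast_atTop_atTop (R := ℝ)).eventually_gt_atTop R⁻¹] with n hn
  have hn0 : (0 : ℝ) < n := (inv_pos.2 hR).trans hn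
  have hnR : 1 < n * R := by rwa [inv_lt_iff_one_lt_mul₀ hR] at hn
  -- Beyond the core both the cavity term and the reflected kernel vanish.
  rw [coreStrain, oddMollificationDeriv,
    hφ.eq_zero_of_one_lt (x := n * R) (by rw [abs_of_pos] <;> linarith), mul_zero, zero_mul, zero_add]
  refine setIntegral_congr_fun measurableSet_Ioi fun ρ hρ => ?_
  have hρ : 0 < ρ := hρ
  have h1 := cavityStrain_mul lam σ r hn0 (ρ / n) t
  rw [mul_div_cancel₀ _ hn0.ne'] at h1
  rw [hφ.eq_zero_of_one_lt (x := n * R + ρ) (by rw [abs_of_pos] <;> linarith), add_zero, h1]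

end IsCavitatingProfile

end Scaling

/-! ### Strains and stresses of the mollified motions -/

section CoreStress

variable {d : ℕ} {h : ℝ → ℝ} {lam σ : ℝ} {r φ : ℝ → ℝ}

/-- The radial stress of the motion mollified at unit scale. -/
noncomputable def coreRadialStress (d : ℕ) (h φ : ℝ → ℝ) (lam σ : ℝ) (r : ℝ → ℝ) (x τ : ℝ) : ℝ :=
  radialStress d h (coreStrain φ lam σ r x τ) (coreAmplitude φ lam r x τ / x)

/-- The hoop stress of the motion mollified at unit scale. -/
noncomputable def coreHoopStress (d : ℕ) (h φ : ℝ → ℝ) (lam σ : ℝ) (r : ℝ → ℝ) (x τ : ℝ) : ℝ :=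
  hoopStress d h (coreStrain φ lam σ r x τ) (coreAmplitude φ lam r x τ / x)

/-- The growth of the stresses of the mollified motion in the core. -/
noncomputable def coreStressBound (d : ℕ) (h : ℝ → ℝ) (c V : ℝ) : ℝ :=
  V + V ^ (d - 1) * (|deriv h c| + |deriv h (V ^ d)|)

/-- Inside the core the radial strain is no longer small where the hoop strain is large, so the
Jacobian is bounded only by V^d; this is how h'(V^d) enters. -/
lemma abs_stress_le_coreStressBound (hh : IsVolumetricEnergy h) (hd : 2 ≤ d) {c A B V : ℝ}
    (hc : 0 < c) (hA : 0 < A) (hB : 0 < B) (hAV : A ≤ V) (hBV : B ≤ V)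
    (hdet : c ≤ A * B ^ (d - 1)) :
    |radialStress d h A B| ≤ coreStressBound d h c V ∧
      |hoopStress d h A B| ≤ coreStressBound d h c V := by
  have hV : 0 < V := hA.trans_le hAV
  have hdet2 : A * B ^ (d - 1) ≤ V ^ d := by
    calc A * B ^ (d - 1) ≤ V * V ^ (d - 1) := by gcongr
      _ = V ^ d := by rw [← pow_succ', Nat.sub_add_cancel (by omega)]
  have h1 := hh.abs_deriv_le hc hdet hdet2
  have hAB : A * B ^ (d - 2) ≤ V ^ (d - 1) := by
    calc A * B ^ (d - 2) ≤ V * V ^ (d - 2) := by gcongr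
      _ = V ^ (d - 1) := by rw [← pow_succ', show d - 2 + 1 = d - 1 by omega]
  constructor
  · rw [radialStress, coreStressBound]
    refine (abs_add_le _ _).trans ?_
    rw [abs_mul, abs_of_pos hA, abs_of_pos (by positivity : 0 < B ^ (d - 1))]
    gcongr
  · rw [hoopStress, coreStressBound]
    refine (abs_add_le _ _).trans ?_
    rw [abs_mul, abs_of_pos hB, abs_of_pos (by positivity : 0 < A * B ^ (d - 2))]
    gcongr

namespace IsCavitatingProfile

lemma measurable_coreRadialStress (hr : IsCavitatingProfile d h lam σ r)
    (hφ : IsRadialMollifier φ) : Measurable (Function.uncurry (coreRadialStress d h φ lam σ r)) :=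
  measurable_radialStress (hr.measurable_coreStrain hφ)
    ((hr.measurable_coreAmplitude hφ).div measurable_fst)

lemma measurable_coreHoopStress (hr : IsCavitatingProfile d h lam σ r)
    (hφ : IsRadialMollifier φ) : Measurable (Function.uncurry (coreHoopStress d h φ lam σ r)) :=
  measurable_hoopStress (hr.measurable_coreStrain hφ)
    ((hr.measurable_coreAmplitude hφ).div measurable_fst)

/-- Bounds for the principal strains of the motion mollified at unit scale. -/
lemma exists_core_field_bounds (hr : IsCavitatingProfile d h lam σ r)
    (hh : IsVolumetricEnergy h) (hlam : 0 < lam) (hd : 1 ≤ d) (hφ : IsRadialMollifier φ) :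
    ∃ c C δ, 0 < c ∧ 0 < C ∧ 0 < δ ∧ δ ≤ 1 ∧ (∀ τ, c ≤ coreStrain φ lam σ r 0 τ ^ d) ∧
      ∀ x τ, 0 < x → 0 < coreStrain φ lam σ r x τ ∧ 0 < coreAmplitude φ lam r x τ ∧
        c ≤ coreStrain φ lam σ r x τ * (coreAmplitude φ lam r x τ / x) ^ (d - 1) ∧
        coreStrain φ lam σ r x τ ≤ C * (1 + max τ 0) ∧
        coreAmplitude φ lam r x τ / x ≤ C * (1 + max τ 0) ∧
        (coreAmplitude φ lam r x τ / x) * ((x + 1) / (max τ 0 + x + 1)) ≤ C ∧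
        (1 < x → coreStrain φ lam σ r x τ ≤ C * ((x + 1) / (max τ 0 + x + 1)) ^ (d - 1)) ∧
        (x ≤ δ → c * (1 + max τ 0) ≤ coreStrain φ lam σ r x τ ∧
          c * (1 + max τ 0) ≤ coreAmplitude φ lam r x τ / x) := by
  obtain ⟨c, C, δ, hc, hC, hδ, hδ1, hb⟩ := hr.exists_core_bounds hh hlam hφ
  have hcd : c * c ^ (d - 1) = c ^ d := by
    rw [← pow_succ', Nat.sub_add_cancel hd]
  -- The power c^d serves the determinant; c/2 serves the hoop strain, since (T+x+1)/(x+1) ≥ (1+T)/2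
  -- for x ≤ 1.
  refine ⟨min (c / 2) (c ^ d), C, δ, by positivity, hC, hδ, hδ1, fun τ => ?_, fun x τ hx => ?_⟩
  · have hT : 0 ≤ max τ 0 := le_max_right _ _
    refine (min_le_right _ _).trans (pow_le_pow_left₀ hc.le ?_ d)
    refine le_trans ?_ ((hb 0 τ le_rfl).2.2.2.1 hδ.le)
    nlinarith
  · have hT : 0 ≤ max τ 0 := le_max_right _ _
    obtain ⟨h1, h2, h3, h4, h5, h6⟩ := hb x τ hx.le
    have hmin : min (c / 2) (c ^ d) * (1 + max τ 0) ≤ c / 2 * (1 + max τ 0) := by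
      gcongr
      exact min_le_left _ _
    generalize coreStrain φ lam σ r x τ = A at *
    generalize coreAmplitude φ lam r x τ = M at *
    generalize max τ 0 = T at *
    set k := (x + 1) / (T + x + 1) with hk
    have hk0 : 0 < k := by positivity
    have hA : 0 < A := lt_of_lt_of_le (by positivity) h1
    have hB1 : c / k ≤ M / x := by
      rw [hk, div_div_eq_mul_div, div_le_div_iff₀ (by positivity) hx]
      exact h5
    have hB2 : M / x * k ≤ C := by
      rw [hk, div_mul_div_comm, div_le_iff₀ (by positivity)]
      linarith
    have hB0 : 0 < M / x := lt_of_lt_of_le (by positivity) hB1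
    have hM : 0 < M := by
      have := mul_pos hB0 hx
      rwa [div_mul_cancel₀ _ hx.ne'] at this
    refine ⟨hA, hM, (min_le_right _ _).trans ?_, h2, ?_, hB2, h3, fun hxδ =>
      ⟨hmin.trans (le_trans ?_ (h4 hxδ)), hmin.trans (le_trans ?_ hB1)⟩⟩
    -- The smallness k^{d-1} of the radial strain is exactly compensated by the hoop strain, which
    -- is at least c/k.
    · calc c ^ d = c * k ^ (d - 1) * (c / k) ^ (d - 1) := by
            rw [← hcd, mul_assoc, ← mul_pow, mul_div_cancel₀ _ hk0.ne']
        _ ≤ _ := by gcongr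
    · calc M / x ≤ C / k := (le_div_iff₀ hk0).2 hB2
        _ ≤ C * (1 + T) := by
          rw [div_le_iff₀ hk0, mul_assoc]
          refine le_mul_of_one_le_right hC.le ?_
          rw [hk, ← mul_div_assoc, one_le_div (by positivity)]
          nlinarith
    · nlinarith
    · rw [hk, div_div_eq_mul_div, div_mul_eq_mul_div, div_le_div_iff₀ (by positivity) (by positivity)]
      have : x ≤ 1 := hxδ.trans hδ1
      nlinarith [mul_nonneg hc.le hT, mul_nonneg hc.le (mul_nonneg hT hx.le), mul_nonneg hc.le hx.le]

/-- For nR > 1 the mollified strains satisfy the hypotheses of `exists_stress_bound` with k =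
(nR+1)/(max(nt) 0 + nR + 1), and R ≤ k(|t|+R) turns k back into R uniformly in n. -/
lemma exists_core_stress_bound (hr : IsCavitatingProfile d h lam σ r)
    (hh : IsVolumetricEnergy h) (hlam : 0 < lam) (hd : 2 ≤ d) (hφ : IsRadialMollifier φ) :
    ∃ K, 0 ≤ K ∧ ∀ R t : ℝ, ∀ n : ℕ, 0 < R → 1 < n * R →
      |coreRadialStress d h φ lam σ r (n * R) (n * t)| * R ^ (d - 1) ≤ K * (|t| + R) ^ (d - 1) ∧
      |coreHoopStress d h φ lam σ r (n * R) (n * t)| * R ^ (d - 1) ≤ K * (|t| + R) ^ (d - 1) ∧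
      |coreAmplitude φ lam r (n * R) (n * t) / n| ≤ K * (|t| + R) := by
  obtain ⟨c, C, δ, hc, hC, hδ, hδ1, -, hb⟩ :=
    hr.exists_core_field_bounds hh hlam (by omega) hφ
  obtain ⟨K, hK0, hK⟩ := exists_stress_bound hh hd (C := C) hc
  refine ⟨K + C, by positivity, fun R t n hR hnR => ?_⟩
  have hT : 0 ≤ max ((n : ℝ) * t) 0 := le_max_right _ _
  have hn0 : (0 : ℝ) < n := by
    by_contra! hcon
    nlinarith
  have hTt : max ((n : ℝ) * t) 0 ≤ n * |t| :=
    max_le (mul_le_mul_of_nonneg_left (le_abs_self t) hn0.le) (by positivity)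
  obtain ⟨h1, h2, h3, -, -, h6, h7, -⟩ := hb (n * R) (n * t) (by positivity)
  set T := max ((n : ℝ) * t) 0
  set k := (n * R + 1) / (T + n * R + 1) with hk
  have hk0 : 0 < k := by positivity
  have hk1 : k ≤ 1 := by
    rw [hk, div_le_one (by positivity)]
    linarith
  have hkR : R ≤ k * (|t| + R) := by
    rw [hk, div_mul_eq_mul_div, le_div_iff₀ (by positivity)]
    nlinarith [abs_nonneg t]
  have h8 := hK k _ _ hk0 hk1 h1.le (h7 hnR) (div_pos h2 (by positivity)).le h6 h3
  have key : ∀ S : ℝ, S * k ^ (d - 1) ≤ K → 0 ≤ S → S * R ^ (d - 1) ≤ (K + C) * (|t| + R) ^ (d - 1) :=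
    fun S hS hS0 => by
      calc S * R ^ (d - 1) ≤ S * (k * (|t| + R)) ^ (d - 1) := by gcongr
        _ = S * k ^ (d - 1) * (|t| + R) ^ (d - 1) := by rw [mul_pow, mul_assoc]
        _ ≤ (K + C) * (|t| + R) ^ (d - 1) := by
            gcongr
            exact hS.trans (le_add_of_nonneg_right hC.le)
  refine ⟨key _ h8.1 (abs_nonneg _), key _ h8.2 (abs_nonneg _), ?_⟩
  rw [abs_of_pos (by positivity)]
  set B := coreAmplitude φ lam r (n * R) (n * t) / (n * R) with hB
  have hB0 : 0 < B := by positivity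
  calc coreAmplitude φ lam r (n * R) (n * t) / n = B * R := by
        rw [hB]
        field_simp
    _ ≤ B * (k * (|t| + R)) := by gcongr
    _ = B * k * (|t| + R) := by ring
    _ ≤ (K + C) * (|t| + R) := by
        gcongr
        exact h6.trans (le_add_of_nonneg_left hK0)

lemma momentumIntegrand_mollified (hr : IsCavitatingProfile d h lam σ r)
    (hh : IsVolumetricEnergy h) (hlam : 0 < lam) (hd : 2 ≤ d) (hφ : IsRadialMollifier φ)
    (ψ : EuclideanSpace ℝ (Fin d) × ℝ → EuclideanSpace ℝ (Fin d)) {n : ℕ} (hn : 1 ≤ n)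
    {x : EuclideanSpace ℝ (Fin d)} (hx : x ≠ 0) (t : ℝ) :
    momentumIntegrand h (radialMotion d (mollifiedAmplitude φ n (selfSimilarAmplitude lam r))) ψ x t =
      radialIntegrand ψ (coreAmplitude φ lam r (n * ‖x‖) (n * t) / n)
        (coreRadialStress d h φ lam σ r (n * ‖x‖) (n * t))
        (coreHoopStress d h φ lam σ r (n * ‖x‖) (n * t)) x t := by
  obtain ⟨c, C, δ, hc, -, -, -, -, hb⟩ := hr.exists_core_field_bounds hh hlam (by omega) hφ
  have hn0 : (0 : ℝ) < n := by exact_mod_cast hn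
  have hx0 : 0 < ‖x‖ := norm_pos_iff.2 hx
  obtain ⟨h1, h2, h3, -⟩ := hb (n * ‖x‖) (n * t) (by positivity)
  have hw := hr.hasDerivAt_mollifiedAmplitude hh hlam hφ hn ‖x‖ t
  have he := hr.mollifiedAmplitude_eq hφ hn ‖x‖ t
  have heB : coreAmplitude φ lam r (n * ‖x‖) (n * t) / n / ‖x‖ =
    coreAmplitude φ lam r (n * ‖x‖) (n * t) / (n * ‖x‖) := div_div _ _ _
  rw [momentumIntegrand_radialMotion hd ψ hx hw h1 (by rw [he]; positivity)
    (hh.differentiableAt (by rw [he, heB]; exact hc.trans_le h3)), he, heB]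
  rfl

/-- The unit-scale bound is scale invariant, so ε does not even depend on n. The origin is treated
apart, the gradient there being a multiple of the identity. -/
lemma exists_det_lower_bound (hr : IsCavitatingProfile d h lam σ r)
    (hh : IsVolumetricEnergy h) (hlam : 0 < lam) (hd : 1 ≤ d) (hφ : IsRadialMollifier φ) :
    ∃ ε : ℝ, 0 < ε ∧ ∀ n : ℕ, 1 ≤ n → ∀ x t, ε ≤ (gradMatrix (fun z => radialMotion d
      (mollifiedAmplitude φ n (selfSimilarAmplitude lam r)) z t) x).det := by
  obtain ⟨c, C, δ, hc, -, -, -, h0, hb⟩ := hr.exists_core_field_bounds hh hlam hd hφ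
  refine ⟨c, hc, fun n hn x t => ?_⟩
  have hn0 : (0 : ℝ) < n := by exact_mod_cast hn
  have hw := fun R => hr.hasDerivAt_mollifiedAmplitude hh hlam hφ hn R t
  have he := fun R => hr.mollifiedAmplitude_eq hφ hn R t
  by_cases hx : x = 0
  · have hw0 := hw 0
    rw [mul_zero] at hw0
    rw [hx, gradMatrix_radialMotion_zero hw0 (by
      rw [he, mul_zero, coreAmplitude, oddMollification_zero hφ, zero_div])]
    simpa using h0 (n * t)
  · have hx0 : 0 < ‖x‖ := norm_pos_iff.2 hx
    obtain ⟨h1, h2, h3, -⟩ := hb (n * ‖x‖) (n * t) (by positivity)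
    rw [gradMatrix_radialMotion hx (hw ‖x‖), he, div_div, det_radialTensor hd _ hx]
    · exact h3
    · positivity

end IsCavitatingProfile

end CoreStress

/-! ### Outside the core: dominated convergence -/

section OuterLimit

variable {d : ℕ} {h : ℝ → ℝ} {lam σ : ℝ} {r φ : ℝ → ℝ}
  {ψ : EuclideanSpace ℝ (Fin d) × ℝ → EuclideanSpace ℝ (Fin d)}

lemma tendsto_radialIntegrand {ι : Type*} {l : Filter ι} {W P Q : ι → ℝ} {W₀ P₀ Q₀ : ℝ}
    (hW : Tendsto W l (𝓝 W₀)) (hP : Tendsto P l (𝓝 P₀)) (hQ : Tendsto Q l (𝓝 Q₀))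
    (ψ : EuclideanSpace ℝ (Fin d) × ℝ → EuclideanSpace ℝ (Fin d)) (x : EuclideanSpace ℝ (Fin d))
    (t : ℝ) :
    Tendsto (fun i => radialIntegrand ψ (W i) (P i) (Q i) x t) l
      (𝓝 (radialIntegrand ψ W₀ P₀ Q₀ x t)) := by
  simp only [radialIntegrand_eq]
  exact (((hW.div_const _).mul_const _).add (hQ.mul_const _)).add
    (((hP.sub hQ).div_const _).mul_const _)

lemma IsVolumetricEnergy.tendsto_stress (hh : IsVolumetricEnergy h) {ι : Type*} {l : Filter ι}
    {A B : ι → ℝ} {A₀ B₀ : ℝ} (hA : Tendsto A l (𝓝 A₀)) (hB : Tendsto B l (𝓝 B₀))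
    (h0 : 0 < A₀ * B₀ ^ (d - 1)) :
    Tendsto (fun i => radialStress d h (A i) (B i)) l (𝓝 (radialStress d h A₀ B₀)) ∧
      Tendsto (fun i => hoopStress d h (A i) (B i)) l (𝓝 (hoopStress d h A₀ B₀)) := by
  have h1 : Tendsto (fun i => deriv h (A i * B i ^ (d - 1))) l
      (𝓝 (deriv h (A₀ * B₀ ^ (d - 1)))) :=
    (hh.hasDerivAt_deriv h0).continuousAt.tendsto.comp (hA.mul (hB.pow _))
  exact ⟨hA.add ((hB.pow _).mul h1), hB.add ((hA.mul (hB.pow _)).mul h1)⟩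

/-- The weak-form integrand of the mollified motion. -/
noncomputable def mollifiedIntegrand (h φ : ℝ → ℝ) (lam σ : ℝ) (r : ℝ → ℝ)
    (ψ : EuclideanSpace ℝ (Fin d) × ℝ → EuclideanSpace ℝ (Fin d)) (n : ℕ)
    (p : EuclideanSpace ℝ (Fin d) × ℝ) : ℝ :=
  radialIntegrand ψ (coreAmplitude φ lam r (n * ‖p.1‖) (n * p.2) / n)
    (coreRadialStress d h φ lam σ r (n * ‖p.1‖) (n * p.2))
    (coreHoopStress d h φ lam σ r (n * ‖p.1‖) (n * p.2)) p.1 p.2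

lemma measurableSet_outer (n : ℕ) :
    MeasurableSet {p : EuclideanSpace ℝ (Fin d) × ℝ | 1 < n * ‖p.1‖} :=
  measurableSet_lt measurable_const (by fun_prop)

namespace IsCavitatingProfile

lemma measurable_mollifiedIntegrand (hr : IsCavitatingProfile d h lam σ r)
    (hφ : IsRadialMollifier φ) (hψ : ContDiff ℝ 2 ψ) (n : ℕ) :
    Measurable (mollifiedIntegrand h φ lam σ r ψ n) := by
  have hq : Measurable fun p : EuclideanSpace ℝ (Fin d) × ℝ => ((n : ℝ) * ‖p.1‖, (n : ℝ) * p.2) := by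
    fun_prop
  exact measurable_radialIntegrand hψ (((hr.measurable_coreAmplitude hφ).comp hq).div_const _)
    ((hr.measurable_coreRadialStress hφ).comp hq) ((hr.measurable_coreHoopStress hφ).comp hq)

/-- The stresses are O(|x|^{1-d}) uniformly in n, and on the bounded support of ψ this is
integrable. -/
lemma exists_outer_majorant (hr : IsCavitatingProfile d h lam σ r)
    (hh : IsVolumetricEnergy h) (hlam : 0 < lam) (hd : 2 ≤ d) (hφ : IsRadialMollifier φ)
    (hψ : ContDiff ℝ 2 ψ) (hc : HasCompactSupport ψ) :
    ∃ G : EuclideanSpace ℝ (Fin d) × ℝ → ℝ, Integrable G ∧ ∀ (n : ℕ) p,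
      ‖{p : EuclideanSpace ℝ (Fin d) × ℝ | 1 < n * ‖p.1‖}.indicator
        (mollifiedIntegrand h φ lam σ r ψ n) p‖ ≤ G p := by
  obtain ⟨K, hK0, hK⟩ := hr.exists_core_stress_bound hh hlam hd hφ
  obtain ⟨C, M, hC, hM, hb, -, h0⟩ := exists_radialIntegrand_bound hψ hc
  set D := C * (K * (M + M) * M ^ (d - 1) + K * (M + M) ^ (d - 1) + K * (M + M) ^ (d - 1)) with hD
  have hD0 : 0 ≤ D := by positivity
  set S : Set (EuclideanSpace ℝ (Fin d) × ℝ) := {p | ‖p.1‖ ≤ M ∧ |p.2| ≤ M} with hS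
  have hm1 : Measurable fun p : EuclideanSpace ℝ (Fin d) × ℝ => ‖p.1‖ := by fun_prop
  have hm2 : Measurable fun p : EuclideanSpace ℝ (Fin d) × ℝ => |p.2| := by fun_prop
  have hSm : MeasurableSet S :=
    (measurableSet_le hm1 measurable_const).inter (measurableSet_le hm2 measurable_const)
  refine ⟨S.indicator fun p => D / ‖p.1‖ ^ (d - 1), ?_, fun n p => ?_⟩
  · refine integrable_prod_of_mul_norm_pow_le (C := D) (M := M) (by omega)
      (Measurable.indicator (by fun_prop) hSm).aestronglyMeasurable (fun x t hx hxM htM => ?_)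
      fun x t hxt => indicator_of_notMem (fun hp => ?_) _
    · have hx0 : 0 < ‖x‖ := norm_pos_iff.2 hx
      rw [indicator_of_mem (show (x, t) ∈ S from ⟨hxM, htM⟩), abs_of_nonneg (by positivity),
        div_mul_cancel₀ _ (by positivity)]
    · exact hxt.elim (not_lt.2 hp.1) (not_lt.2 hp.2)
  · have hG0 : 0 ≤ S.indicator (fun p => D / ‖p.1‖ ^ (d - 1)) p :=
      indicator_nonneg (fun p _ => by positivity) p
    by_cases hp : p ∈ {p : EuclideanSpace ℝ (Fin d) × ℝ | 1 < n * ‖p.1‖}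
    · rw [indicator_of_mem hp]
      have hp : 1 < n * ‖p.1‖ := hp
      have hx0 : 0 < ‖p.1‖ := by
        refine (norm_nonneg _).lt_of_ne fun h => ?_
        rw [← h, mul_zero] at hp
        linarith
      by_cases hpS : p ∈ S
      · rw [indicator_of_mem hpS, le_div_iff₀ (by positivity)]
        obtain ⟨h1, h2, h3⟩ := hK ‖p.1‖ p.2 n hx0 hp
        have h4 : |p.2| + ‖p.1‖ ≤ M + M := add_le_add hpS.2 hpS.1
        have h5 : ‖p.1‖ ^ (d - 1) ≤ M ^ (d - 1) := pow_le_pow_left₀ hx0.le hpS.1 _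
        refine (mul_le_mul_of_nonneg_right (hb p.1 p.2 _ _ _) (by positivity)).trans ?_
        rw [mul_assoc, add_mul, add_mul, hD]
        have h6 : K * (|p.2| + ‖p.1‖) ^ (d - 1) ≤ K * (M + M) ^ (d - 1) := by gcongr
        refine mul_le_mul_of_nonneg_left (add_le_add (add_le_add ?_ (h1.trans h6)) (h2.trans h6))
          hC.le
        exact mul_le_mul (h3.trans (mul_le_mul_of_nonneg_left h4 hK0)) h5 (by positivity)
          (by positivity)
      · have : M < ‖p.1‖ ∨ M < |p.2| := by
          by_contra! hcon
          exact hpS hcon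
        rw [mollifiedIntegrand, (h0 p.1 p.2 this).1, norm_zero]
        exact hG0
    · rwa [indicator_of_notMem hp, norm_zero]

lemma integrable_outer (hr : IsCavitatingProfile d h lam σ r)
    (hh : IsVolumetricEnergy h) (hlam : 0 < lam) (hd : 2 ≤ d) (hφ : IsRadialMollifier φ)
    (hψ : ContDiff ℝ 2 ψ) (hc : HasCompactSupport ψ) (n : ℕ) :
    Integrable ({p : EuclideanSpace ℝ (Fin d) × ℝ | 1 < n * ‖p.1‖}.indicator
      (mollifiedIntegrand h φ lam σ r ψ n)) := by
  obtain ⟨G, hG, hb⟩ := hr.exists_outer_majorant hh hlam hd hφ hψ hc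
  exact hG.mono' ((hr.measurable_mollifiedIntegrand hφ hψ n).indicator
    (measurableSet_outer n)).aestronglyMeasurable (Eventually.of_forall (hb n))

/-- Off the axis and the shock the integrands converge to that of the cavitating motion, whose
integral is zero by the weak form. -/
lemma tendsto_integral_outer (hr : IsCavitatingProfile d h lam σ r)
    (hh : IsVolumetricEnergy h) (hlam : 0 < lam) (hd : 3 ≤ d) (hφ : IsRadialMollifier φ)
    (hψ : ContDiff ℝ 2 ψ) (hc : HasCompactSupport ψ) :
    Tendsto (fun n : ℕ => ∫ p in {p : EuclideanSpace ℝ (Fin d) × ℝ | 1 < n * ‖p.1‖},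
      mollifiedIntegrand h φ lam σ r ψ n p) atTop (𝓝 0) := by
  obtain ⟨G, hG, hb⟩ := hr.exists_outer_majorant hh hlam (by omega) hφ hψ hc
  obtain ⟨c, C, hc0, -, hw, hs⟩ := hr.exists_field_bounds hh hlam
  rw [← (hr.integrable_and_integral_radialIntegrand hh hlam hd hψ hc).2]
  simp only [← integral_indicator (measurableSet_outer (d := d) _)]
  refine tendsto_integral_of_dominated_convergence G (fun n =>
    ((hr.measurable_mollifiedIntegrand hφ hψ n).indicator
      (measurableSet_outer n)).aestronglyMeasurable) hG
    (fun n => Eventually.of_forall (hb n)) ?_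
  filter_upwards [hr.ae_not_on_shock (by omega)] with p ⟨hx, hxt⟩
  have hx0 : 0 < ‖p.1‖ := norm_pos_iff.2 hx
  have hA := hr.tendsto_coreStrain hφ hx0 hxt
  have hW := hr.tendsto_coreAmplitude hφ hx0 hxt
  have hB : Tendsto (fun n : ℕ => coreAmplitude φ lam r (n * ‖p.1‖) (n * p.2) / (n * ‖p.1‖)) atTop
      (𝓝 (cavityAmplitude lam r ‖p.1‖ p.2 / ‖p.1‖)) := by
    refine (hW.div_const ‖p.1‖).congr fun n => ?_
    rw [div_div]
  obtain ⟨hP, hQ⟩ := hh.tendsto_stress (d := d) hA hB (hc0.trans_le (hs _ _ hx0).2.2)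
  refine (tendsto_radialIntegrand hW hP hQ ψ p.1 p.2).congr' ?_
  filter_upwards [(tendsto_natCast_atTop_atTop (R := ℝ)).eventually_gt_atTop ‖p.1‖⁻¹] with n hn
  have hnR : 1 < n * ‖p.1‖ := by rwa [inv_lt_iff_one_lt_mul₀ hx0] at hn
  rw [indicator_of_mem (show p ∈ {p : EuclideanSpace ℝ (Fin d) × ℝ | 1 < n * ‖p.1‖} from hnR)]
  rfl

end IsCavitatingProfile

end OuterLimit

/-! ### Inside the core: smallness under the growth condition -/

section InnerLimit

variable {d : ℕ} {h : ℝ → ℝ} {lam σ : ℝ} {r φ : ℝ → ℝ}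
  {ψ : EuclideanSpace ℝ (Fin d) × ℝ → EuclideanSpace ℝ (Fin d)}

lemma le_coreStressBound (d : ℕ) (h : ℝ → ℝ) (c : ℝ) {V : ℝ} (hV : 0 ≤ V) :
    V ≤ coreStressBound d h c V :=
  le_add_of_nonneg_right (by positivity)

/-- The quotient is v^{1-d} + |h'(c)|/v + |h'(v^d)|/v; the last term is where the growth condition
on h is used. -/
lemma tendsto_coreStressBound_div_pow (hd : 2 ≤ d) (c : ℝ)
    (hlim : Tendsto (fun v : ℝ => deriv h (v ^ d) / v) atTop (𝓝 0)) :
    Tendsto (fun v => coreStressBound d h c v / v ^ d) atTop (𝓝 0) := by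
  have h1 : Tendsto (fun v : ℝ => (v ^ (d - 1))⁻¹) atTop (𝓝 0) :=
    tendsto_inv_atTop_zero.comp (tendsto_pow_atTop (by omega))
  have h2 : Tendsto (fun v : ℝ => |deriv h c| / v) atTop (𝓝 0) :=
    tendsto_const_nhds.div_atTop tendsto_id
  have h3 := (h1.add h2).add hlim.abs
  rw [abs_zero, add_zero, add_zero] at h3
  refine h3.congr' ?_
  filter_upwards [eventually_gt_atTop (0 : ℝ)] with v hv
  have h4 : v ^ d = v * v ^ (d - 1) := by rw [← pow_succ', Nat.sub_add_cancel (by omega)]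
  rw [coreStressBound, abs_div, abs_of_pos hv]
  generalize |deriv h (v ^ d)| = D
  rw [h4]
  field_simp
  ring

lemma volume_real_cylinder (d : ℕ) {ρ : ℝ} (hρ : 0 ≤ ρ) {a b : ℝ} (hab : a ≤ b) :
    (volume : Measure (EuclideanSpace ℝ (Fin d) × ℝ)).real (Metric.closedBall 0 ρ ×ˢ Icc a b) =
      ρ ^ d * volume.real (Metric.closedBall (0 : EuclideanSpace ℝ (Fin d)) 1) * (b - a) := by
  rw [Measure.volume_eq_prod, measureReal_prod_prod, Measure.addHaar_real_closedBall' _ _ hρ,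
    finrank_euclideanSpace_fin, Real.volume_real_Icc_of_le hab]

lemma volume_cylinder_ne_top (d : ℕ) (ρ a b : ℝ) :
    (volume : Measure (EuclideanSpace ℝ (Fin d) × ℝ)) (Metric.closedBall 0 ρ ×ˢ Icc a b) ≠ ⊤ :=
  ((isCompact_closedBall _ _).prod isCompact_Icc).measure_ne_top

namespace IsCavitatingProfile

/-- On the support of ψ the rescaled time is at most nM, so both strains in the core are at most Ln
with L = C(1+M). The factor 3 accounts for amplitude and two stresses. -/
lemma exists_inner_bound (hr : IsCavitatingProfile d h lam σ r)
    (hh : IsVolumetricEnergy h) (hlam : 0 < lam) (hd : 2 ≤ d) (hφ : IsRadialMollifier φ)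
    (hψ : ContDiff ℝ 2 ψ) (hc : HasCompactSupport ψ) :
    ∃ c L D M, 0 < L ∧ 0 ≤ D ∧ 0 < M ∧ ∀ n : ℕ, 1 ≤ n →
      ∀ p : EuclideanSpace ℝ (Fin d) × ℝ, (p.1 ≠ 0 → n * ‖p.1‖ ≤ 1 →
        |mollifiedIntegrand h φ lam σ r ψ n p| ≤ D * coreStressBound d h c (L * n)) ∧
      (M < |p.2| → mollifiedIntegrand h φ lam σ r ψ n p = 0) := by
  obtain ⟨c, C, δ, hc0, hC, -, -, -, hb⟩ := hr.exists_core_field_bounds hh hlam (by omega) hφ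
  obtain ⟨C', M, hC', hM, hb', -, h0⟩ := exists_radialIntegrand_bound hψ hc
  refine ⟨c, C * (1 + M), 3 * C', M, by positivity, by positivity, hM, fun n hn p =>
    ⟨fun hx hxn => ?_, fun ht => (h0 p.1 p.2 (Or.inr ht)).1 _ _ _⟩⟩
  have hn1 : (1 : ℝ) ≤ n := by exact_mod_cast hn
  have hn0 : (0 : ℝ) < n := by linarith
  have hx0 : 0 < ‖p.1‖ := norm_pos_iff.2 hx
  set V := C * (1 + M) * n with hV
  have hV0 : 0 < V := by positivity
  have hSB := le_coreStressBound d h c hV0.le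
  by_cases ht : M < |p.2|
  · rw [mollifiedIntegrand, (h0 p.1 p.2 (Or.inr ht)).1, abs_zero]
    exact mul_nonneg (by positivity) (hV0.le.trans hSB)
  · rw [not_lt] at ht
    obtain ⟨h1, h2, h3, h4, h5, -⟩ := hb (n * ‖p.1‖) (n * p.2) (by positivity)
    have hT : max ((n : ℝ) * p.2) 0 ≤ n * M :=
      max_le (mul_le_mul_of_nonneg_left ((le_abs_self _).trans ht) hn0.le) (by positivity)
    have hTV : C * (1 + max ((n : ℝ) * p.2) 0) ≤ V := by
      rw [hV, mul_assoc]
      gcongr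
      nlinarith
    obtain ⟨hP, hQ⟩ := abs_stress_le_coreStressBound hh hd hc0 h1
      (div_pos h2 (by positivity)) (h4.trans hTV) (h5.trans hTV) h3
    have hW : |coreAmplitude φ lam r (n * ‖p.1‖) (n * p.2) / n| ≤ coreStressBound d h c V := by
      rw [abs_of_pos (by positivity)]
      refine le_trans ?_ hSB
      refine (h5.trans hTV).trans' ?_
      exact div_le_div_of_nonneg_left h2.le (by positivity) (by nlinarith)
    refine (hb' p.1 p.2 _ _ _).trans ?_
    calc _ ≤ C' * (coreStressBound d h c V + coreStressBound d h c V + coreStressBound d h c V) :=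
          mul_le_mul_of_nonneg_left (add_le_add (add_le_add hW hP) hQ) hC'.le
      _ = _ := by ring

lemma integrableOn_inner (hr : IsCavitatingProfile d h lam σ r)
    (hh : IsVolumetricEnergy h) (hlam : 0 < lam) (hd : 2 ≤ d) (hφ : IsRadialMollifier φ)
    (hψ : ContDiff ℝ 2 ψ) (hc : HasCompactSupport ψ) {n : ℕ} (hn : 1 ≤ n) :
    IntegrableOn (mollifiedIntegrand h φ lam σ r ψ n)
      {p : EuclideanSpace ℝ (Fin d) × ℝ | 1 < n * ‖p.1‖}ᶜ := by
  obtain ⟨c, L, D, M, hL, hD, hM, hb⟩ := hr.exists_inner_bound hh hlam hd hφ hψ hc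
  have hn0 : (0 : ℝ) < n := by exact_mod_cast hn
  rw [← integrable_indicator_iff (measurableSet_outer n).compl]
  refine integrable_of_bounded_support (volume_cylinder_ne_top d (1 / n) (-M) M)
    (C := D * coreStressBound d h c (L * n))
    ((hr.measurable_mollifiedIntegrand hφ hψ n).indicator
      (measurableSet_outer n).compl).aestronglyMeasurable ?_ fun p hp => ?_
  · filter_upwards [hr.ae_not_on_shock (by omega)] with p ⟨hx, _⟩
    by_cases hp : p ∈ {p : EuclideanSpace ℝ (Fin d) × ℝ | 1 < n * ‖p.1‖}ᶜ
    · rw [indicator_of_mem hp]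
      exact (hb n hn p).1 hx (not_lt.1 hp)
    · rw [indicator_of_notMem hp, abs_zero]
      exact mul_nonneg hD ((le_coreStressBound d h c (by positivity)).trans' (by positivity))
  · by_cases hp1 : p ∈ {p : EuclideanSpace ℝ (Fin d) × ℝ | 1 < n * ‖p.1‖}ᶜ
    · rw [indicator_of_mem hp1]
      refine (hb n hn p).2 (not_le.1 fun ht => hp ⟨?_, abs_le.1 ht⟩)
      rw [mem_closedBall_zero_iff, le_div_iff₀ hn0, mul_comm]
      exact not_lt.1 hp1
    · rw [indicator_of_notMem hp1]

lemma integrable_mollifiedIntegrand (hr : IsCavitatingProfile d h lam σ r)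
    (hh : IsVolumetricEnergy h) (hlam : 0 < lam) (hd : 2 ≤ d) (hφ : IsRadialMollifier φ)
    (hψ : ContDiff ℝ 2 ψ) (hc : HasCompactSupport ψ) {n : ℕ} (hn : 1 ≤ n) :
    Integrable (mollifiedIntegrand h φ lam σ r ψ n) := by
  rw [← integrableOn_univ, ← union_compl_self {p : EuclideanSpace ℝ (Fin d) × ℝ | 1 < n * ‖p.1‖}]
  exact ((integrable_indicator_iff (measurableSet_outer n)).1
    (hr.integrable_outer hh hlam hd hφ hψ hc n)).union
    (hr.integrableOn_inner hh hlam hd hφ hψ hc hn)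

/-- The core over a bounded time interval has volume of order n^{-d}, which is of order (Ln)^{-d},
to be compared with the stress bound at V = Ln. -/
lemma tendsto_integral_inner (hr : IsCavitatingProfile d h lam σ r)
    (hh : IsVolumetricEnergy h) (hlam : 0 < lam) (hd : 2 ≤ d) (hφ : IsRadialMollifier φ)
    (hψ : ContDiff ℝ 2 ψ) (hc : HasCompactSupport ψ)
    (hlim : Tendsto (fun v : ℝ => deriv h (v ^ d) / v) atTop (𝓝 0)) :
    Tendsto (fun n : ℕ => ∫ p in {p : EuclideanSpace ℝ (Fin d) × ℝ | 1 < n * ‖p.1‖}ᶜ,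
      mollifiedIntegrand h φ lam σ r ψ n p) atTop (𝓝 0) := by
  obtain ⟨c, L, D, M, hL, hD, hM, hb⟩ := hr.exists_inner_bound hh hlam hd hφ hψ hc
  set ω := volume.real (Metric.closedBall (0 : EuclideanSpace ℝ (Fin d)) 1)
  have hLn : Tendsto (fun n : ℕ => L * (n : ℝ)) atTop atTop :=
    tendsto_natCast_atTop_atTop.const_mul_atTop hL
  have h1 := ((tendsto_coreStressBound_div_pow hd c hlim).comp hLn).const_mul
    (D * L ^ d * ω * (M - -M))
  rw [mul_zero] at h1
  refine squeeze_zero_norm' ?_ h1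
  filter_upwards [eventually_ge_atTop 1] with n hn
  have hn0 : (0 : ℝ) < n := by exact_mod_cast hn
  set S : Set (EuclideanSpace ℝ (Fin d) × ℝ) := Metric.closedBall 0 (1 / n) ×ˢ Icc (-M) M with hS
  have hmem : ∀ p : EuclideanSpace ℝ (Fin d) × ℝ, n * ‖p.1‖ ≤ 1 ↔ ‖p.1‖ ≤ 1 / n := fun p => by
    rw [le_div_iff₀ hn0, mul_comm]
  have hsub : S ⊆ {p : EuclideanSpace ℝ (Fin d) × ℝ | 1 < n * ‖p.1‖}ᶜ := fun p hp =>
    not_lt.2 ((hmem p).2 (mem_closedBall_zero_iff.1 hp.1))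
  rw [setIntegral_eq_of_subset_of_forall_sdiff_eq_zero (measurableSet_outer n).compl hsub
    fun p hp => (hb n hn p).2 (not_le.1 fun ht => hp.2
      ⟨mem_closedBall_zero_iff.2 ((hmem p).1 (not_lt.1 hp.1)), abs_le.1 ht⟩)]
  have hvol := volume_real_cylinder d (ρ := 1 / n) (by positivity) (by linarith : -M ≤ M)
  refine (norm_setIntegral_le_of_norm_le_const_ae (C := D * coreStressBound d h c (L * n))
    (volume_cylinder_ne_top d (1 / n) (-M) M).lt_top ?_).trans (le_of_eq ?_)
  · filter_upwards [ae_restrict_of_ae (hr.ae_not_on_shock (by omega)),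
      ae_restrict_mem (measurableSet_closedBall.prod measurableSet_Icc)] with p ⟨hx, _⟩ hp
    exact (hb n hn p).1 hx (not_lt.1 (hsub hp))
  · rw [hvol]
    simp only [Function.comp_apply, one_div_pow, mul_pow]
    field_simp
    rfl

/-- The splitting into core and exterior on which both halves of the dichotomy rest. -/
lemma integrable_momentumIntegrand_mollified (hr : IsCavitatingProfile d h lam σ r)
    (hh : IsVolumetricEnergy h) (hlam : 0 < lam) (hd : 2 ≤ d) (hφ : IsRadialMollifier φ)
    (hψ : ContDiff ℝ 2 ψ) (hc : HasCompactSupport ψ) {n : ℕ} (hn : 1 ≤ n) :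
    Integrable (fun p : EuclideanSpace ℝ (Fin d) × ℝ => momentumIntegrand h
      (radialMotion d (mollifiedAmplitude φ n (selfSimilarAmplitude lam r))) ψ p.1 p.2) ∧
    ∫ t, ∫ x, momentumIntegrand h
      (radialMotion d (mollifiedAmplitude φ n (selfSimilarAmplitude lam r))) ψ x t =
      (∫ p in {p : EuclideanSpace ℝ (Fin d) × ℝ | 1 < n * ‖p.1‖},
        mollifiedIntegrand h φ lam σ r ψ n p) +
      ∫ p in {p : EuclideanSpace ℝ (Fin d) × ℝ | 1 < n * ‖p.1‖}ᶜ,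
        mollifiedIntegrand h φ lam σ r ψ n p := by
  have hI := hr.integrable_mollifiedIntegrand hh hlam hd hφ hψ hc hn
  have hae : mollifiedIntegrand h φ lam σ r ψ n =ᵐ[volume]
      fun p : EuclideanSpace ℝ (Fin d) × ℝ => momentumIntegrand h
      (radialMotion d (mollifiedAmplitude φ n (selfSimilarAmplitude lam r))) ψ p.1 p.2 := by
    filter_upwards [hr.ae_not_on_shock (by omega)] with p ⟨hx, _⟩
    exact (hr.momentumIntegrand_mollified hh hlam hd hφ ψ hn hx p.2).symm
  have hI' := hI.congr hae
  refine ⟨hI', ?_⟩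
  rw [integral_add_compl (measurableSet_outer n) hI, integral_congr_ae hae]
  rw [Measure.volume_eq_prod] at hI' ⊢
  exact (integral_prod_symm _ hI').symm

lemma norm_radialMotion (d : ℕ) (w : ℝ → ℝ → ℝ) (x : EuclideanSpace ℝ (Fin d)) (t : ℝ) :
    ‖radialMotion d w x t‖ ≤ |w ‖x‖ t| := by
  rw [radialMotion, norm_smul, norm_div, norm_norm, Real.norm_eq_abs]
  by_cases hx : ‖x‖ = 0
  · rw [hx, mul_zero]
    exact abs_nonneg _
  · rw [div_mul_cancel₀ _ hx]

lemma isLocBoundedL1 (hr : IsCavitatingProfile d h lam σ r) (hh : IsVolumetricEnergy h)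
    (hlam : 0 < lam) : IsLocBoundedL1 (radialMotion d (selfSimilarAmplitude lam r)) := by
  constructor
  · have h1 : Measurable fun p : EuclideanSpace ℝ (Fin d) × ℝ =>
        (cavityAmplitude lam r ‖p.1‖ p.2 / ‖p.1‖) • p.1 :=
      ((hr.measurable_cavityAmplitude.comp
        (measurable_fst.norm.prodMk measurable_snd)).div measurable_fst.norm).smul measurable_fst
    refine h1.aestronglyMeasurable.congr (Eventually.of_forall fun p => ?_)
    simp only [radialMotion, cavityAmplitude_eq lam r (norm_nonneg p.1)]
  · intro T M
    obtain ⟨c, C, hc, hC, hw, -⟩ := hr.exists_field_bounds hh hlam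
    set B := Metric.closedBall (0 : EuclideanSpace ℝ (Fin d)) M with hB
    have htop : ENNReal.ofReal (C * (|T| + |M|)) * volume B ≠ ⊤ :=
      ENNReal.mul_ne_top ENNReal.ofReal_ne_top (isCompact_closedBall _ _).measure_ne_top
    refine ⟨(ENNReal.ofReal (C * (|T| + |M|)) * volume B).toNNReal,
      Eventually.of_forall fun t ht => ?_⟩
    rw [ENNReal.coe_toNNReal htop, ← setLIntegral_const]
    refine setLIntegral_mono' measurableSet_closedBall fun x hx => ?_
    rw [← ofReal_norm]
    refine ENNReal.ofReal_le_ofReal ((norm_radialMotion d _ x t).trans ?_)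
    obtain ⟨h1, h2⟩ := hw ‖x‖ t (norm_nonneg x)
    have h3 : 0 ≤ max t 0 := le_max_right _ _
    rw [cavityAmplitude_eq lam r (norm_nonneg x)] at h1 h2
    rw [abs_of_nonneg (h1.trans' (by positivity))]
    refine h2.trans (mul_le_mul_of_nonneg_left (add_le_add ?_ ?_) hC.le)
    · exact max_le ((le_abs_self t).trans (ht.trans (le_abs_self T))) (abs_nonneg T)
    · exact (mem_closedBall_zero_iff.1 hx).trans (le_abs_self M)

lemma radialMotion_linear {w : ℝ → ℝ → ℝ} {x : EuclideanSpace ℝ (Fin d)} {t : ℝ}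
    (hw : w ‖x‖ t = lam * ‖x‖) : radialMotion d w x t = lam • x := by
  rw [radialMotion, hw]
  by_cases hx : x = 0
  · simp [hx]
  · rw [mul_div_cancel_right₀ _ (norm_ne_zero_iff.2 hx)]

lemma isSlicSolution (hr : IsCavitatingProfile d h lam σ r) (hh : IsVolumetricEnergy h)
    (hlam : 0 < lam) (hd : 3 ≤ d)
    (hlim : Tendsto (fun v : ℝ => deriv h (v ^ d) / v) atTop (𝓝 0)) :
    IsSlicSolution d h lam (selfSimilarAmplitude lam r) where
  amplitude_nonneg R t hR := by
    obtain ⟨c, C, hc, hC, hw, -⟩ := hr.exists_field_bounds hh hlam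
    have h3 : 0 ≤ max t 0 := le_max_right _ _
    rw [← cavityAmplitude_eq lam r hR]
    exact (hw R t hR).1.trans' (by positivity)
  locBounded := hr.isLocBoundedL1 hh hlam
  monotone t R₁ hR₁ R₂ hR₂ h12 := by
    simp only [selfSimilarAmplitude]
    split_ifs with ht
    · exact mul_le_mul_of_nonneg_left h12 hlam.le
    · have ht0 : 0 < t := not_le.1 ht
      exact mul_le_mul_of_nonneg_left (hr.monotoneOn hlam (div_nonneg hR₁ ht0.le)
        (div_nonneg hR₂ ht0.le) (by gcongr)) ht0.le
  eq_of_nonpos x t ht := radialMotion_linear (if_pos ht)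
  eq_of_far := by
    refine ⟨σ, hr.speed_pos, fun x t ht hx => radialMotion_linear ?_⟩
    rw [selfSimilarAmplitude, if_neg (not_le.2 ht),
      hr.eq_ahead _ ((le_div_iff₀ ht).2 hx.le)]
    field_simp
  det_bound φ hφ n hn := by
    obtain ⟨ε, hε, hb⟩ := hr.exists_det_lower_bound hh hlam (by omega) hφ
    exact ⟨ε, hε, hb n hn⟩
  momentum_limit φ hφ ψ hψ hc := by
    have key := fun n hn =>
      hr.integrable_momentumIntegrand_mollified (n := n) hh hlam (by omega) hφ hψ hc hn
    refine ⟨fun n hn => (key n hn).1, ?_⟩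
    have h1 := (hr.tendsto_integral_outer hh hlam hd hφ hψ hc).add
      (hr.tendsto_integral_inner hh hlam (by omega) hφ hψ hc hlim)
    rw [add_zero] at h1
    refine h1.congr' ?_
    filter_upwards [eventually_ge_atTop 1] with n hn
    exact (key n hn).2.symm

end IsCavitatingProfile

end InnerLimit

/-! ### The core contribution persists under superlinear or linear growth -/

section Divergence

lemma exists_isRadialMollifier : ∃ φ, IsRadialMollifier φ := by
  let f : ContDiffBump (0 : ℝ) := ⟨1 / 2, 1, by norm_num, by norm_num⟩
  refine ⟨f.normed volume, f.contDiff_normed, f.nonneg_normed, f.normed_neg, f.integral_normed, ?_,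
    ?_⟩
  · rw [f.tsupport_normed_eq, Real.closedBall_eq_Icc]
    norm_num
  · rw [f.normed_def, f.one_of_mem_closedBall (Metric.mem_closedBall_self f.rIn_pos.le)]
    exact div_pos one_pos f.integral_pos

variable {d : ℕ} {h : ℝ → ℝ} {lam σ : ℝ} {r φ : ℝ → ℝ}
  {ψ : EuclideanSpace ℝ (Fin d) × ℝ → EuclideanSpace ℝ (Fin d)}

/-- Test functions that are a nonnegative multiple of the identity near the axis `x = 0`. -/
lemma exists_dilation_test_function (d : ℕ) :
    ∃ (ψ : EuclideanSpace ℝ (Fin d) × ℝ → EuclideanSpace ℝ (Fin d)) (η : ℝ → ℝ),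
      ContDiff ℝ 2 ψ ∧ HasCompactSupport ψ ∧ (∀ t, 0 ≤ η t) ∧ (∀ t, η t ≤ 1) ∧
      (∀ t ∈ Icc (3 / 2 : ℝ) (5 / 2), η t = 1) ∧
      ∀ (x : EuclideanSpace ℝ (Fin d)) (t W P Q : ℝ), x ≠ 0 → ‖x‖ < 1 →
        radialIntegrand ψ W P Q x t =
          radialIntegrand ψ W 0 0 x t + η t * (P + (d - 1) * Q) := by
  let χ : ContDiffBump (0 : EuclideanSpace ℝ (Fin d)) := ⟨1, 2, by norm_num, by norm_num⟩
  let η : ContDiffBump (2 : ℝ) := ⟨1 / 2, 1, by norm_num, by norm_num⟩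
  have hχ : ContDiff ℝ 2 χ := χ.contDiff
  have hη : ContDiff ℝ 2 η := η.contDiff
  refine ⟨fun p => (η p.2 * χ p.1) • p.1, η, ?_, ?_, fun t => η.nonneg, fun t => η.le_one,
    fun t ht => η.one_of_mem_closedBall ?_, fun x t W P Q hx hx1 => ?_⟩
  · exact ((hη.comp contDiff_snd).mul (hχ.comp contDiff_fst)).smul contDiff_fst
  · refine HasCompactSupport.of_support_subset_isCompact
      ((isCompact_closedBall (0 : EuclideanSpace ℝ (Fin d)) 2).prod
        (isCompact_closedBall (2 : ℝ) 1)) fun p hp => ?_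
    have hp0 : η p.2 * χ p.1 ≠ 0 := fun h0 => hp (by simp only [h0, zero_smul])
    have h1 : p.2 ∈ Function.support η := left_ne_zero_of_mul hp0
    have h2 : p.1 ∈ Function.support χ := right_ne_zero_of_mul hp0
    rw [η.support_eq] at h1
    rw [χ.support_eq] at h2
    exact ⟨Metric.ball_subset_closedBall h2, Metric.ball_subset_closedBall h1⟩
  · change dist t 2 ≤ 1 / 2
    rw [Real.dist_eq, abs_le]
    constructor <;> linarith [ht.1, ht.2]
  · have hx0 : 0 < ‖x‖ := norm_pos_iff.2 hx
    have h1 : HasFDerivAt (fun z => (η t * χ z) • z)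
        (η t • ContinuousLinearMap.id ℝ (EuclideanSpace ℝ (Fin d))) x := by
      refine ((hasFDerivAt_id x).const_smul (η t)).congr_of_eventuallyEq ?_
      -- Where χ = 1 the field is η(t)x with gradient η(t) times the identity, so S : ∇ψ becomes η
      -- times the trace Φ₁ + (d-1)Φ₂.
      filter_upwards [Metric.isOpen_ball.mem_nhds (mem_ball_zero_iff.2 hx1)] with z hz
      have : χ z = 1 := χ.one_of_mem_closedBall (Metric.ball_subset_closedBall hz)
      simp [this]
    have h2 : ∀ i, gradMatrix (fun z => (η t * χ z) • z) x i i = η t := fun i => by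
      simp [gradMatrix, h1.fderiv]
    rw [radialIntegrand_eq, radialIntegrand_eq]
    simp only [h2, h1.fderiv]
    simp only [Finset.sum_const, Finset.card_univ, Fintype.card_fin, nsmul_eq_mul,
      smul_apply, ContinuousLinearMap.id_apply, inner_smul_right,
      real_inner_self_eq_norm_sq]
    generalize inner ℝ x (iteratedDeriv 2 (fun τ => (η τ * χ x) • x) t) = I
    field_simp
    ring

/-- The lower limit is taken in the extended reals so that the value +∞ is admitted. -/
lemma eventually_mul_lt_of_liminf_pos {u : ℝ → ℝ}
    (hu : 0 < liminf (fun v : ℝ => ((u v / v : ℝ) : EReal)) atTop) :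
    ∃ ε : ℝ, 0 < ε ∧ ∀ᶠ v in atTop, ε * v ≤ u v := by
  obtain ⟨ε, hε0, hε⟩ := EReal.lt_iff_exists_real_btwn.1 hu
  refine ⟨ε, by exact_mod_cast hε0, ?_⟩
  filter_upwards [eventually_lt_of_lt_liminf hε, eventually_gt_atTop 0] with v h1 h2
  rw [EReal.coe_lt_coe_iff] at h1
  exact ((lt_div_iff₀ h2).1 h1).le

/-- Since h' is increasing and the Jacobian is at least c, h' is bounded below, and the negative
part of the stresses is only O(V^{d-1}), one order below the expected V^d. -/
lemma neg_le_stress (hh : IsVolumetricEnergy h) (hd : 2 ≤ d) {c A B V : ℝ}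
    (hc : 0 < c) (hA : 0 < A) (hB : 0 < B) (hAV : A ≤ V) (hBV : B ≤ V)
    (hdet : c ≤ A * B ^ (d - 1)) :
    -(|deriv h c| * V ^ (d - 1)) ≤ radialStress d h A B ∧
      -(|deriv h c| * V ^ (d - 1)) ≤ hoopStress d h A B := by
  have h1 : -|deriv h c| ≤ deriv h (A * B ^ (d - 1)) :=
    (neg_abs_le _).trans (hh.strictMonoOn_deriv.monotoneOn hc (hc.trans_le hdet) hdet)
  have h0 := abs_nonneg (deriv h c)
  have hV : 0 < V := hA.trans_le hAV
  have key : ∀ g : ℝ, 0 ≤ g → g ≤ V ^ (d - 1) →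
      -(|deriv h c| * V ^ (d - 1)) ≤ g * deriv h (A * B ^ (d - 1)) := fun g hg hgV => by
    nlinarith [mul_le_mul_of_nonneg_left h1 hg, mul_le_mul_of_nonneg_left hgV h0]
  have hAB : A * B ^ (d - 2) ≤ V ^ (d - 1) := by
    calc A * B ^ (d - 2) ≤ V * V ^ (d - 2) := by gcongr
      _ = V ^ (d - 1) := by rw [← pow_succ', show d - 2 + 1 = d - 1 by omega]
  constructor
  · have := key (B ^ (d - 1)) (by positivity) (by gcongr)
    rw [radialStress]
    linarith
  · have := key (A * B ^ (d - 2)) (by positivity) hAB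
    rw [hoopStress]
    linarith

namespace IsCavitatingProfile

/-- For n|x| ≤ δ and t near 2 both strains are at least cn, so monotonicity of h' gives Φ₁ ≥
(cn)^{d-1} h'((cn)^d) ≥ ε(cn)^d. Elsewhere in the core the integrand is bounded below by order
-n^{d-1}. -/
lemma exists_inner_lower_bound (hr : IsCavitatingProfile d h lam σ r)
    (hh : IsVolumetricEnergy h) (hlam : 0 < lam) (hd : 2 ≤ d) (hφ : IsRadialMollifier φ)
    (hψ : ContDiff ℝ 2 ψ) (hc : HasCompactSupport ψ) {η : ℝ → ℝ} (hη0 : ∀ t, 0 ≤ η t)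
    (hη1 : ∀ t, η t ≤ 1) (hη : ∀ t ∈ Icc (3 / 2 : ℝ) (5 / 2), η t = 1)
    (hψη : ∀ (x : EuclideanSpace ℝ (Fin d)) (t W P Q : ℝ), x ≠ 0 → ‖x‖ < 1 →
      radialIntegrand ψ W P Q x t = radialIntegrand ψ W 0 0 x t + η t * (P + (d - 1) * Q))
    {ε : ℝ} (hε : 0 < ε) (hlim : ∀ᶠ v : ℝ in atTop, ε * v ≤ deriv h (v ^ d)) :
    ∃ κ E δ M, 0 < κ ∧ 0 < δ ∧ δ ≤ 1 ∧ 3 ≤ M ∧ ∀ᶠ n : ℕ in atTop,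
      ∀ p : EuclideanSpace ℝ (Fin d) × ℝ, (p.1 ≠ 0 → n * ‖p.1‖ ≤ 1 → |p.2| ≤ M →
        -(E * n ^ (d - 1)) ≤ mollifiedIntegrand h φ lam σ r ψ n p ∧
        (n * ‖p.1‖ ≤ δ → p.2 ∈ Icc (3 / 2 : ℝ) (5 / 2) →
          κ * n ^ d - E * n ^ (d - 1) ≤ mollifiedIntegrand h φ lam σ r ψ n p)) ∧
      (M < |p.2| → mollifiedIntegrand h φ lam σ r ψ n p = 0) := by
  obtain ⟨c, C, δ, hc0, hC, hδ, hδ1, -, hb⟩ :=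
    hr.exists_core_field_bounds hh hlam (by omega) hφ
  obtain ⟨C', M', hC', -, hb', -, h0⟩ := exists_radialIntegrand_bound hψ hc
  set M := max M' 3 with hM
  have hM3 : 3 ≤ M := le_max_right _ _
  set L := C * (1 + M) with hL
  have hL0 : 0 < L := by positivity
  have hd1 : (1 : ℝ) ≤ d := by exact_mod_cast (by omega : 1 ≤ d)
  have hcn : Tendsto (fun n : ℕ => c * (n : ℝ)) atTop atTop :=
    tendsto_natCast_atTop_atTop.const_mul_atTop hc0
  refine ⟨ε * c ^ d, C' * L + d * (|deriv h c| * L ^ (d - 1)), δ, M, by positivity, hδ, hδ1, hM3, ?_⟩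
  filter_upwards [eventually_ge_atTop 2, hcn.eventually hlim] with n hn hlimn p
  have hn2 : (2 : ℝ) ≤ n := by exact_mod_cast hn
  have hn0 : (0 : ℝ) < n := by linarith
  refine ⟨fun hx hxn ht => ?_, fun ht => (h0 p.1 p.2
    (Or.inr ((le_max_left _ _).trans_lt ht))).1 _ _ _⟩
  have hx0 : 0 < ‖p.1‖ := norm_pos_iff.2 hx
  have hx1 : ‖p.1‖ < 1 := by nlinarith
  obtain ⟨h1, h2, h3, h4, h5, -, -, h8⟩ := hb (n * ‖p.1‖) (n * p.2) (by positivity)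
  set V := L * n with hV
  have hV0 : 0 < V := by positivity
  have hT : max ((n : ℝ) * p.2) 0 ≤ n * M :=
    max_le (mul_le_mul_of_nonneg_left ((le_abs_self _).trans ht) hn0.le) (by positivity)
  have hTV : C * (1 + max ((n : ℝ) * p.2) 0) ≤ V := by
    rw [hV, hL, mul_assoc]
    gcongr
    nlinarith
  have hpow : (n : ℝ) ≤ n ^ (d - 1) := le_self_pow₀ (by linarith) (by omega)
  have hW : |radialIntegrand ψ (coreAmplitude φ lam r (n * ‖p.1‖) (n * p.2) / n) 0 0 p.1 p.2| ≤
      C' * L * n ^ (d - 1) := by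
    refine (hb' p.1 p.2 _ _ _).trans ?_
    rw [abs_zero, add_zero, add_zero, abs_of_pos (by positivity), mul_assoc]
    refine mul_le_mul_of_nonneg_left ?_ hC'.le
    refine le_trans ?_ (mul_le_mul_of_nonneg_left hpow hL0.le)
    refine (h5.trans hTV).trans' ?_
    exact div_le_div_of_nonneg_left h2.le (by positivity) (by nlinarith)
  have hW' := neg_le_of_abs_le hW
  obtain ⟨hP, hQ⟩ := neg_le_stress hh hd hc0 h1 (div_pos h2 (by positivity)) (h4.trans hTV)
    (h5.trans hTV) h3
  rw [hV, mul_pow, ← mul_assoc] at hP hQ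
  rw [mollifiedIntegrand, hψη _ _ _ _ _ hx hx1, coreRadialStress, coreHoopStress]
  set D := |deriv h c| * L ^ (d - 1) * (n : ℝ) ^ (d - 1) with hD
  have hD0 : 0 ≤ D := by positivity
  have hsplit : (C' * L + d * (|deriv h c| * L ^ (d - 1))) * (n : ℝ) ^ (d - 1) =
      C' * L * n ^ (d - 1) + d * D := by
    rw [hD]
    ring
  rw [hsplit]
  have hQ' := mul_le_mul_of_nonneg_left hQ (by linarith : (0 : ℝ) ≤ d - 1)
  constructor
  · have h9 : -(d * D) ≤ radialStress d h (coreStrain φ lam σ r (n * ‖p.1‖) (n * p.2))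
        (coreAmplitude φ lam r (n * ‖p.1‖) (n * p.2) / (n * ‖p.1‖)) + (d - 1) *
        hoopStress d h (coreStrain φ lam σ r (n * ‖p.1‖) (n * p.2))
        (coreAmplitude φ lam r (n * ‖p.1‖) (n * p.2) / (n * ‖p.1‖)) := by linarith
    have h10 := mul_le_mul_of_nonneg_left h9 (hη0 p.2)
    have h11 := mul_le_mul_of_nonneg_right (hη1 p.2) (by positivity : 0 ≤ d * D)
    linarith
  · intro hxδ htI
    rw [hη p.2 htI, one_mul]
    obtain ⟨hA, hB⟩ := h8 hxδ
    -- Here t ≥ 3/2 is used: by then the cavity, of size proportional to t, is open enough to force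
    -- strains of order n.
    have hTn : (n : ℝ) ≤ 1 + max ((n : ℝ) * p.2) 0 := by
      have := le_max_left ((n : ℝ) * p.2) 0
      nlinarith [htI.1]
    have hcT := mul_le_mul_of_nonneg_left hTn hc0.le
    replace hA := hcT.trans hA
    replace hB := hcT.trans hB
    have hP' : ε * c ^ d * n ^ d ≤ radialStress d h
        (coreStrain φ lam σ r (n * ‖p.1‖) (n * p.2))
        (coreAmplitude φ lam r (n * ‖p.1‖) (n * p.2) / (n * ‖p.1‖)) := by
      rw [radialStress]
      generalize coreStrain φ lam σ r (n * ‖p.1‖) (n * p.2) = A at *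
      generalize coreAmplitude φ lam r (n * ‖p.1‖) (n * p.2) / (n * ‖p.1‖) = B at *
      have hcn0 : 0 < c * (n : ℝ) := by positivity
      have hB0 : 0 < B := hcn0.trans_le hB
      have hdd : c * (n : ℝ) * (c * n) ^ (d - 1) = (c * n) ^ d := by
        rw [← pow_succ', Nat.sub_add_cancel (by omega)]
      have hv : (c * (n : ℝ)) ^ d ≤ A * B ^ (d - 1) := by
        rw [← hdd]
        gcongr
      have h9 := hh.strictMonoOn_deriv.monotoneOn (mem_Ioi.2 (by positivity))
        (mem_Ioi.2 (hc0.trans_le h3)) hv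
      have h10 := hlimn.trans h9
      calc ε * c ^ d * n ^ d = (c * n) ^ (d - 1) * (ε * (c * n)) := by
            rw [mul_assoc, ← mul_pow, ← hdd]
            ring
        _ ≤ B ^ (d - 1) * deriv h (A * B ^ (d - 1)) := by gcongr
        _ ≤ _ := le_add_of_nonneg_left h1.le
    linarith

/-- The slic limit and the exterior limit together force the core integral to 0, whereas the lower
bounds times the volumes keep it above κδ^dω - O(1/n), with ω the volume of the unit ball. -/
lemma not_isSlicSolution (hr : IsCavitatingProfile d h lam σ r) (hh : IsVolumetricEnergy h)
    (hlam : 0 < lam) (hd : 3 ≤ d)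
    (hlim : 0 < liminf (fun v : ℝ => ((deriv h (v ^ d) / v : ℝ) : EReal)) atTop) :
    ¬ IsSlicSolution d h lam (selfSimilarAmplitude lam r) := by
  intro hslic
  have : Nontrivial (EuclideanSpace ℝ (Fin d)) := nontrivial_euclideanSpace (by omega)
  obtain ⟨ε, hε, hlimε⟩ := eventually_mul_lt_of_liminf_pos (u := fun v => deriv h (v ^ d)) hlim
  obtain ⟨φ, hφ⟩ := exists_isRadialMollifier
  obtain ⟨ψ, η, hψ, hc, hη0, hη1, hη, hψη⟩ := exists_dilation_test_function d
  obtain ⟨κ, E, δ, M, hκ, hδ, hδ1, hM, hb⟩ :=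
    hr.exists_inner_lower_bound hh hlam (by omega) hφ hψ hc hη0 hη1 hη hψη hε hlimε
  set ω := volume.real (Metric.closedBall (0 : EuclideanSpace ℝ (Fin d)) 1) with hω
  have hω0 : 0 < ω := by
    rw [hω, Measure.real]
    exact ENNReal.toReal_pos (Metric.measure_closedBall_pos _ _ one_pos).ne'
      (isCompact_closedBall _ _).measure_ne_top
  have hinner : Tendsto (fun n : ℕ => ∫ p in {p : EuclideanSpace ℝ (Fin d) × ℝ | 1 < n * ‖p.1‖}ᶜ,
      mollifiedIntegrand h φ lam σ r ψ n p) atTop (𝓝 0) := by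
    have h1 := (hslic.momentum_limit φ hφ ψ hψ hc).2.sub
      (hr.tendsto_integral_outer hh hlam hd hφ hψ hc)
    rw [sub_zero] at h1
    refine h1.congr' ?_
    filter_upwards [eventually_ge_atTop 1] with n hn
    rw [(hr.integrable_momentumIntegrand_mollified hh hlam (by omega) hφ hψ hc hn).2,
      add_sub_cancel_left]
  -- The gain κn^d acts on a cylinder of volume (δ/n)^d ω and duration 1. The loss En^{d-1} acts on
  -- the whole core, of volume 2Mω/n^d, and so contributes only O(1/n).
  have hlower : Tendsto (fun n : ℕ => κ * δ ^ d * ω - E * (M - -M) * ω / n) atTop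
      (𝓝 (κ * δ ^ d * ω - 0)) :=
    tendsto_const_nhds.sub (tendsto_const_nhds.div_atTop tendsto_natCast_atTop_atTop)
  refine absurd (le_of_tendsto_of_tendsto hlower hinner ?_) (by rw [not_le]; simp; positivity)
  filter_upwards [hb, eventually_ge_atTop 1] with n hbn hn
  have hn0 : (0 : ℝ) < n := by exact_mod_cast hn
  set S : Set (EuclideanSpace ℝ (Fin d) × ℝ) := Metric.closedBall 0 (1 / n) ×ˢ Icc (-M) M with hS
  set S' : Set (EuclideanSpace ℝ (Fin d) × ℝ) :=
    Metric.closedBall 0 (δ / n) ×ˢ Icc (3 / 2) (5 / 2) with hS'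
  have hSm : MeasurableSet S := measurableSet_closedBall.prod measurableSet_Icc
  have hSm' : MeasurableSet S' := measurableSet_closedBall.prod measurableSet_Icc
  have hSS : S' ⊆ S := prod_mono (Metric.closedBall_subset_closedBall (by gcongr))
    (Icc_subset_Icc (by linarith) (by linarith))
  have hmem : ∀ (p : EuclideanSpace ℝ (Fin d) × ℝ) (a : ℝ), n * ‖p.1‖ ≤ a ↔ ‖p.1‖ ≤ a / n :=
    fun p a => by rw [le_div_iff₀ hn0, mul_comm]
  have hsub : S ⊆ {p : EuclideanSpace ℝ (Fin d) × ℝ | 1 < n * ‖p.1‖}ᶜ := fun p hp =>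
    not_lt.2 ((hmem p 1).2 (mem_closedBall_zero_iff.1 hp.1))
  rw [setIntegral_eq_of_subset_of_forall_sdiff_eq_zero (measurableSet_outer n).compl hsub
    fun p hp => (hbn p).2 (not_le.1 fun ht => hp.2
      ⟨mem_closedBall_zero_iff.2 ((hmem p 1).1 (not_lt.1 hp.1)), abs_le.1 ht⟩)]
  have hvol : volume.real S = (1 / n) ^ d * ω * (M - -M) :=
    volume_real_cylinder d (by positivity) (by linarith)
  have hvol' : volume.real S' = (δ / n) ^ d * ω * (5 / 2 - 3 / 2) :=
    volume_real_cylinder d (by positivity) (by norm_num)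
  have hI1 : IntegrableOn (S'.indicator fun _ => κ * (n : ℝ) ^ d) S :=
    ((integrable_indicator_iff hSm').2
      (integrableOn_const (volume_cylinder_ne_top d _ _ _))).integrableOn
  have hI2 : IntegrableOn (fun _ : EuclideanSpace ℝ (Fin d) × ℝ => E * (n : ℝ) ^ (d - 1)) S :=
    integrableOn_const (volume_cylinder_ne_top d _ _ _)
  calc κ * δ ^ d * ω - E * (M - -M) * ω / n
      = ∫ p in S, (S'.indicator (fun _ => κ * (n : ℝ) ^ d) p - E * (n : ℝ) ^ (d - 1)) := by
        rw [integral_sub hI1 hI2, setIntegral_indicator hSm', inter_eq_self_of_subset_right hSS,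
          setIntegral_const, setIntegral_const, hvol, hvol', smul_eq_mul, smul_eq_mul]
        have hnd : (n : ℝ) ^ d = n * n ^ (d - 1) := by
          rw [← pow_succ', Nat.sub_add_cancel (by omega)]
        rw [div_pow, one_div_pow, hnd]
        field_simp
        ring
    _ ≤ ∫ p in S, mollifiedIntegrand h φ lam σ r ψ n p := by
        refine setIntegral_mono_on_ae (hI1.sub hI2)
          (hr.integrable_mollifiedIntegrand hh hlam (by omega) hφ hψ hc hn).integrableOn hSm ?_
        filter_upwards [hr.ae_not_on_shock (by omega)] with p ⟨hx, _⟩ hp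
        obtain ⟨h1, h2⟩ := (hbn p).1 hx (not_lt.1 (hsub hp)) (abs_le.2 hp.2)
        by_cases hp' : p ∈ S'
        · rw [indicator_of_mem hp']
          exact h2 ((hmem p δ).2 (mem_closedBall_zero_iff.1 hp'.1)) hp'.2
        · rw [indicator_of_notMem hp', zero_sub]
          exact h1

end IsCavitatingProfile

end Divergence

theorem theorem3p8 (d : ℕ) (hd : 3 ≤ d) (h : ℝ → ℝ) (hh : IsVolumetricEnergy h)
    (lam : ℝ) (hlam : 0 < lam) (σ : ℝ) (r : ℝ → ℝ) (hr : IsCavitatingProfile d h lam σ r) :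
    IsWeakSolution h (radialMotion d (selfSimilarAmplitude lam r)) ∧
    (Tendsto (fun v : ℝ => deriv h (v ^ d) / v) atTop (𝓝 0) →
      IsSlicSolution d h lam (selfSimilarAmplitude lam r)) ∧
    (0 < liminf (fun v : ℝ => ((deriv h (v ^ d) / v : ℝ) : EReal)) atTop →
      ¬ IsSlicSolution d h lam (selfSimilarAmplitude lam r)) := by
  exact ⟨hr.isWeakSolution hh hlam hd, hr.isSlicSolution hh hlam hd,
    hr.not_isSlicSolution hh hlam hd⟩
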